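/- **Setting.** Let $p\ge 1$, $q\ge 0$ be integers and let $(\varepsilon_t)_{t\in\mathbb Z}$ be i.i.d. random variables with $E\varepsilon_0=0$, $E\varepsilon_0^2=1$. Let $0<\underline u<\bar u$, $0<\rho_0<1$, $q\underline u<\rho_0$. For $\mathbf u=(s_0,\dots,s_p,t_1,\dots,t_q)\in\mathbb R^{p+q+1}$ put $$\Theta=\{\mathbf u:\ t_1+\cdots+t_q\le\rho_0,\ \underline u\le\min(\mathbf s,\mathbf t)\le\max(\mathbf s,\mathbf t)\le\bar u\},$$ and assume that $\theta=(\alpha_0,\dots,\alpha_p,\beta_1,\dots,\beta_q)$ is in the interior of $\Theta$. Let $(X_t)_{t\in\mathbb Z}$ be a strictly stationary process with, almost surely for every $t\in\mathbb Z$, $$X_t=\sigma_t\varepsilon_t,\qquad \sigma_t^2=\alpha_0+\sum_{i=1}^p\alpha_iX_{t-i}^2+\sum_{j=1}^q\beta_j\sigma_{t-j}^2,\qquad \sigma_t\ge 0,$$ and assume the Bougerol–Picard stationarity condition: the top Lyapunov exponent $\gamma=\inf_{n\ge1}\frac1n E\log\|A_{n-1}\cdots A_1A_0\|$ is negative, where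 $A_t$ is the $(p+q)\times(p+q)$ matrix determined by $z_t=A_tz_{t-1}+b_t$ for $z_t=(X_t^2,\dots,X_{t-p+1}^2,\sigma_t^2,\dots,\sigma_{t-q+1}^2)^{\top}$: its row for $X_t^2$ is $\varepsilon_t^2(\alpha_1,\dots,\alpha_p,\beta_1,\dots,\beta_q)$, its row for $\sigma_t^2$ (when $q\ge1$) is $(\alpha_1,\dots,\alpha_p,\beta_1,\dots,\beta_q)$, its other rows are the shifts, and $b_t=(\alpha_0\varepsilon_t^2,0,\dots,0,\alpha_0,0,\dots,0)^{\top}$. Define $c_0(\mathbf u)=s_0/(1-(t_1+\cdots+t_q))$ and, for $i\ge1$, $c_i(\mathbf u)=s_i+\sum_{j=1}^{\min(q,i-1)}t_jc_{i-j}(\mathbf u)$, with $s_i:=0$ for $i>p$. Put $\sigma_t^2(\mathbf u)=c_0(\mathbf u)+\sum_{i\ge1}c_i(\mathbf u)X_{t-i}^2$ and $$\partial\log\sigma_t^2(\mathbf u)=\frac{\partial c_0(\mathbf u)+\sum_{i\ge1}\partial c_i(\mathbf u)X_{t-i}^2}{\sigma_t^2(\mathbf u)}\in\mathbb R^{p+q+1},$$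 where $\partial c_i$ is the gradient of $c_i$. Let $\hat\theta_n$ be an estimator of $\theta$, that is, a measurable function of $X_0,\dots,X_n$, and define the residuals $$\hat\varepsilon_t=\frac{X_t}{\hat\sigma_t},\qquad \hat\sigma_t^2=c_0(\hat\theta_n)+\sum_{i=1}^tc_i(\hat\theta_n)X_{t-i}^2,\qquad 1\le t\le n.$$ **Theorem 1.3.** Suppose that $\sqrt n\,|\hat\theta_n-\theta|=O_P(1)$ ($|\cdot|$ the maximum norm), that $\lim_{x\downarrow0}x^{-\zeta}P\{|\varepsilon_0|\le x\}=0$ for some $\zeta>0$, and that $E|\varepsilon_0|^k<\infty$ for an integer $k\ge1$. Then the series in $\sigma_0^2(\theta)$ and $\partial\log\sigma_0^2(\theta)$ converge almost surely, $$\psi_k(\mathbf u)=E\bigl|\langle\varepsilon_0^k\,\partial\log\sigma_0^2(\theta),\mathbf u\rangle\bigr|<\infty\qquad\text{for all }\mathbf u\in\mathbb R^{p+q+1},$$ and $$\left|\frac1{\sqrt n}\sum_{t=1}^n|\hat\varepsilon_t^k-\varepsilon_t^k|-\frac k2\,\psi_k\bigl(\sqrt n(\hat\theta_n-\theta)\bigr)\right|=o_P(1)\qquad(n\to\infty).$$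 -/

import Mathlib

open MeasureTheory ProbabilityTheory Filter Topology

noncomputable section

/-- Parameter vectors `u = (s₀, s₁, …, s_p, t₁, …, t_q) ∈ ℝ^{p+q+1}`: `u (Sum.inl i)` is `s_i` for
`0 ≤ i ≤ p` and `u (Sum.inr j)` is `t_{j+1}` for `0 ≤ j < q`. The norm of this function space is the
maximum norm. A GARCH parameter is `θ = (α₀, α₁, …, α_p, β₁, …, β_q)`. -/
abbrev GarchParam (p q : ℕ) : Type := Fin (p + 1) ⊕ Fin q → ℝ

/-- The parameter space
`Θ = {u : t₁ + ⋯ + t_q ≤ ρ₀, lo ≤ min(s, t) ≤ max(s, t) ≤ hi}`. -/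
def garchParamSpace (p q : ℕ) (lo hi ρ₀ : ℝ) : Set (GarchParam p q) :=
  {u | ∑ j : Fin q, u (Sum.inr j) ≤ ρ₀ ∧ ∀ a, lo ≤ u a ∧ u a ≤ hi}

/-- The coefficients `c_i(u)`: `c₀(u) = s₀ / (1 - (t₁ + ⋯ + t_q))` and, for `i ≥ 1`,
`c_i(u) = s_i + ∑_{1 ≤ j ≤ min(q, i - 1)} t_j c_{i-j}(u)`, where `s_i` is read as `0` for `i > p`. -/
def garchCoef {p q : ℕ} (u : GarchParam p q) : ℕ → ℝ
  | 0 => u (Sum.inl 0) / (1 - ∑ j : Fin q, u (Sum.inr j))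
  | i + 1 =>
    (if h : i + 1 ≤ p then u (Sum.inl ⟨i + 1, Nat.lt_succ_of_le h⟩) else 0) +
      ∑ j : Fin q, if (j : ℕ) < i then u (Sum.inr j) * garchCoef u (i - j) else 0
  termination_by i => i
  decreasing_by omega

/-- The partial derivative of `c_i` at `u` in the coordinate `a`. -/
def garchCoefDeriv {p q : ℕ} (u : GarchParam p q) (i : ℕ) (a : Fin (p + 1) ⊕ Fin q) : ℝ :=
  fderiv ℝ (fun v : GarchParam p q => garchCoef v i) u (Pi.single a 1)

/-- `σ_t²(u) = c₀(u) + ∑_{i ≥ 1} c_i(u) X_{t-i}²`, for one trajectory `x` of the process `X`. -/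
def garchSigmaSq {p q : ℕ} (u : GarchParam p q) (x : ℤ → ℝ) (t : ℤ) : ℝ :=
  garchCoef u 0 + ∑' i : ℕ, garchCoef u (i + 1) * x (t - (i + 1)) ^ 2

/-- The vector `∂ log σ_t²(u) =
(∂c₀(u) + ∑_{i ≥ 1} ∂c_i(u) X_{t-i}²) / (c₀(u) + ∑_{i ≥ 1} c_i(u) X_{t-i}²)`. -/
def garchDLogSigmaSq {p q : ℕ} (u : GarchParam p q) (x : ℤ → ℝ) (t : ℤ) : GarchParam p q :=
  fun a => (garchCoefDeriv u 0 a + ∑' i : ℕ, garchCoefDeriv u (i + 1) a * x (t - (i + 1)) ^ 2) /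
    garchSigmaSq u x t

/-- The truncated conditional variance `σ̂_t² = c₀(u) + ∑_{i=1}^t c_i(u) X_{t-i}²`; it involves
`X_0, …, X_{t-1}` only. -/
def garchSigmaSqHat {p q : ℕ} (u : GarchParam p q) (x : ℤ → ℝ) (t : ℕ) : ℝ :=
  garchCoef u 0 + ∑ i ∈ Finset.Icc 1 t, garchCoef u i * x ((t : ℤ) - i) ^ 2

/-- The residual `ε̂_t = X_t / σ̂_t` computed with the parameter value `u`. -/
def garchResidual {p q : ℕ} (u : GarchParam p q) (x : ℤ → ℝ) (t : ℕ) : ℝ :=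
  x t / Real.sqrt (garchSigmaSqHat u x t)

/-- The row `(α₁, …, α_p, β₁, …, β_q)`. -/
def garchRow {p q : ℕ} (θ : GarchParam p q) : Fin p ⊕ Fin q → ℝ :=
  Sum.elim (fun i => θ (Sum.inl i.succ)) (fun j => θ (Sum.inr j))

/-- The matrix `A(e)` of the Markovian form `z_t = A(ε_t) z_{t-1} + b(ε_t)` of the GARCH equations,
with `z_t = (X_t², …, X_{t-p+1}², σ_t², …, σ_{t-q+1}²)`. -/
def garchMatrix {p q : ℕ} (θ : GarchParam p q) (e : ℝ) :
    Matrix (Fin p ⊕ Fin q) (Fin p ⊕ Fin q) ℝ :=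
  Matrix.of fun r c =>
    match r with
    | Sum.inl i =>
      if (i : ℕ) = 0 then e ^ 2 * garchRow θ c
      else Sum.elim (fun i' : Fin p => if (i' : ℕ) + 1 = i then 1 else 0) (fun _ => 0) c
    | Sum.inr j =>
      if (j : ℕ) = 0 then garchRow θ c
      else Sum.elim (fun _ => 0) (fun j' : Fin q => if (j' : ℕ) + 1 = j then 1 else 0) c

/-- The product `A(e_{n-1}) ⋯ A(e_1) A(e_0)`. -/
def garchMatrixProd {p q : ℕ} (θ : GarchParam p q) (e : ℤ → ℝ) :
    ℕ → Matrix (Fin p ⊕ Fin q) (Fin p ⊕ Fin q) ℝ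
  | 0 => 1
  | n + 1 => garchMatrix θ (e n) * garchMatrixProd θ e n

section Lyapunov

attribute [local instance] Matrix.linftyOpNormedAddCommGroup

/-- The top Lyapunov exponent `γ = inf_{n ≥ 1} (1/n) E log ‖A(ε_{n-1}) ⋯ A(ε_0)‖`, with the operator
norm that belongs to the maximum norm on vectors. -/
def garchLyapunov {p q : ℕ} {Ω : Type*} [MeasurableSpace Ω] (μ : Measure Ω) (θ : GarchParam p q)
    (ε : ℤ → Ω → ℝ) : ℝ :=
  ⨅ n : ℕ, (1 / ((n : ℝ) + 1)) *
    ∫ ω, Real.log ‖garchMatrixProd θ (fun t => ε t ω) (n + 1)‖ ∂μ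

end Lyapunov

/-- The innovations are i.i.d. random variables with mean `0` and variance `1`. -/
structure IsGarchInnovation {Ω : Type*} [MeasurableSpace Ω] (μ : Measure Ω) (ε : ℤ → Ω → ℝ) :
    Prop where
  measurable : ∀ t, Measurable (ε t)
  indep : iIndepFun ε μ
  identDistrib : ∀ t, IdentDistrib (ε t) (ε 0) μ μ
  mean_zero : ∫ ω, ε 0 ω ∂μ = 0
  variance_one : ∫ ω, ε 0 ω ^ 2 ∂μ = 1

/-- `X` is a strictly stationary solution of the GARCH(p, q) equations with parameter `θ`,
innovations `ε` and volatilities `σ`. -/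
structure IsStationaryGarch {p q : ℕ} {Ω : Type*} [MeasurableSpace Ω] (μ : Measure Ω)
    (θ : GarchParam p q) (ε σ X : ℤ → Ω → ℝ) : Prop where
  measurable_X : ∀ t, Measurable (X t)
  measurable_σ : ∀ t, Measurable (σ t)
  σ_nonneg : ∀ t, ∀ᵐ ω ∂μ, 0 ≤ σ t ω
  X_eq : ∀ t, ∀ᵐ ω ∂μ, X t ω = σ t ω * ε t ω
  σ_sq_eq : ∀ t, ∀ᵐ ω ∂μ, σ t ω ^ 2 = θ (Sum.inl 0) +
    ∑ i : Fin p, θ (Sum.inl i.succ) * X (t - ((i : ℤ) + 1)) ω ^ 2 +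
    ∑ j : Fin q, θ (Sum.inr j) * σ (t - ((j : ℤ) + 1)) ω ^ 2
  stationary : ∀ h : ℤ, IdentDistrib (fun ω t => X (t + h) ω) (fun ω t => X t ω) μ μ

/-- `Z_n = O_P(1)` for nonnegative `Z_n`. -/
def IsBigOInProb {Ω : Type*} [MeasurableSpace Ω] (μ : Measure Ω) (Z : ℕ → Ω → ℝ) : Prop :=
  ∀ η : ℝ, 0 < η → ∃ M : ℝ, ∀ᶠ n in atTop, μ.real {ω | M < Z n ω} ≤ η

/-- The random variable `ε_0^k ⟨∂ log σ_0²(θ), u⟩`. -/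
def garchPsiIntegrand {p q : ℕ} {Ω : Type*} (k : ℕ) (θ : GarchParam p q) (ε X : ℤ → Ω → ℝ)
    (u : GarchParam p q) (ω : Ω) : ℝ :=
  ∑ a, ε 0 ω ^ k * garchDLogSigmaSq θ (fun t => X t ω) 0 a * u a

/-- `ψ_k(u) = E |⟨ε_0^k ∂ log σ_0²(θ), u⟩|`. -/
def garchPsi {p q : ℕ} {Ω : Type*} [MeasurableSpace Ω] (μ : Measure Ω) (k : ℕ)
    (θ : GarchParam p q) (ε X : ℤ → Ω → ℝ) (u : GarchParam p q) : ℝ :=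
  ∫ ω, |garchPsiIntegrand k θ ε X u ω| ∂μ

end

/-! Put h = θ̂_n − θ. Since X_t = σ_t(θ)ε_t, the t-th term is |ε_t|^k |(σ_t²(θ)/σ̂_t²)^{k/2} − 1|.
Expanding in h gives (k/2)|⟨ε_t^k ∂log σ_t²(θ), h⟩|, a quadratic error, and the error of cutting the
series at time 0 (`exists_residual_expansion`). After division by √n, the linear part is an
empirical mean of |⟨W_t, √n h⟩|, and a law of large numbers uniform over bounded sets of directions
(`exists_majorant_abs_linear_mean`) replaces it by ψ_k(√n h). On the event |h| ≤ B/√n the quadratic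
errors have mean O(1/n) each, hence O(n^{-1/2}) in total after scaling. The cutting errors add up to
an almost surely finite variable, which 1/√n kills (`tendstoInMeasure_residual`).

The difficulty is that X_t is only known to have a small fractional moment, while the quadratic
error needs a finite mean. Relative to c_i(θ), a perturbation of θ changes c_i by factors of order
κ^i, with κ > 1 as close to 1 as desired (`garchCoef_local`). So ratios of volatilities are
controlled by the mean of κ^i under the weights c_i X_{t-i}²/σ_t². Cauchy–Schwarz
(`sq_tsum_le_mul_tsum`) bounds the perturbed volatility from below, and Jensen
(`pow_weighted_tsum_le`) turns powers of this mean into `garchTilt` with a slightly larger base K.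
Each weight lies in [0,1] and is at most a constant times ρ^i X_{t-i}², hence at most the s-th power
of that bound; the tilt is therefore integrable once E|X|^{2s} is finite (`integrable_garchTilt`).
It depends on innovations before t only, so the factor |ε_t|^k is independent of it.

The fractional moment comes from the negative Lyapunov exponent: some block of matrices has s-th
moment below one, so the s-th moments of the products are summable
(`IsGarchInnovation.exists_tsum_prodMoment_ne_top`) and the state is a convergent series in past
innovations (`IsStationaryGarch.exists_isPastFactor`). Every variable in sight is then F(ε_t,
ε_{t-1}, …) with one F, and the law of large numbers for such processes follows in L¹ from cylinder
functions by approximation (`IsPastFactor.tendsto_integral_abs_mean_sub`). -/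

noncomputable section

open scoped ENNReal

/-! ### Law of large numbers in L¹ for functionals of an i.i.d. past. -/

section PastSequence

set_option linter.unusedSectionVars false

variable {Ω : Type*} [MeasurableSpace Ω] {μ : Measure Ω} {ε : ℤ → Ω → ℝ}

/-- The sequence `(ε_t, ε_{t-1}, …)`. -/
def pastSeq (ε : ℤ → Ω → ℝ) (t : ℤ) (ω : Ω) : ℕ → ℝ := fun i => ε (t - i) ω

/-- The σ-algebra generated by the variables `ε_i`, `i ∈ S`. -/
abbrev sigmaOn (ε : ℤ → Ω → ℝ) (S : Set ℤ) : MeasurableSpace Ω :=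
  ⨆ i ∈ S, MeasurableSpace.comap (ε i) inferInstance

lemma measurable_sigmaOn {S : Set ℤ} {i : ℤ} (hi : i ∈ S) : Measurable[sigmaOn ε S] (ε i) := by
  rw [measurable_iff_comap_le]
  exact le_iSup₂_of_le i hi le_rfl

lemma measurable_sigmaOn_pastSeq (t : ℤ) : Measurable[sigmaOn ε (Set.Iic t)] (pastSeq ε t) := by
  rw [@measurable_pi_iff]
  intro i
  exact measurable_sigmaOn (by simp)

lemma IsGarchInnovation.indepFun_of_measurable (hε : IsGarchInnovation μ ε) {β γ : Type*}
    [mβ : MeasurableSpace β] [mγ : MeasurableSpace γ] {S T : Set ℤ} (hST : Disjoint S T)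
    {f : Ω → β} {g : Ω → γ} (hf : Measurable[sigmaOn ε S] f) (hg : Measurable[sigmaOn ε T] g) :
    IndepFun f g μ := by
  have h := indep_iSup_of_disjoint (fun i => (hε.measurable i).comap_le)
    ((iIndepFun_iff_iIndep _ _ _).1 hε.indep) hST
  rw [IndepFun_iff_Indep]
  exact indep_of_indep_of_le_left (indep_of_indep_of_le_right h (measurable_iff_comap_le.1 hg))
    (measurable_iff_comap_le.1 hf)

lemma IsGarchInnovation.measurable_pastSeq (hε : IsGarchInnovation μ ε) (t : ℤ) :
    Measurable (pastSeq ε t) := by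
  rw [measurable_pi_iff]
  exact fun i => hε.measurable _

/-- Every past sequence is distributed as the infinite product of copies of the law of ε_0, which
does not involve t. All stationarity used below, except that assumed of X, comes from here. -/
lemma IsGarchInnovation.map_pastSeq [IsProbabilityMeasure μ] (hε : IsGarchInnovation μ ε) (t : ℤ) :
    μ.map (pastSeq ε t) = μ.map (pastSeq ε 0) := by
  have key : ∀ t : ℤ, μ.map (pastSeq ε t) = Measure.infinitePi (fun _ : ℕ => μ.map (ε 0)) := by
    intro t
    have h1 : iIndepFun (fun i : ℕ => ε (t - i)) μ :=
      hε.indep.precomp (g := fun i : ℕ => t - (i : ℤ)) (fun a b h => by simpa using h)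
    have h2 := h1.map_fun_eq_infinitePi_map (fun i => hε.measurable _)
    have h3 : (fun i : ℕ => μ.map (ε (t - i))) = fun _ => μ.map (ε 0) :=
      funext fun i => (hε.identDistrib _).map_eq
    rw [h3] at h2
    exact h2
  rw [key, key]

lemma IsGarchInnovation.measurePreserving_pastSeq [IsProbabilityMeasure μ]
    (hε : IsGarchInnovation μ ε) (t : ℤ) :
    MeasurePreserving (pastSeq ε t) μ (μ.map (pastSeq ε 0)) :=
  ⟨hε.measurable_pastSeq t, hε.map_pastSeq t⟩

/-- The integrated deviation of the empirical mean of `F(ε_t, ε_{t-1}, …)`, `1 ≤ t ≤ n`, from the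
expectation. -/
def meanDefect (μ : Measure Ω) (ε : ℤ → Ω → ℝ) (F : (ℕ → ℝ) → ℝ) (n : ℕ) : ℝ :=
  ∫ ω, |(n : ℝ)⁻¹ * ∑ t ∈ Finset.Icc 1 n, F (pastSeq ε t ω) - ∫ e, F e ∂(μ.map (pastSeq ε 0))| ∂μ

lemma IsGarchInnovation.integrable_comp_pastSeq [IsProbabilityMeasure μ]
    (hε : IsGarchInnovation μ ε) {F : (ℕ → ℝ) → ℝ} (hF : Integrable F (μ.map (pastSeq ε 0)))
    (t : ℤ) : Integrable (fun ω => F (pastSeq ε t ω)) μ :=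
  (hε.measurePreserving_pastSeq t).integrable_comp_of_integrable hF

lemma IsGarchInnovation.integral_comp_pastSeq [IsProbabilityMeasure μ]
    (hε : IsGarchInnovation μ ε) {F : (ℕ → ℝ) → ℝ} (hF : Integrable F (μ.map (pastSeq ε 0)))
    (t : ℤ) : ∫ ω, F (pastSeq ε t ω) ∂μ = ∫ e, F e ∂(μ.map (pastSeq ε 0)) := by
  rw [← hε.map_pastSeq t, integral_map (hε.measurable_pastSeq t).aemeasurable]
  rw [hε.map_pastSeq t]
  exact hF.1

lemma IsGarchInnovation.integrable_mean [IsProbabilityMeasure μ]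
    (hε : IsGarchInnovation μ ε) {F : (ℕ → ℝ) → ℝ} (hF : Integrable F (μ.map (pastSeq ε 0)))
    (n : ℕ) : Integrable (fun ω => (n : ℝ)⁻¹ * ∑ t ∈ Finset.Icc 1 n, F (pastSeq ε t ω) -
      ∫ e, F e ∂(μ.map (pastSeq ε 0))) μ :=
  ((integrable_finsetSum _ fun t _ => hε.integrable_comp_pastSeq hF _).const_mul _).sub
    (integrable_const _)

lemma meanDefect_nonneg (F : (ℕ → ℝ) → ℝ) (n : ℕ) : 0 ≤ meanDefect μ ε F n :=
  integral_nonneg fun _ => abs_nonneg _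

lemma IsGarchInnovation.meanDefect_add_le [IsProbabilityMeasure μ]
    (hε : IsGarchInnovation μ ε) {F G : (ℕ → ℝ) → ℝ} (hF : Integrable F (μ.map (pastSeq ε 0)))
    (hG : Integrable G (μ.map (pastSeq ε 0))) (n : ℕ) :
    meanDefect μ ε (F + G) n ≤ meanDefect μ ε F n + meanDefect μ ε G n := by
  unfold meanDefect
  rw [← integral_add (hε.integrable_mean hF n).abs (hε.integrable_mean hG n).abs]
  refine integral_mono (hε.integrable_mean (hF.add hG) n).abs
    ((hε.integrable_mean hF n).abs.add (hε.integrable_mean hG n).abs) fun ω => ?_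
  refine le_of_eq_of_le ?_ (abs_add_le _ _)
  have : ∫ e, (F + G) e ∂(μ.map (pastSeq ε 0)) = _ := integral_add hF hG
  rw [this]
  simp only [Pi.add_apply, Finset.sum_add_distrib]
  congr 1
  ring

lemma meanDefect_const_smul (c : ℝ) (F : (ℕ → ℝ) → ℝ) (n : ℕ) :
    meanDefect μ ε (fun e => c * F e) n = |c| * meanDefect μ ε F n := by
  unfold meanDefect
  rw [← integral_const_mul]
  congr 1
  funext ω
  rw [← abs_mul, integral_const_mul, ← Finset.mul_sum]
  congr 1
  ring

lemma IsGarchInnovation.meanDefect_le_norm [IsProbabilityMeasure μ]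
    (hε : IsGarchInnovation μ ε) {F : (ℕ → ℝ) → ℝ} (hF : Integrable F (μ.map (pastSeq ε 0)))
    (n : ℕ) : meanDefect μ ε F n ≤ 2 * ∫ e, |F e| ∂(μ.map (pastSeq ε 0)) := by
  set P := μ.map (pastSeq ε 0)
  have h1 : meanDefect μ ε F n ≤
      ∫ ω, ((n : ℝ)⁻¹ * ∑ t ∈ Finset.Icc 1 n, |F (pastSeq ε t ω)| + ∫ e, |F e| ∂P) ∂μ := by
    refine integral_mono (hε.integrable_mean hF n).abs
      (((integrable_finsetSum _ fun t _ => (hε.integrable_comp_pastSeq hF _).abs).const_mul _).add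
        (integrable_const _)) fun ω => ?_
    refine (abs_sub _ _).trans (add_le_add ?_ (abs_integral_le_integral_abs))
    rw [abs_mul, abs_of_nonneg (by positivity : (0 : ℝ) ≤ (n : ℝ)⁻¹)]
    exact mul_le_mul_of_nonneg_left (Finset.abs_sum_le_sum_abs _ _) (by positivity)
  refine h1.trans ?_
  rw [integral_add ((integrable_finsetSum _ fun t _ =>
    (hε.integrable_comp_pastSeq hF _).abs).const_mul _) (integrable_const _), integral_const_mul,
    integral_finsetSum _ fun t _ => (hε.integrable_comp_pastSeq hF _).abs]
  have h2 : ∀ t ∈ Finset.Icc 1 n, ∫ ω, |F (pastSeq ε t ω)| ∂μ = ∫ e, |F e| ∂P := fun t _ =>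
    hε.integral_comp_pastSeq hF.abs t
  rw [Finset.sum_congr rfl h2]
  have h3 : 0 ≤ ∫ e, |F e| ∂P := integral_nonneg fun _ => abs_nonneg _
  have h4 : (n : ℝ)⁻¹ * (n * ∫ e, |F e| ∂P) ≤ ∫ e, |F e| ∂P := by
    rw [← mul_assoc]
    exact mul_le_of_le_one_left h3 inv_mul_le_one
  simp only [Finset.sum_const, Nat.card_Icc, nsmul_eq_mul, integral_const, probReal_univ, one_smul,
    Nat.add_sub_cancel]
  linarith

/-- The defect is subadditive and at most twice the L¹ norm, so the functionals obeying the law of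
large numbers are closed in L¹. This reduces the law to functions of finitely many coordinates. -/
lemma IsGarchInnovation.tendsto_meanDefect_of_approx [IsProbabilityMeasure μ]
    (hε : IsGarchInnovation μ ε) {F : (ℕ → ℝ) → ℝ} (hF : Integrable F (μ.map (pastSeq ε 0)))
    (h : ∀ η : ℝ, 0 < η → ∃ G, Integrable G (μ.map (pastSeq ε 0)) ∧
      Tendsto (meanDefect μ ε G) atTop (𝓝 0) ∧
      ∫ e, |F e - G e| ∂(μ.map (pastSeq ε 0)) ≤ η) :
    Tendsto (meanDefect μ ε F) atTop (𝓝 0) := by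
  rw [Metric.tendsto_atTop]
  intro η hη
  obtain ⟨G, hG, hG0, hFG⟩ := h (η / 4) (by positivity)
  obtain ⟨N, hN⟩ := Metric.tendsto_atTop.1 hG0 (η / 2) (by positivity)
  refine ⟨N, fun n hn => ?_⟩
  have h1 := hN n hn
  rw [Real.dist_0_eq_abs, abs_of_nonneg (meanDefect_nonneg _ _)] at h1 ⊢
  have h2 := hε.meanDefect_add_le hG (hF.sub hG) n
  rw [add_sub_cancel] at h2
  have h3 := hε.meanDefect_le_norm (hF.sub hG) n
  simp only [Pi.sub_apply] at h3
  linarith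

/-- A bounded function of finitely many coordinates satisfies the law of large numbers. -/
lemma IsGarchInnovation.tendsto_meanDefect_cylinder [IsProbabilityMeasure μ]
    (hε : IsGarchInnovation μ ε) {I : Finset ℕ} {S : Set (I → ℝ)} (hS : MeasurableSet S) :
    Tendsto (meanDefect μ ε ((cylinder (α := fun _ => ℝ) I S).indicator fun _ => (1 : ℝ)))
      atTop (𝓝 0) := by
  set F : (ℕ → ℝ) → ℝ := (cylinder (α := fun _ => ℝ) I S).indicator fun _ => (1 : ℝ) with hFdef
  have hFm : Measurable F := measurable_const.indicator (hS.cylinder I)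
  have hF0 : ∀ e, 0 ≤ F e := fun e => Set.indicator_nonneg (fun _ _ => zero_le_one) e
  have hF1 : ∀ e, F e ≤ 1 := fun e => Set.indicator_le_self' (fun _ _ => zero_le_one) e
  -- The base of the cylinder uses coordinates below m, so V_t depends on ε over (t − m, t] only:
  -- the sequence is m-dependent.
  obtain ⟨m, hm⟩ : ∃ m : ℕ, ∀ i ∈ I, i < m := ⟨I.sup id + 1, fun i hi =>
    Nat.lt_succ_of_le (Finset.le_sup (f := id) hi)⟩
  set V : ℕ → Ω → ℝ := fun t ω => F (pastSeq ε t ω)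
  have hVm : ∀ t, Measurable (V t) := fun t => hFm.comp (hε.measurable_pastSeq t)
  have hVL : ∀ t, MemLp (V t) 2 μ := fun t =>
    MemLp.of_bound (hVm t).aestronglyMeasurable 1 (ae_of_all _ fun ω => by
      rw [Real.norm_eq_abs, abs_of_nonneg (hF0 _)]; exact hF1 _)
  have hFi : Integrable F (μ.map (pastSeq ε 0)) := by
    have := Measure.isProbabilityMeasure_map (μ := μ) (hε.measurable_pastSeq 0).aemeasurable
    exact Integrable.of_bound hFm.aestronglyMeasurable 1 (ae_of_all _ fun e => by
      rw [Real.norm_eq_abs, abs_of_nonneg (hF0 _)]; exact hF1 _)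
  set a := ∫ e, F e ∂(μ.map (pastSeq ε 0))
  have hVa : ∀ t, ∫ ω, V t ω ∂μ = a := fun t => hε.integral_comp_pastSeq hFi t
  have ha0 : 0 ≤ a := integral_nonneg hF0
  have ha1 : a ≤ 1 := by
    rw [← hVa 0]
    calc ∫ ω, V 0 ω ∂μ ≤ ∫ ω, (1 : ℝ) ∂μ := integral_mono
          (hε.integrable_comp_pastSeq hFi _) (integrable_const _) fun ω => hF1 _
      _ = 1 := by simp
  have hVS : ∀ t : ℕ, Measurable[sigmaOn ε (Set.Ioc ((t : ℤ) - m) t)] (V t) := by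
    intro t
    have : V t = S.indicator (fun _ => (1 : ℝ)) ∘ fun ω => fun i : I => ε (t - (i : ℕ)) ω := by
      funext ω
      rfl
    rw [this]
    refine (measurable_const.indicator hS).comp ?_
    rw [@measurable_pi_iff]
    intro i
    have := hm i i.2
    exact measurable_sigmaOn (by simp only [Set.mem_Ioc]; omega)
  have hcov0 : ∀ s t : ℕ, s + m ≤ t ∨ t + m ≤ s → cov[V s, V t; μ] = 0 := by
    intro s t hst
    refine IndepFun.covariance_eq_zero ?_ (hVL s) (hVL t)
    refine hε.indepFun_of_measurable ?_ (hVS s) (hVS t)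
    rw [Set.disjoint_left]
    intro x hx hx'
    simp only [Set.mem_Ioc] at hx hx'
    omega
  have hcov1 : ∀ s t : ℕ, cov[V s, V t; μ] ≤ 1 := by
    intro s t
    unfold covariance
    rw [hVa, hVa]
    calc ∫ ω, (V s ω - a) * (V t ω - a) ∂μ ≤ ∫ ω, (1 : ℝ) ∂μ := by
          refine integral_mono (((hVL s).sub (memLp_const a)).integrable_mul
            ((hVL t).sub (memLp_const a))) (integrable_const _) fun ω => ?_
          have h1 : |V s ω - a| ≤ 1 := by
            rw [abs_le]; constructor <;> linarith [hF0 (pastSeq ε s ω), hF1 (pastSeq ε s ω)]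
          have h2 : |V t ω - a| ≤ 1 := by
            rw [abs_le]; constructor <;> linarith [hF0 (pastSeq ε t ω), hF1 (pastSeq ε t ω)]
          calc (V s ω - a) * (V t ω - a) ≤ |(V s ω - a) * (V t ω - a)| := le_abs_self _
            _ = |V s ω - a| * |V t ω - a| := abs_mul _ _
            _ ≤ 1 := mul_le_one₀ h1 (abs_nonneg _) h2
      _ = 1 := by simp
  -- For each s, at most 2m indices t give a nonzero covariance, and each covariance is at most 1.
  have hvar : ∀ n : ℕ, Var[∑ t ∈ Finset.Icc 1 n, V t; μ] ≤ n * (2 * m) := by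
    intro n
    rw [variance_sum' fun t _ => hVL t]
    calc ∑ s ∈ Finset.Icc 1 n, ∑ t ∈ Finset.Icc 1 n, cov[V s, V t; μ]
        ≤ ∑ s ∈ Finset.Icc 1 n, (2 * m : ℝ) := by
          refine Finset.sum_le_sum fun s _ => ?_
          calc ∑ t ∈ Finset.Icc 1 n, cov[V s, V t; μ]
              ≤ ∑ t ∈ Finset.Icc 1 n, if t ∈ Finset.Ico (s + 1 - m) (s + m) then (1 : ℝ) else 0 := by
                refine Finset.sum_le_sum fun t _ => ?_
                split_ifs with h
                · exact hcov1 s t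
                · refine (hcov0 s t ?_).le
                  simp only [Finset.mem_Ico, not_and_or, not_le, not_lt] at h
                  omega
            _ = ((Finset.Icc 1 n).filter (· ∈ Finset.Ico (s + 1 - m) (s + m))).card := by
                rw [Finset.sum_ite, Finset.sum_const_zero, add_zero, Finset.sum_const,
                  nsmul_eq_mul, mul_one]
            _ ≤ (Finset.Ico (s + 1 - m) (s + m)).card := by
                exact_mod_cast Finset.card_le_card fun x hx => (Finset.mem_filter.1 hx).2
            _ ≤ (2 * m : ℝ) := by
                rw [Nat.card_Ico]
                exact_mod_cast (by omega : s + m - (s + 1 - m) ≤ 2 * m)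
      _ = n * (2 * m) := by simp
  -- The inequality |D| ≤ η + D²/η converts the O(1/n) variance of the mean into an L¹ bound, with η
  -- free.
  have hbound : ∀ n : ℕ, 1 ≤ n → ∀ η : ℝ, 0 < η →
      meanDefect μ ε F n ≤ η + η⁻¹ * ((n : ℝ)⁻¹ * (2 * m)) := by
    intro n hn η hη
    have hn' : (0 : ℝ) < n := by exact_mod_cast hn
    set D : Ω → ℝ := fun ω => (n : ℝ)⁻¹ * ∑ t ∈ Finset.Icc 1 n, V t ω - a
    have hDeq : ∀ ω, D ω = (n : ℝ)⁻¹ * ((∑ t ∈ Finset.Icc 1 n, V t) ω - n * a) := by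
      intro ω
      simp only [D, Finset.sum_apply]
      field_simp
    have hsumL : MemLp (∑ t ∈ Finset.Icc 1 n, V t) 2 μ := memLp_finsetSum' _ fun t _ => hVL t
    have hE : ∫ ω, (∑ t ∈ Finset.Icc 1 n, V t) ω ∂μ = n * a := by
      have h1 : ∫ ω, (∑ t ∈ Finset.Icc 1 n, V t) ω ∂μ = ∫ ω, ∑ t ∈ Finset.Icc 1 n, V t ω ∂μ :=
        integral_congr_ae (ae_of_all _ fun ω => Finset.sum_apply _ _ _)
      rw [h1, integral_finsetSum _ fun t _ => hε.integrable_comp_pastSeq hFi _,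
        Finset.sum_congr rfl fun t _ => hVa t]
      simp
    have hD2 : ∫ ω, D ω ^ 2 ∂μ ≤ (n : ℝ)⁻¹ * (2 * m) := by
      have : ∫ ω, D ω ^ 2 ∂μ = (n : ℝ)⁻¹ ^ 2 * Var[∑ t ∈ Finset.Icc 1 n, V t; μ] := by
        rw [variance_eq_integral hsumL.aemeasurable, hE, ← integral_const_mul]
        congr 1
        funext ω
        rw [hDeq, mul_pow]
      rw [this]
      calc (n : ℝ)⁻¹ ^ 2 * Var[∑ t ∈ Finset.Icc 1 n, V t; μ] ≤ (n : ℝ)⁻¹ ^ 2 * (n * (2 * m)) :=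
            mul_le_mul_of_nonneg_left (hvar n) (by positivity)
        _ = _ := by field_simp
    have hDL : MemLp D 2 μ := by
      have : D = fun ω => (n : ℝ)⁻¹ * ((∑ t ∈ Finset.Icc 1 n, V t) ω - n * a) := funext hDeq
      rw [this]
      exact (hsumL.sub (memLp_const _)).const_mul _
    have hint := hDL.integrable_sq
    calc meanDefect μ ε F n = ∫ ω, |D ω| ∂μ := rfl
      _ ≤ ∫ ω, (η + η⁻¹ * D ω ^ 2) ∂μ := by
          refine integral_mono (hDL.integrable one_le_two).abs
            ((integrable_const _).add (hint.const_mul _)) fun ω => ?_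
          have h1 : 0 ≤ η⁻¹ * (|D ω| - η) ^ 2 := by positivity
          have h2 : η⁻¹ * (|D ω| - η) ^ 2 = η⁻¹ * D ω ^ 2 - 2 * |D ω| + η := by
            rw [sub_sq, sq_abs]; field_simp
          have h3 := abs_nonneg (D ω)
          show |D ω| ≤ η + η⁻¹ * D ω ^ 2
          linarith
      _ = η + η⁻¹ * ∫ ω, D ω ^ 2 ∂μ := by
          rw [integral_add (integrable_const _) (hint.const_mul _), integral_const_mul]
          simp
      _ ≤ _ := by gcongr
  rw [Metric.tendsto_atTop]
  intro η hη
  have hlim : Tendsto (fun n : ℕ => η / 2 + (η / 2)⁻¹ * ((n : ℝ)⁻¹ * (2 * m))) atTop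
      (𝓝 (η / 2 + (η / 2)⁻¹ * (0 * (2 * m)))) :=
    ((tendsto_inv_atTop_nhds_zero_nat.mul_const _).const_mul _).const_add _
  have hev := hlim.eventually_lt_const (u := η) (by simp; linarith)
  obtain ⟨N, hN⟩ := eventually_atTop.1 (hev.and (eventually_ge_atTop 1))
  refine ⟨N, fun n hn => ?_⟩
  rw [Real.dist_0_eq_abs, abs_of_nonneg (meanDefect_nonneg _ _)]
  exact (hbound n (hN n hn).2 _ (by positivity)).trans_lt (hN n hn).1

/-- Measurable cylinders form an algebra generating the product σ-algebra, hence approximate every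
measurable set in measure. Indicators thus inherit the law from cylinders, and integrable
functionals inherit it through linear combinations and L¹ limits. -/
lemma IsGarchInnovation.tendsto_meanDefect [IsProbabilityMeasure μ]
    (hε : IsGarchInnovation μ ε) {F : (ℕ → ℝ) → ℝ} (hF : Integrable F (μ.map (pastSeq ε 0))) :
    Tendsto (meanDefect μ ε F) atTop (𝓝 0) := by
  have := Measure.isProbabilityMeasure_map (μ := μ) (hε.measurable_pastSeq 0).aemeasurable
  set P := μ.map (pastSeq ε 0) with hP
  have hind : ∀ ⦃s : Set (ℕ → ℝ)⦄, MeasurableSet s →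
      Tendsto (meanDefect μ ε (s.indicator fun _ => (1 : ℝ))) atTop (𝓝 0) := by
    intro s hs
    have hd : P.MeasureDense (measurableCylinders (fun _ : ℕ => ℝ)) :=
      Measure.MeasureDense.of_generateFrom_isSetAlgebra_finite _ isSetAlgebra_measurableCylinders
        generateFrom_measurableCylinders.symm
    refine hε.tendsto_meanDefect_of_approx ((integrable_const (1 : ℝ)).indicator hs) fun η hη => ?_
    obtain ⟨t, ht, hst⟩ := hd.approx s hs (measure_ne_top _ _) η hη
    obtain ⟨I, S, hS, rfl⟩ := (mem_measurableCylinders _).1 ht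
    refine ⟨_, (integrable_const (1 : ℝ)).indicator (hS.cylinder I),
      hε.tendsto_meanDefect_cylinder hS, ?_⟩
    have h1 : (fun e => |s.indicator (fun _ => (1 : ℝ)) e -
        (cylinder (α := fun _ => ℝ) I S).indicator (fun _ => (1 : ℝ)) e|) =
        (symmDiff s (cylinder I S)).indicator fun _ => (1 : ℝ) := by
      funext e
      by_cases h1 : e ∈ s <;> by_cases h2 : e ∈ cylinder (α := fun _ => ℝ) I S <;>
        simp [Set.indicator, Set.mem_symmDiff, h1, h2]
    rw [h1, integral_indicator_const _ (hs.symmDiff (hS.cylinder I))]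
    simp only [smul_eq_mul, mul_one]
    exact ENNReal.toReal_le_of_le_ofReal hη.le hst.le
  revert F
  refine fun {F} hF => Integrable.induction (μ := P) (fun F => Tendsto (meanDefect μ ε F) atTop (𝓝 0)) ?_ ?_ ?_ ?_ hF
  · intro c s hs _
    have h1 : (s.indicator fun _ => c) = fun e => c * s.indicator (fun _ => (1 : ℝ)) e := by
      funext e
      by_cases h : e ∈ s <;> simp [h]
    rw [h1]
    have h2 : meanDefect μ ε (fun e => c * s.indicator (fun _ => (1 : ℝ)) e) =
        fun n => |c| * meanDefect μ ε (s.indicator fun _ => (1 : ℝ)) n :=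
      funext fun n => meanDefect_const_smul _ _ _
    rw [h2]
    simpa using (hind hs).const_mul |c|
  · intro f g _ hf hg hf0 hg0
    refine squeeze_zero (fun n => meanDefect_nonneg _ _) (fun n => hε.meanDefect_add_le hf hg n) ?_
    simpa using hf0.add hg0
  · rw [← isSeqClosed_iff_isClosed]
    intro f g hf hfg
    refine hε.tendsto_meanDefect_of_approx (L1.integrable_coeFn g) fun η hη => ?_
    obtain ⟨N, hN⟩ := Metric.tendsto_atTop.1 hfg η hη
    refine ⟨f N, L1.integrable_coeFn _, hf N, ?_⟩
    have h1 := (hN N le_rfl).le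
    rw [dist_comm, L1.dist_eq_integral_dist] at h1
    simpa only [Real.dist_eq] using h1
  · intro f g hfg hf hf0
    refine hε.tendsto_meanDefect_of_approx (hf.congr hfg) fun η hη => ⟨f, hf, hf0, ?_⟩
    have : ∫ e, |g e - f e| ∂P = 0 := integral_eq_zero_of_ae (by
      filter_upwards [hfg] with e he
      simp [he])
    linarith

end PastSequence

/-! ### Processes that are one fixed function of the past innovations. -/

section PastFactor

variable {Ω : Type*} [MeasurableSpace Ω] {μ : Measure Ω} {ε : ℤ → Ω → ℝ}

/-- The process `V` is of the form `V_t = F(ε_t, ε_{t-1}, …)` almost surely, for one measurable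
function `F`. -/
def IsPastFactor (μ : Measure Ω) (ε V : ℤ → Ω → ℝ) : Prop :=
  ∃ F : (ℕ → ℝ) → ℝ, Measurable F ∧ ∀ t, V t =ᵐ[μ] fun ω => F (pastSeq ε t ω)

lemma IsPastFactor.of_pastSeq {F : (ℕ → ℝ) → ℝ} (hF : Measurable F) :
    IsPastFactor μ ε (fun t ω => F (pastSeq ε t ω)) := ⟨F, hF, fun _ => EventuallyEq.rfl⟩

lemma IsPastFactor.const (c : ℝ) : IsPastFactor μ ε (fun _ _ => c) :=
  .of_pastSeq (F := fun _ => c) measurable_const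

lemma IsPastFactor.innovation : IsPastFactor μ ε ε :=
  ⟨fun e => e 0, measurable_pi_apply 0, fun t => by simp [pastSeq]⟩

lemma IsPastFactor.congr {V W : ℤ → Ω → ℝ} (hV : IsPastFactor μ ε V) (h : ∀ t, W t =ᵐ[μ] V t) :
    IsPastFactor μ ε W := by
  obtain ⟨F, hF, hV⟩ := hV
  exact ⟨F, hF, fun t => (h t).trans (hV t)⟩

lemma IsPastFactor.comp {V : ℤ → Ω → ℝ} (hV : IsPastFactor μ ε V) {g : ℝ → ℝ}
    (hg : Measurable g) : IsPastFactor μ ε (fun t ω => g (V t ω)) := by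
  obtain ⟨F, hF, hV⟩ := hV
  exact ⟨fun e => g (F e), hg.comp hF, fun t => (hV t).fun_comp g⟩

lemma IsPastFactor.comp₂ {V W : ℤ → Ω → ℝ} (hV : IsPastFactor μ ε V) (hW : IsPastFactor μ ε W)
    {g : ℝ → ℝ → ℝ} (hg : Measurable (Function.uncurry g)) :
    IsPastFactor μ ε (fun t ω => g (V t ω) (W t ω)) := by
  obtain ⟨F, hF, hV⟩ := hV
  obtain ⟨G, hG, hW⟩ := hW
  refine ⟨fun e => g (F e) (G e), hg.comp (hF.prodMk hG), fun t => ?_⟩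
  filter_upwards [hV t, hW t] with ω h1 h2
  rw [h1, h2]

lemma IsPastFactor.add {V W : ℤ → Ω → ℝ} (hV : IsPastFactor μ ε V) (hW : IsPastFactor μ ε W) :
    IsPastFactor μ ε (fun t ω => V t ω + W t ω) := hV.comp₂ hW (g := fun a b => a + b) measurable_add

lemma IsPastFactor.mul {V W : ℤ → Ω → ℝ} (hV : IsPastFactor μ ε V) (hW : IsPastFactor μ ε W) :
    IsPastFactor μ ε (fun t ω => V t ω * W t ω) := hV.comp₂ hW (g := fun a b => a * b) measurable_mul

lemma IsPastFactor.div {V W : ℤ → Ω → ℝ} (hV : IsPastFactor μ ε V) (hW : IsPastFactor μ ε W) :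
    IsPastFactor μ ε (fun t ω => V t ω / W t ω) := hV.comp₂ hW (g := fun a b => a / b) measurable_div

lemma IsPastFactor.sum {ι : Type*} (s : Finset ι) {V : ι → ℤ → Ω → ℝ}
    (hV : ∀ i ∈ s, IsPastFactor μ ε (V i)) : IsPastFactor μ ε (fun t ω => ∑ i ∈ s, V i t ω) := by
  classical
  induction s using Finset.induction_on with
  | empty => simpa using IsPastFactor.const 0
  | insert a s ha ih =>
    have := (hV a (by simp)).add (ih fun i hi => hV i (by simp [hi]))
    simpa [Finset.sum_insert ha] using this

lemma IsPastFactor.shift {V : ℤ → Ω → ℝ} (hV : IsPastFactor μ ε V) (k : ℕ) :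
    IsPastFactor μ ε (fun t ω => V (t - k) ω) := by
  obtain ⟨F, hF, hV⟩ := hV
  refine ⟨fun e => F fun i => e (k + i), hF.comp (measurable_pi_iff.2 fun i =>
    measurable_pi_apply _), fun t => ?_⟩
  filter_upwards [hV (t - k)] with ω h
  rw [h]
  congr 1
  funext i
  simp [pastSeq, sub_sub]

/-- `limUnder` provides one measurable function on the whole sequence space, the same for all t; its
value where the limit fails to exist is irrelevant almost surely. -/
lemma IsPastFactor.limit {V : ℕ → ℤ → Ω → ℝ} {W : ℤ → Ω → ℝ} (hV : ∀ m, IsPastFactor μ ε (V m))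
    (h : ∀ t, ∀ᵐ ω ∂μ, Tendsto (fun m => V m t ω) atTop (𝓝 (W t ω))) : IsPastFactor μ ε W := by
  choose F hF hV using hV
  refine ⟨fun e => limUnder atTop (fun m => F m e),
    (StronglyMeasurable.limUnder fun m => (hF m).stronglyMeasurable).measurable, fun t => ?_⟩
  filter_upwards [h t, ae_all_iff.2 fun m => hV m t] with ω h1 h2
  simp only [h2] at h1
  exact h1.limUnder_eq.symm

lemma IsPastFactor.tsum {V : ℕ → ℤ → Ω → ℝ} (hV : ∀ m, IsPastFactor μ ε (V m))
    (h : ∀ t, ∀ᵐ ω ∂μ, Summable fun m => V m t ω) :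
    IsPastFactor μ ε (fun t ω => ∑' m, V m t ω) :=
  .limit (fun n => .sum (Finset.range n) fun m _ => hV m)
    fun t => (h t).mono fun _ hω => hω.hasSum.tendsto_sum_nat

lemma IsPastFactor.aemeasurable {V : ℤ → Ω → ℝ} (hV : IsPastFactor μ ε V)
    (hε : IsGarchInnovation μ ε) (t : ℤ) : AEMeasurable (V t) μ := by
  obtain ⟨F, hF, hV⟩ := hV
  exact (hF.comp (hε.measurable_pastSeq t)).aemeasurable.congr (hV t).symm

lemma IsPastFactor.identDistrib [IsProbabilityMeasure μ] {V : ℤ → Ω → ℝ}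
    (hV : IsPastFactor μ ε V) (hε : IsGarchInnovation μ ε) (t : ℤ) :
    IdentDistrib (V t) (V 0) μ μ := by
  refine ⟨hV.aemeasurable hε t, hV.aemeasurable hε 0, ?_⟩
  obtain ⟨F, hF, hV⟩ := hV
  have key : ∀ t, μ.map (V t) = (μ.map (pastSeq ε 0)).map F := fun t => by
    rw [← hε.map_pastSeq t, Measure.map_map hF (hε.measurable_pastSeq t)]
    exact Measure.map_congr (hV t)
  rw [key, key]

lemma IsPastFactor.indepFun_innovation {V : ℤ → Ω → ℝ} (hV : IsPastFactor μ ε V)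
    (hε : IsGarchInnovation μ ε) (t : ℤ) : IndepFun (ε t) (V (t - 1)) μ := by
  obtain ⟨F, hF, hV⟩ := hV
  refine IndepFun.congr ?_ EventuallyEq.rfl (hV (t - 1)).symm
  refine hε.indepFun_of_measurable (S := {t}) (T := Set.Iic (t - 1)) ?_
    (measurable_sigmaOn (by simp)) (hF.comp (measurable_sigmaOn_pastSeq _))
  simp

/-- The law of large numbers in mean for a function of the past of an i.i.d. sequence. -/
theorem IsPastFactor.tendsto_integral_abs_mean_sub [IsProbabilityMeasure μ] {V : ℤ → Ω → ℝ}
    (hV : IsPastFactor μ ε V) (hε : IsGarchInnovation μ ε) (hint : Integrable (V 0) μ) :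
    Tendsto (fun n : ℕ => ∫ ω, |(n : ℝ)⁻¹ * ∑ t ∈ Finset.Icc 1 n, V t ω - ∫ ω, V 0 ω ∂μ| ∂μ)
      atTop (𝓝 0) := by
  obtain ⟨F, hF, hV⟩ := hV
  have hFi : Integrable F (μ.map (pastSeq ε 0)) :=
    (integrable_map_measure hF.aestronglyMeasurable (hε.measurable_pastSeq 0).aemeasurable).2
      (hint.congr (hV 0))
  refine (hε.tendsto_meanDefect hFi).congr fun n => ?_
  unfold meanDefect
  have h0 : ∫ ω, V 0 ω ∂μ = ∫ e, F e ∂(μ.map (pastSeq ε 0)) := by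
    rw [integral_congr_ae (hV 0), hε.integral_comp_pastSeq hFi]
  rw [h0]
  refine integral_congr_ae ?_
  filter_upwards [ae_all_iff.2 hV] with ω h
  simp only [h]

end PastFactor

/-! ### Products of the random matrices in the order of backward iteration. -/

section BackwardProducts

attribute [local instance] Matrix.linftyOpNormedAddCommGroup

/-- The operator norm for the maximum norm on vectors. -/
def supOpNorm {ι : Type*} [Fintype ι] (A : Matrix ι ι ℝ) : NNReal := ‖A‖₊

variable {ι : Type*} [Fintype ι]

lemma supOpNorm_mul_le (A B : Matrix ι ι ℝ) : supOpNorm (A * B) ≤ supOpNorm A * supOpNorm B :=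
  Matrix.linfty_opNNNorm_mul A B

lemma norm_mulVec_le_supOpNorm (A : Matrix ι ι ℝ) (v : ι → ℝ) :
    ‖A.mulVec v‖ ≤ supOpNorm A * ‖v‖ := Matrix.linfty_opNorm_mulVec A v

lemma supOpNorm_eq (A : Matrix ι ι ℝ) :
    supOpNorm A = Finset.univ.sup fun i => ∑ j, ‖A i j‖₊ := Matrix.linfty_opNNNorm_def A

lemma supOpNorm_le_of_entry_le (A : Matrix ι ι ℝ) {c : NNReal} (h : ∀ i j, ‖A i j‖₊ ≤ c) :
    supOpNorm A ≤ Fintype.card ι * c := by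
  rw [supOpNorm_eq]
  refine Finset.sup_le fun i _ => ?_
  calc ∑ j, ‖A i j‖₊ ≤ ∑ _j : ι, c := Finset.sum_le_sum fun j _ => h i j
    _ = _ := by simp

lemma measurable_supOpNorm {β : Type*} [MeasurableSpace β] {A : β → Matrix ι ι ℝ}
    (h : ∀ i j, Measurable fun b => A b i j) : Measurable fun b => supOpNorm (A b) := by
  simp only [supOpNorm_eq]
  have key : ∀ s : Finset ι, Measurable fun b => s.sup fun i => ∑ j, ‖A b i j‖₊ := by
    classical
    intro s
    induction s using Finset.induction_on with
    | empty => simp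
    | insert a s ha ih =>
      simp only [Finset.sup_insert]
      exact (Finset.measurable_fun_sum _ fun j _ => (h a j).nnnorm).sup ih
  exact key _

variable {p q : ℕ}

/-- The product `A(e_0) A(e_1) ⋯ A(e_{m-1})`. -/
def garchBackProd (θ : GarchParam p q) (e : ℕ → ℝ) :
    ℕ → Matrix (Fin p ⊕ Fin q) (Fin p ⊕ Fin q) ℝ
  | 0 => 1
  | m + 1 => garchBackProd θ e m * garchMatrix θ (e m)

lemma garchBackProd_add (θ : GarchParam p q) (e : ℕ → ℝ) (m l : ℕ) :
    garchBackProd θ e (m + l) = garchBackProd θ e m * garchBackProd θ (fun i => e (m + i)) l := by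
  induction l with
  | zero => simp [garchBackProd]
  | succ l ih => rw [← add_assoc, garchBackProd, ih, garchBackProd, Matrix.mul_assoc]

lemma garchBackProd_one (θ : GarchParam p q) (e : ℕ → ℝ) :
    garchBackProd θ e 1 = garchMatrix θ (e 0) := by simp [garchBackProd]

lemma garchBackProd_congr (θ : GarchParam p q) {e e' : ℕ → ℝ} (m : ℕ) (h : ∀ i < m, e i = e' i) :
    garchBackProd θ e m = garchBackProd θ e' m := by
  induction m with
  | zero => rfl
  | succ m ih =>
    rw [garchBackProd, garchBackProd, ih fun i hi => h i (by omega), h m (by omega)]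

/-- Reversal of time links the forward products, through which the Lyapunov exponent is defined,
with the products that appear when the recursion is iterated into the past. -/
lemma garchMatrixProd_eq_garchBackProd (θ : GarchParam p q) (e : ℤ → ℝ) (n : ℕ) :
    garchMatrixProd θ e n = garchBackProd θ (fun i => e ((n : ℤ) - 1 - i)) n := by
  induction n with
  | zero => rfl
  | succ n ih =>
    rw [garchMatrixProd, ih, add_comm n 1, garchBackProd_add, garchBackProd_one]
    congr 1
    · simp
    · refine garchBackProd_congr θ n fun i _ => ?_
      congr 1
      push_cast
      ring

lemma measurable_garchMatrix_apply {β : Type*} [MeasurableSpace β] (θ : GarchParam p q)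
    {x : β → ℝ} (hx : Measurable x) (i j : Fin p ⊕ Fin q) :
    Measurable fun b => garchMatrix θ (x b) i j := by
  rcases i with i | i
  · simp only [garchMatrix, Matrix.of_apply]
    split_ifs
    · exact (hx.pow_const 2).mul_const _
    · exact measurable_const
  · simp only [garchMatrix, Matrix.of_apply]
    exact measurable_const

lemma measurable_garchBackProd_apply {β : Type*} [MeasurableSpace β] (θ : GarchParam p q)
    {e : β → ℕ → ℝ} (m : ℕ) (he : ∀ i < m, Measurable fun b => e b i) (i j : Fin p ⊕ Fin q) :
    Measurable fun b => garchBackProd θ (e b) m i j := by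
  induction m generalizing i j with
  | zero => exact measurable_const
  | succ m ih =>
    simp only [garchBackProd, Matrix.mul_apply]
    exact Finset.measurable_fun_sum _ fun k _ => (ih (fun i hi => he i (by omega)) i k).mul
      (measurable_garchMatrix_apply θ (he m (by omega)) k j)

lemma measurable_supOpNorm_garchBackProd {β : Type*} [MeasurableSpace β] (θ : GarchParam p q)
    {e : β → ℕ → ℝ} (m : ℕ) (he : ∀ i < m, Measurable fun b => e b i) :
    Measurable fun b => supOpNorm (garchBackProd θ (e b) m) :=
  measurable_supOpNorm fun i j => measurable_garchBackProd_apply θ m he i j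

/-- All entries are at most affine in x², so the finite variance of the innovations gives the
matrices a first moment. -/
lemma supOpNorm_garchMatrix_le (θ : GarchParam p q) :
    ∃ C : NNReal, ∀ x : ℝ, (supOpNorm (garchMatrix θ x) : ℝ) ≤ C * (1 + x ^ 2) := by
  refine ⟨Fintype.card (Fin p ⊕ Fin q) * (‖θ‖₊ + 1), fun x => ?_⟩
  have h1 : ∀ i j, ‖garchMatrix θ x i j‖₊ ≤ (‖θ‖₊ + 1) * Real.toNNReal (1 + x ^ 2) := by
    intro i j
    rw [← NNReal.coe_le_coe]
    push_cast
    rw [Real.coe_toNNReal _ (by positivity)]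
    have hrow : ∀ c, ‖garchRow θ c‖ ≤ ‖θ‖ := by
      rintro (c | c)
      · exact norm_le_pi_norm θ (Sum.inl c.succ)
      · exact norm_le_pi_norm θ (Sum.inr c)
    have hn := norm_nonneg θ
    have hx := sq_nonneg x
    have hone : (1 : ℝ) ≤ (‖θ‖ + 1) * (1 + x ^ 2) := by nlinarith
    rcases i with i | i
    · simp only [garchMatrix, Matrix.of_apply]
      split_ifs
      · rw [norm_mul, Real.norm_of_nonneg hx]
        nlinarith [hrow j, norm_nonneg (garchRow θ j)]
      · rcases j with j | j
        · simp only [Sum.elim_inl]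
          split_ifs <;> simp [hone]
          positivity
        · simp only [Sum.elim_inr, norm_zero]; positivity
    · simp only [garchMatrix, Matrix.of_apply]
      split_ifs
      · nlinarith [hrow j, norm_nonneg (garchRow θ j)]
      · rcases j with j | j
        · simp only [Sum.elim_inl, norm_zero]; positivity
        · simp only [Sum.elim_inr]
          split_ifs <;> simp [hone]
          positivity
  have h2 := NNReal.coe_le_coe.2 (supOpNorm_le_of_entry_le _ h1)
  push_cast at h2 ⊢
  rw [Real.coe_toNNReal _ (by positivity)] at h2
  linarith

end BackwardProducts

/-! ### Fractional moments of the matrix products. -/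

section ProductMoments

variable {Ω : Type*} [MeasurableSpace Ω] {μ : Measure Ω} {ε : ℤ → Ω → ℝ} {p q : ℕ}

lemma IsGarchInnovation.lintegral_comp_pastSeq [IsProbabilityMeasure μ]
    (hε : IsGarchInnovation μ ε) {G : (ℕ → ℝ) → ℝ≥0∞} (hG : Measurable G) (t : ℤ) :
    ∫⁻ ω, G (pastSeq ε t ω) ∂μ = ∫⁻ ω, G (pastSeq ε 0 ω) ∂μ := by
  rw [(hε.measurePreserving_pastSeq t).lintegral_comp hG,
    (hε.measurePreserving_pastSeq 0).lintegral_comp hG]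

/-- `E ‖A(ε_0) A(ε_{-1}) ⋯ A(ε_{-m+1})‖^s`. -/
def prodMoment (μ : Measure Ω) (ε : ℤ → Ω → ℝ) (θ : GarchParam p q) (s : ℝ) (m : ℕ) : ℝ≥0∞ :=
  ∫⁻ ω, (supOpNorm (garchBackProd θ (pastSeq ε 0 ω) m) : ℝ≥0∞) ^ s ∂μ

lemma measurable_supOpNorm_garchBackProd_rpow (θ : GarchParam p q) (s : ℝ) (m : ℕ) :
    Measurable fun e : ℕ → ℝ => (supOpNorm (garchBackProd θ e m) : ℝ≥0∞) ^ s :=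
  (measurable_supOpNorm_garchBackProd θ m
    fun i _ => measurable_pi_apply i).coe_nnreal_ennreal.pow_const s

lemma IsGarchInnovation.lintegral_supOpNorm_rpow [IsProbabilityMeasure μ]
    (hε : IsGarchInnovation μ ε) (θ : GarchParam p q) (s : ℝ) (m : ℕ) (t : ℤ) :
    ∫⁻ ω, (supOpNorm (garchBackProd θ (pastSeq ε t ω) m) : ℝ≥0∞) ^ s ∂μ =
      prodMoment μ ε θ s m :=
  hε.lintegral_comp_pastSeq (measurable_supOpNorm_garchBackProd_rpow θ s m) t

/-- A function of the first `m` coordinates of the past is independent of the more remote past. -/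
lemma IsGarchInnovation.lintegral_mul_remote [IsProbabilityMeasure μ]
    (hε : IsGarchInnovation μ ε) (θ : GarchParam p q) (s : ℝ) (m : ℕ) (t : ℤ)
    {G : (ℕ → ℝ) → ℝ≥0∞} (hG : Measurable G) :
    ∫⁻ ω, (supOpNorm (garchBackProd θ (pastSeq ε t ω) m) : ℝ≥0∞) ^ s *
      G (fun i => pastSeq ε t ω (m + i)) ∂μ =
      prodMoment μ ε θ s m * ∫⁻ ω, G (pastSeq ε 0 ω) ∂μ := by
  have h0 : ∀ ω, (fun i => pastSeq ε t ω (m + i)) = pastSeq ε (t - m) ω := by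
    intro ω
    funext i
    simp [pastSeq, sub_sub]
  simp only [h0]
  have hf : Measurable[sigmaOn ε (Set.Ioc (t - m) t)]
      fun ω => (supOpNorm (garchBackProd θ (pastSeq ε t ω) m) : ℝ≥0∞) ^ s := by
    have := @measurable_supOpNorm_garchBackProd p q Ω (sigmaOn ε (Set.Ioc (t - m) t)) θ
      (pastSeq ε t) m fun i hi => measurable_sigmaOn (by simp only [Set.mem_Ioc]; omega)
    exact (measurable_coe_nnreal_ennreal.comp this).pow_const s
  have hind : IndepFun (fun ω => (supOpNorm (garchBackProd θ (pastSeq ε t ω) m) : ℝ≥0∞) ^ s)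
      (fun ω => G (pastSeq ε (t - m) ω)) μ := by
    refine hε.indepFun_of_measurable (S := Set.Ioc (t - m) t) (T := Set.Iic (t - m)) ?_ hf
      (hG.comp (measurable_sigmaOn_pastSeq _))
    rw [Set.disjoint_left]
    intro x hx hx'
    simp only [Set.mem_Ioc, Set.mem_Iic] at hx hx'
    omega
  have := lintegral_mul_eq_lintegral_mul_lintegral_of_indepFun
    ((measurable_supOpNorm_garchBackProd_rpow θ s m).comp (hε.measurable_pastSeq t))
    (hG.comp (hε.measurable_pastSeq _)) hind
  rw [← hε.lintegral_supOpNorm_rpow θ s m t, ← hε.lintegral_comp_pastSeq hG (t - m)]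
  exact this

/-- The first m factors and the remaining l factors use disjoint sets of innovations, so
submultiplicativity of the norm passes to the moments. -/
lemma IsGarchInnovation.prodMoment_add_le [IsProbabilityMeasure μ]
    (hε : IsGarchInnovation μ ε) (θ : GarchParam p q) {s : ℝ} (hs : 0 ≤ s) (m l : ℕ) :
    prodMoment μ ε θ s (m + l) ≤ prodMoment μ ε θ s m * prodMoment μ ε θ s l := by
  have := hε.lintegral_mul_remote θ s m 0 (measurable_supOpNorm_garchBackProd_rpow θ s l)
  rw [← prodMoment] at this
  rw [← this]
  refine lintegral_mono fun ω => ?_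
  rw [garchBackProd_add, ← ENNReal.mul_rpow_of_nonneg _ _ hs]
  refine ENNReal.rpow_le_rpow ?_ hs
  exact_mod_cast supOpNorm_mul_le _ _

lemma IsGarchInnovation.integrable_sq (hε : IsGarchInnovation μ ε) :
    Integrable (fun ω => ε 0 ω ^ 2) μ := by
  -- The Bochner integral of a non-integrable function is 0, whereas this one is 1.
  by_contra h
  have := hε.variance_one
  rw [integral_undef h] at this
  exact zero_ne_one this

lemma IsGarchInnovation.prodMoment_one_ne_top [IsProbabilityMeasure μ]
    (hε : IsGarchInnovation μ ε) (θ : GarchParam p q) (m : ℕ) : prodMoment μ ε θ 1 m ≠ ∞ := by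
  induction m with
  | zero =>
    simp only [prodMoment, garchBackProd, lintegral_const, measure_univ, mul_one]
    exact ENNReal.rpow_ne_top_of_nonneg zero_le_one ENNReal.coe_ne_top
  | succ m ih =>
    refine ne_top_of_le_ne_top (ENNReal.mul_ne_top ih ?_) (hε.prodMoment_add_le θ zero_le_one m 1)
    obtain ⟨C, hC⟩ := supOpNorm_garchMatrix_le θ
    have hint : Integrable (fun ω => (C : ℝ) * (1 + ε 0 ω ^ 2)) μ :=
      ((integrable_const _).add hε.integrable_sq).const_mul _
    refine ne_top_of_le_ne_top hint.lintegral_lt_top.ne (lintegral_mono fun ω => ?_)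
    rw [ENNReal.rpow_one, garchBackProd_one, ← ENNReal.ofReal_coe_nnreal]
    exact ENNReal.ofReal_le_ofReal ((hC _).trans_eq (by simp [pastSeq]))

lemma ENNReal.rpow_le_one_add {x : ℝ≥0∞} {s : ℝ} (hs : 0 ≤ s) (hs1 : s ≤ 1) : x ^ s ≤ 1 + x := by
  rcases le_total x 1 with h | h
  · exact (ENNReal.rpow_le_one h hs).trans le_self_add
  · exact ((ENNReal.rpow_le_rpow_of_exponent_le h hs1).trans_eq (ENNReal.rpow_one x)).trans
      le_add_self

lemma IsGarchInnovation.prodMoment_ne_top [IsProbabilityMeasure μ]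
    (hε : IsGarchInnovation μ ε) (θ : GarchParam p q) {s : ℝ} (hs : 0 ≤ s) (hs1 : s ≤ 1) (m : ℕ) :
    prodMoment μ ε θ s m ≠ ∞ := by
  have h1 : ∫⁻ ω, (1 + (supOpNorm (garchBackProd θ (pastSeq ε 0 ω) m) : ℝ≥0∞) ^ (1 : ℝ)) ∂μ ≠ ∞ := by
    rw [lintegral_add_left measurable_const]
    simp only [lintegral_const, measure_univ, mul_one]
    exact ENNReal.add_ne_top.2 ⟨ENNReal.one_ne_top, hε.prodMoment_one_ne_top θ m⟩
  refine ne_top_of_le_ne_top h1 (lintegral_mono fun ω => ?_)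
  simpa using ENNReal.rpow_le_one_add hs hs1

/-- If `Y` has negative mean and `e^Y` is integrable, then `E e^{sY} < 1` for some `0 < s ≤ 1`. -/
lemma exists_integral_exp_mul_lt_one [IsProbabilityMeasure μ] {Y : Ω → ℝ} (hY : ∫ ω, Y ω ∂μ < 0)
    (hexp : Integrable (fun ω => Real.exp (Y ω)) μ) :
    ∃ s : ℝ, 0 < s ∧ s ≤ 1 ∧ Integrable (fun ω => Real.exp (s * Y ω)) μ ∧
      ∫ ω, Real.exp (s * Y ω) ∂μ < 1 := by
  have hYi : Integrable Y μ := by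
    by_contra h
    rw [integral_undef h] at hY
    exact lt_irrefl _ hY
  have hmeas : ∀ s : ℝ, AEStronglyMeasurable (fun ω => Real.exp (s * Y ω)) μ := fun s =>
    Real.continuous_exp.comp_aestronglyMeasurable (hYi.1.const_mul s)
  have hconv : ∀ s : ℝ, 0 ≤ s → s ≤ 1 → ∀ y : ℝ,
      Real.exp (s * y) ≤ (1 - s) + s * Real.exp y := by
    intro s h0 h1 y
    have := convexOn_exp.2 (Set.mem_univ 0) (Set.mem_univ y) (sub_nonneg.2 h1) h0 (by ring)
    simpa using this
  have hei : ∀ s : ℝ, 0 ≤ s → s ≤ 1 → Integrable (fun ω => Real.exp (s * Y ω)) μ := by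
    intro s h0 h1
    refine ((integrable_const (1 - s)).add (hexp.const_mul s)).mono' (hmeas s)
      (ae_of_all _ fun ω => ?_)
    rw [Real.norm_of_nonneg (Real.exp_nonneg _)]
    exact hconv s h0 h1 _
  -- Difference quotients at 0 of s ↦ e^{sY} along s = 1/(j+1). Convexity places them between Y and
  -- e^Y − 1, so by dominated convergence their expectations tend to E Y < 0, which forces E e^{sY}
  -- < 1 for some such s.
  set f : ℕ → Ω → ℝ := fun j ω => ((j : ℝ) + 1) * (Real.exp ((1 / ((j : ℝ) + 1)) * Y ω) - 1)
  have hs : ∀ j : ℕ, 0 < 1 / ((j : ℝ) + 1) ∧ 1 / ((j : ℝ) + 1) ≤ 1 := fun j =>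
    ⟨by positivity, by rw [div_le_one (by positivity)]; simp⟩
  have hlim : Tendsto (fun j => ∫ ω, f j ω ∂μ) atTop (𝓝 (∫ ω, Y ω ∂μ)) := by
    refine tendsto_integral_of_dominated_convergence (fun ω => |Y ω| + (Real.exp (Y ω) + 1))
      (fun j => (((hmeas _).sub aestronglyMeasurable_const).const_mul _))
      (hYi.abs.add (hexp.add (integrable_const _))) (fun j => ae_of_all _ fun ω => ?_)
      (ae_of_all _ fun ω => ?_)
    · have hj : (0 : ℝ) < (j : ℝ) + 1 := by positivity
      have h1 : Y ω ≤ f j ω := by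
        have := Real.add_one_le_exp ((1 / ((j : ℝ) + 1)) * Y ω)
        calc Y ω = ((j : ℝ) + 1) * (((1 / ((j : ℝ) + 1)) * Y ω + 1) - 1) := by field_simp; ring
          _ ≤ _ := mul_le_mul_of_nonneg_left (sub_le_sub_right this 1) hj.le
      have h2 : f j ω ≤ Real.exp (Y ω) - 1 := by
        have := hconv _ (hs j).1.le (hs j).2 (Y ω)
        calc f j ω ≤ ((j : ℝ) + 1) * (((1 - 1 / ((j : ℝ) + 1)) +
              1 / ((j : ℝ) + 1) * Real.exp (Y ω)) - 1) :=
              mul_le_mul_of_nonneg_left (sub_le_sub_right this 1) hj.le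
          _ = _ := by field_simp; ring
      rw [Real.norm_eq_abs, abs_le]
      have := neg_abs_le (Y ω)
      have := abs_nonneg (Y ω)
      have := Real.exp_nonneg (Y ω)
      constructor <;> linarith
    · have hd : HasDerivAt (fun x : ℝ => Real.exp (x * Y ω)) (Y ω) 0 := by
        have := ((hasDerivAt_id (0 : ℝ)).mul_const (Y ω)).exp
        simpa using this
      have h1 := hd.tendsto_slope_zero_right
      have h2 : Tendsto (fun j : ℕ => 1 / ((j : ℝ) + 1)) atTop (𝓝[>] 0) :=
        tendsto_nhdsWithin_iff.2 ⟨tendsto_one_div_add_atTop_nhds_zero_nat,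
          Eventually.of_forall fun j => (hs j).1⟩
      refine (h1.comp h2).congr fun j => ?_
      simp [f]
  obtain ⟨j, hj⟩ := (hlim.eventually_lt_const hY).exists
  refine ⟨1 / ((j : ℝ) + 1), (hs j).1, (hs j).2, hei _ (hs j).1.le (hs j).2, ?_⟩
  have h1 : ∫ ω, f j ω ∂μ =
      ((j : ℝ) + 1) * (∫ ω, Real.exp ((1 / ((j : ℝ) + 1)) * Y ω) ∂μ - 1) := by
    rw [integral_const_mul, integral_sub (hei _ (hs j).1.le (hs j).2) (integrable_const _)]
    simp
  rw [h1] at hj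
  by_contra h
  push Not at h
  have : (0 : ℝ) ≤ ((j : ℝ) + 1) * (∫ ω, Real.exp ((1 / ((j : ℝ) + 1)) * Y ω) ∂μ - 1) :=
    mul_nonneg (by positivity) (by linarith)
  linarith

lemma IsGarchInnovation.exists_prodMoment_lt_one [IsProbabilityMeasure μ]
    (hε : IsGarchInnovation μ ε) {θ : GarchParam p q} (hγ : garchLyapunov μ θ ε < 0) :
    ∃ s : ℝ, 0 < s ∧ s ≤ 1 ∧ ∃ N : ℕ, prodMoment μ ε θ s N < 1 := by
  -- If no expected log norm were negative, the infimum defining γ would be nonnegative.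
  obtain ⟨n, hn⟩ : ∃ n : ℕ, ∫ ω, Real.log (supOpNorm (garchMatrixProd θ
      (fun t => ε t ω) (n + 1))) ∂μ < 0 := by
    by_contra! h
    refine absurd hγ (not_lt.2 (Real.iInf_nonneg fun n => mul_nonneg (by positivity) (h n)))
  have hpast : ∀ ω, garchMatrixProd θ (fun t => ε t ω) (n + 1) =
      garchBackProd θ (pastSeq ε n ω) (n + 1) := by
    intro ω
    rw [garchMatrixProd_eq_garchBackProd]
    congr 1
    funext i
    simp [pastSeq]
  simp only [hpast] at hn
  set B : Ω → NNReal := fun ω => supOpNorm (garchBackProd θ (pastSeq ε n ω) (n + 1))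
  have hB : Measurable B := measurable_supOpNorm_garchBackProd θ (n + 1)
    fun i _ => hε.measurable _
  have hBi : Integrable (fun ω => (B ω : ℝ)) μ := by
    refine ⟨hB.coe_nnreal_real.aestronglyMeasurable, ?_⟩
    rw [hasFiniteIntegral_iff_enorm]
    have := hε.prodMoment_one_ne_top θ (n + 1)
    rw [← hε.lintegral_supOpNorm_rpow θ 1 (n + 1) n] at this
    refine lt_of_le_of_lt (lintegral_mono fun ω => ?_) this.lt_top
    rw [ENNReal.rpow_one]
    simp [B, enorm_eq_nnnorm]
  have hexple : ∀ ω, Real.exp (Real.log (B ω)) ≤ 1 + B ω := by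
    intro ω
    rcases eq_or_ne (B ω) 0 with h | h
    · simp [h]
    · rw [Real.exp_log (by positivity)]; linarith
  obtain ⟨s, hs0, hs1, hsi, hslt⟩ := exists_integral_exp_mul_lt_one hn
    (((integrable_const 1).add hBi).mono'
      (Real.measurable_exp.comp (Real.measurable_log.comp hB.coe_nnreal_real)).aestronglyMeasurable
      (ae_of_all _ fun ω => by
        rw [Real.norm_of_nonneg (Real.exp_nonneg _)]; exact hexple ω))
  refine ⟨s, hs0, hs1, n + 1, ?_⟩
  rw [← hε.lintegral_supOpNorm_rpow θ s (n + 1) n]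
  calc ∫⁻ ω, (B ω : ℝ≥0∞) ^ s ∂μ ≤ ∫⁻ ω, ENNReal.ofReal (Real.exp (s * Real.log (B ω))) ∂μ := by
        refine lintegral_mono fun ω => ?_
        -- Where the product vanishes, `Real.log 0 = 0` makes the exponential equal to 1, still an
        -- upper bound for 0^s.
        rcases eq_or_ne (B ω) 0 with h | h
        · simp [h, hs0]
        · have hpos : (0 : ℝ) < B ω := by positivity
          rw [mul_comm, ← Real.rpow_def_of_pos hpos, ← ENNReal.ofReal_rpow_of_pos hpos,
            ENNReal.ofReal_coe_nnreal]
    _ = ENNReal.ofReal (∫ ω, Real.exp (s * Real.log (B ω)) ∂μ) :=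
        (ofReal_integral_eq_lintegral_ofReal hsi (ae_of_all _ fun _ => Real.exp_nonneg _)).symm
    _ < 1 := by
        rw [← ENNReal.ofReal_one]
        exact (ENNReal.ofReal_lt_ofReal_iff one_pos).2 hslt

/-- Under the Bougerol–Picard condition the products of matrices have summable fractional moments. -/
lemma IsGarchInnovation.exists_tsum_prodMoment_ne_top [IsProbabilityMeasure μ]
    (hε : IsGarchInnovation μ ε) {θ : GarchParam p q} (hγ : garchLyapunov μ θ ε < 0) :
    ∃ s : ℝ, 0 < s ∧ s ≤ 1 ∧ ∑' m, prodMoment μ ε θ s m ≠ ∞ := by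
  obtain ⟨s, hs0, hs1, N, hN⟩ := hε.exists_prodMoment_lt_one hγ
  refine ⟨s, hs0, hs1, ?_⟩
  set π : ℕ → ℝ := fun m => (prodMoment μ ε θ s m).toReal
  have hfin : ∀ m, prodMoment μ ε θ s m ≠ ∞ := fun m => hε.prodMoment_ne_top θ hs0.le hs1 m
  have hπ0 : ∀ m, 0 ≤ π m := fun m => ENNReal.toReal_nonneg
  have hsub : ∀ m, π (N + m) ≤ π N * π m := fun m => by
    rw [← ENNReal.toReal_mul]
    exact ENNReal.toReal_mono (ENNReal.mul_ne_top (hfin _) (hfin _))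
      (hε.prodMoment_add_le θ hs0.le N m)
  have hN1 : π N < 1 := by
    have := (ENNReal.toReal_lt_toReal (hfin N) ENNReal.one_ne_top).2 hN
    simpa using this
  have hsum : Summable π := by
    -- For the partial sums P_n, submultiplicativity gives P_n ≤ P_N + π_N P_n, and π_N < 1.
    refine summable_of_sum_range_le (c := (∑ m ∈ Finset.range N, π m) / (1 - π N)) hπ0 fun n => ?_
    rw [le_div_iff₀ (by linarith)]
    have h1 : ∑ m ∈ Finset.range n, π m ≤ ∑ m ∈ Finset.range (N + n), π m :=
      Finset.sum_le_sum_of_subset_of_nonneg (Finset.range_mono (by omega)) fun _ _ _ => hπ0 _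
    rw [Finset.sum_range_add] at h1
    have h2 : ∑ m ∈ Finset.range n, π (N + m) ≤ π N * ∑ m ∈ Finset.range n, π m := by
      rw [Finset.mul_sum]
      exact Finset.sum_le_sum fun m _ => hsub m
    nlinarith
  have h3 : ∀ m, prodMoment μ ε θ s m = ENNReal.ofReal (π m) := fun m =>
    (ENNReal.ofReal_toReal (hfin m)).symm
  simp only [h3]
  exact hsum.tsum_ofReal_ne_top

end ProductMoments

/-! ### The stationary solution as a series in past innovations. -/

section CausalSolution

variable {Ω : Type*} [MeasurableSpace Ω] {μ : Measure Ω} {ε σ X : ℤ → Ω → ℝ} {p q : ℕ}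
  {θ : GarchParam p q}

/-- The state vector `(X_t², …, X_{t-p+1}², σ_t², …, σ_{t-q+1}²)`. -/
def garchState (p q : ℕ) (σ X : ℤ → Ω → ℝ) (t : ℤ) (ω : Ω) : Fin p ⊕ Fin q → ℝ :=
  Sum.elim (fun i => X (t - (i : ℕ)) ω ^ 2) (fun j => σ (t - (j : ℕ)) ω ^ 2)

/-- The vector `(α₀ e², 0, …, 0, α₀, 0, …, 0)`. -/
def garchShock (θ : GarchParam p q) (e : ℝ) : Fin p ⊕ Fin q → ℝ :=
  Sum.elim (fun i => if (i : ℕ) = 0 then θ (Sum.inl 0) * e ^ 2 else 0)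
    (fun j => if (j : ℕ) = 0 then θ (Sum.inl 0) else 0)

lemma Fin.sum_ite_succ_eq {n : ℕ} (i : Fin n) (hi : (i : ℕ) ≠ 0) (f : ℕ → ℝ) :
    ∑ j : Fin n, (if (j : ℕ) + 1 = i then 1 else 0) * f j = f (i - 1) := by
  rw [Finset.sum_eq_single (⟨i - 1, by omega⟩ : Fin n)]
  · rw [if_pos (by simp only; omega), one_mul]
  · intro j _ hj
    rw [if_neg, zero_mul]
    intro h
    apply hj
    ext
    simp only
    omega
  · simp

lemma IsStationaryGarch.state_eq (hX : IsStationaryGarch μ θ ε σ X) (t : ℤ) :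
    ∀ᵐ ω ∂μ, garchState p q σ X t ω =
      (garchMatrix θ (ε t ω)).mulVec (garchState p q σ X (t - 1) ω) + garchShock θ (ε t ω) := by
  filter_upwards [hX.X_eq t, hX.σ_sq_eq t] with ω h1 h2
  have hrow : ∑ c, garchRow θ c * garchState p q σ X (t - 1) ω c + θ (Sum.inl 0) = σ t ω ^ 2 := by
    rw [h2, Fintype.sum_sum_type]
    simp only [garchRow, garchState, Sum.elim_inl, Sum.elim_inr]
    have : ∀ n : ℕ, t - 1 - (n : ℤ) = t - ((n : ℤ) + 1) := fun n => by ring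
    simp only [this]
    ring
  funext a
  rcases a with i | j
  · simp only [Pi.add_apply, Matrix.mulVec, dotProduct, garchMatrix, Matrix.of_apply, garchShock,
      Sum.elim_inl]
    by_cases hi : (i : ℕ) = 0
    · have h3 : garchState p q σ X t ω (Sum.inl i) = X t ω ^ 2 := by simp [garchState, hi]
      simp only [hi, if_true, mul_assoc, ← Finset.mul_sum]
      rw [h3, h1]
      linear_combination (-(ε t ω ^ 2)) * hrow
    · simp only [hi, if_false, add_zero, Fintype.sum_sum_type, Sum.elim_inl, Sum.elim_inr, zero_mul,
        Finset.sum_const_zero]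
      simp only [garchState, Sum.elim_inl]
      rw [Fin.sum_ite_succ_eq i hi fun n => X (t - 1 - (n : ℕ)) ω ^ 2]
      congr 2
      push_cast [Nat.cast_sub (Nat.one_le_iff_ne_zero.2 hi)]
      ring
  · simp only [Pi.add_apply, Matrix.mulVec, dotProduct, garchMatrix, Matrix.of_apply, garchShock,
      Sum.elim_inr]
    by_cases hj : (j : ℕ) = 0
    · simp only [hj, if_true]
      rw [hrow]
      simp [garchState, hj]
    · simp only [hj, if_false, add_zero, Fintype.sum_sum_type, Sum.elim_inl, Sum.elim_inr, zero_mul,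
        Finset.sum_const_zero, zero_add]
      simp only [garchState, Sum.elim_inr]
      rw [Fin.sum_ite_succ_eq j hj fun n => σ (t - 1 - (n : ℕ)) ω ^ 2]
      congr 2
      push_cast [Nat.cast_sub (Nat.one_le_iff_ne_zero.2 hj)]
      ring

lemma IsStationaryGarch.state_eq_iterate (hX : IsStationaryGarch μ θ ε σ X) (t : ℤ) :
    ∀ᵐ ω ∂μ, ∀ m : ℕ, garchState p q σ X t ω =
      (garchBackProd θ (pastSeq ε t ω) m).mulVec (garchState p q σ X (t - m) ω) +
      ∑ l ∈ Finset.range m, (garchBackProd θ (pastSeq ε t ω) l).mulVec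
        (garchShock θ (pastSeq ε t ω l)) := by
  filter_upwards [ae_all_iff.2 fun m : ℕ => hX.state_eq (t - m)] with ω h m
  induction m with
  | zero => simp [garchBackProd]
  | succ m ih =>
    rw [Finset.sum_range_succ, garchBackProd, ← Matrix.mulVec_mulVec, add_comm (∑ _ ∈ _, _),
      ← add_assoc, ← Matrix.mulVec_add]
    have h1 := h m
    rw [show t - ((m + 1 : ℕ) : ℤ) = t - m - 1 by push_cast; ring]
    rw [ih]
    congr 2

lemma tendsto_measure_lt_atTop [IsProbabilityMeasure μ] {Y : Ω → ℝ} (hY : Measurable Y) :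
    Tendsto (fun n : ℕ => μ {ω | (n : ℝ) < Y ω}) atTop (𝓝 0) := by
  have h := tendsto_measure_iInter_atTop (μ := μ) (s := fun n : ℕ => {ω | (n : ℝ) < Y ω})
    (fun n => (measurableSet_lt measurable_const hY).nullMeasurableSet)
    (fun a b hab ω (hω : (b : ℝ) < Y ω) =>
      show (a : ℝ) < Y ω from lt_of_le_of_lt (by exact_mod_cast hab) hω) ⟨0, measure_ne_top _ _⟩
  have h0 : ⋂ n : ℕ, {ω | (n : ℝ) < Y ω} = ∅ := by
    refine Set.eq_empty_of_forall_notMem fun ω hω => ?_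
    obtain ⟨n, hn⟩ := exists_nat_gt (Y ω)
    have := Set.mem_iInter.1 hω n
    simp only [Set.mem_ofPred_eq] at this
    linarith
  rw [h0, measure_empty] at h
  exact h

/-- The small-ball condition enters the proof here: multiplying it by x^ζ → 0 shows that ε_0 is
rarely close to 0, which makes division by ε_t harmless. -/
lemma exists_measure_abs_le_le [IsProbabilityMeasure μ]
    (hsmall : ∃ ζ : ℝ, 0 < ζ ∧
      Tendsto (fun x : ℝ => x ^ (-ζ) * μ.real {ω | |ε 0 ω| ≤ x}) (𝓝[>] 0) (𝓝 0))
    {η : ℝ≥0∞} (hη : 0 < η) : ∃ δ : ℝ, 0 < δ ∧ μ {ω | |ε 0 ω| ≤ δ} ≤ η := by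
  obtain ⟨ζ, hζ, hlim⟩ := hsmall
  have h1 : Tendsto (fun x : ℝ => x ^ ζ) (𝓝[>] 0) (𝓝 0) := by
    have := (Real.continuousAt_rpow_const 0 ζ (Or.inr hζ.le)).tendsto
    rw [Real.zero_rpow hζ.ne'] at this
    exact this.mono_left nhdsWithin_le_nhds
  have h2 := h1.mul hlim
  rw [zero_mul] at h2
  have h3 : Tendsto (fun x : ℝ => μ.real {ω | |ε 0 ω| ≤ x}) (𝓝[>] 0) (𝓝 0) := by
    refine h2.congr' ?_
    filter_upwards [self_mem_nhdsWithin] with x hx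
    rw [← mul_assoc, ← Real.rpow_add hx, add_neg_cancel, Real.rpow_zero, one_mul]
  have h4 : Tendsto (fun x : ℝ => μ {ω | |ε 0 ω| ≤ x}) (𝓝[>] 0) (𝓝 0) := by
    have := ENNReal.tendsto_ofReal h3
    simpa [ofReal_measureReal] using this
  obtain ⟨x, hx, hx0⟩ := ((h4.eventually_le_const hη).and self_mem_nhdsWithin).exists
  exact ⟨x, hx0, hx⟩

/-- The squares of the coordinates of the state vectors are tight. -/
lemma IsStationaryGarch.tight_state [IsProbabilityMeasure μ] (hε : IsGarchInnovation μ ε)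
    (hX : IsStationaryGarch μ θ ε σ X)
    (hsmall : ∃ ζ : ℝ, 0 < ζ ∧
      Tendsto (fun x : ℝ => x ^ (-ζ) * μ.real {ω | |ε 0 ω| ≤ x}) (𝓝[>] 0) (𝓝 0))
    {η : ℝ≥0∞} (hη : 0 < η) :
    ∃ K : ℝ, 0 < K ∧ ∀ t, μ {ω | K < ‖garchState p q σ X t ω‖} ≤ η := by
  have hXlaw : ∀ (t : ℤ) (K : ℝ), μ {ω | K < X t ω ^ 2} = μ {ω | K < X 0 ω ^ 2} := by
    intro t K
    have h1 := (hX.stationary t).comp (measurable_pi_apply (0 : ℤ))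
    have h2 : IdentDistrib (X t) (X 0) μ μ := by simpa [Function.comp_def] using h1
    exact h2.measure_mem_eq (s := {x | K < x ^ 2})
      (measurableSet_lt measurable_const (measurable_id.pow_const 2))
  have hXt : ∀ {η : ℝ≥0∞}, 0 < η → ∃ K : ℝ, 0 < K ∧ ∀ t, μ {ω | K < X t ω ^ 2} ≤ η := by
    intro η hη
    obtain ⟨n, hn, hn0⟩ := (((tendsto_measure_lt_atTop (μ := μ)
      ((hX.measurable_X 0).pow_const 2)).eventually_le_const hη).and
      (eventually_gt_atTop 0)).exists
    exact ⟨n, by exact_mod_cast hn0, fun t => (hXlaw t n).trans_le hn⟩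
  -- Stationarity is assumed of X alone. The volatilities are tight because σ_t² = X_t²/ε_t² and
  -- |ε_t| ≤ δ has small probability.
  have hσt : ∀ {η : ℝ≥0∞}, 0 < η → ∃ K : ℝ, 0 < K ∧ ∀ t, μ {ω | K < σ t ω ^ 2} ≤ η := by
    intro η hη
    obtain ⟨K, hK, hKX⟩ := hXt (ENNReal.half_pos hη.ne')
    obtain ⟨δ, hδ, hδε⟩ := exists_measure_abs_le_le hsmall (ENNReal.half_pos hη.ne')
    refine ⟨K / δ ^ 2, by positivity, fun t => ?_⟩
    have hεlaw : μ {ω | |ε t ω| ≤ δ} = μ {ω | |ε 0 ω| ≤ δ} :=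
      (hε.identDistrib t).measure_mem_eq (s := {x | |x| ≤ δ})
        (measurableSet_le measurable_id.abs measurable_const)
    have hsub : ({ω | K / δ ^ 2 < σ t ω ^ 2} : Set Ω) ≤ᵐ[μ]
        ({ω | K < X t ω ^ 2} ∪ {ω | |ε t ω| ≤ δ} : Set Ω) := by
      filter_upwards [hX.X_eq t] with ω hω h
      by_cases h' : |ε t ω| ≤ δ
      · exact Or.inr h'
      · left
        replace h : K / δ ^ 2 < σ t ω ^ 2 := h
        show K < X t ω ^ 2
        push Not at h'
        have h3 : δ ^ 2 < ε t ω ^ 2 := by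
          rw [← sq_abs (ε t ω)]
          exact pow_lt_pow_left₀ h' hδ.le two_ne_zero
        rw [div_lt_iff₀ (by positivity)] at h
        rw [hω, mul_pow]
        nlinarith [sq_nonneg (σ t ω)]
    calc μ {ω | K / δ ^ 2 < σ t ω ^ 2} ≤ μ ({ω | K < X t ω ^ 2} ∪ {ω | |ε t ω| ≤ δ}) :=
          measure_mono_ae hsub
      _ ≤ μ {ω | K < X t ω ^ 2} + μ {ω | |ε t ω| ≤ δ} := measure_union_le _ _
      _ ≤ η / 2 + η / 2 := add_le_add (hKX t) (hεlaw.trans_le hδε)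
      _ = η := ENNReal.add_halves η
  -- Each coordinate receives the share η/d; the added 1 keeps d nonzero.
  set d : ℝ≥0∞ := (Fintype.card (Fin p ⊕ Fin q) : ℝ≥0∞) + 1
  have hd0 : d ≠ 0 := by simp [d]
  have hdt : d ≠ ∞ := by simp [d]
  obtain ⟨K₁, hK₁, h₁⟩ := hXt (ENNReal.div_pos hη.ne' hdt)
  obtain ⟨K₂, hK₂, h₂⟩ := hσt (ENNReal.div_pos hη.ne' hdt)
  refine ⟨max K₁ K₂, by positivity, fun t => ?_⟩
  have hsub : {ω | max K₁ K₂ < ‖garchState p q σ X t ω‖} ⊆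
      ⋃ a, {ω | max K₁ K₂ < garchState p q σ X t ω a} := by
    intro ω hω
    by_contra hcon
    simp only [Set.mem_iUnion, Set.mem_ofPred_eq, not_exists, not_lt] at hcon hω
    refine absurd hω (not_lt.2 ((pi_norm_le_iff_of_nonneg (by positivity)).2 fun a => ?_))
    rw [Real.norm_of_nonneg]
    · exact hcon a
    · rcases a with i | j
      · exact sq_nonneg _
      · exact sq_nonneg _
  calc μ {ω | max K₁ K₂ < ‖garchState p q σ X t ω‖}
      ≤ ∑ a, μ {ω | max K₁ K₂ < garchState p q σ X t ω a} :=
        (measure_mono hsub).trans (measure_iUnion_fintype_le _ _)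
    _ ≤ ∑ _a : Fin p ⊕ Fin q, η / d := by
        refine Finset.sum_le_sum fun a _ => ?_
        rcases a with i | j
        · refine le_trans (measure_mono fun ω hω => ?_) (h₁ (t - (i : ℕ)))
          exact lt_of_le_of_lt (le_max_left K₁ K₂) hω
        · refine le_trans (measure_mono fun ω hω => ?_) (h₂ (t - (j : ℕ)))
          exact lt_of_le_of_lt (le_max_right K₁ K₂) hω
    _ = Fintype.card (Fin p ⊕ Fin q) * (η / d) := by simp
    _ ≤ d * (η / d) := by gcongr; simp [d]
    _ = η := ENNReal.mul_div_cancel hd0 hdt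

lemma ENNReal.rpow_finsetSum_le {ι : Type*} (s : Finset ι) (f : ι → ℝ≥0∞) {r : ℝ} (hr : 0 < r)
    (hr1 : r ≤ 1) : (∑ i ∈ s, f i) ^ r ≤ ∑ i ∈ s, f i ^ r := by
  classical
  induction s using Finset.induction_on with
  | empty => simp [hr]
  | insert a s ha ih =>
    rw [Finset.sum_insert ha, Finset.sum_insert ha]
    exact (ENNReal.rpow_add_le_add_rpow _ _ hr.le hr1).trans (by gcongr)

/-- Powers r ≤ 1 are subadditive, which is why fractional moments of a series are controlled term by
term. -/
lemma ENNReal.rpow_tsum_le (f : ℕ → ℝ≥0∞) {r : ℝ} (hr : 0 < r) (hr1 : r ≤ 1) :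
    (∑' i, f i) ^ r ≤ ∑' i, f i ^ r := by
  rw [← ENNReal.le_rpow_inv_iff hr]
  refine ENNReal.tsum_le_of_sum_range_le fun n => ?_
  rw [ENNReal.le_rpow_inv_iff hr]
  exact (ENNReal.rpow_finsetSum_le _ _ hr hr1).trans (ENNReal.sum_le_tsum _)

lemma measurable_garchShock (θ : GarchParam p q) : Measurable (garchShock θ) := by
  refine measurable_pi_iff.2 fun a => ?_
  rcases a with i | j
  · simp only [garchShock, Sum.elim_inl]
    split_ifs
    · exact (measurable_id.pow_const 2).const_mul _
    · exact measurable_const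
  · simp only [garchShock, Sum.elim_inr]
    exact measurable_const

lemma norm_garchShock_le (θ : GarchParam p q) (x : ℝ) : ‖garchShock θ x‖ ≤ ‖θ‖ * (1 + x ^ 2) := by
  have h0 := norm_le_pi_norm θ (Sum.inl 0)
  have h1 := norm_nonneg θ
  have h2 := sq_nonneg x
  refine (pi_norm_le_iff_of_nonneg (by positivity)).2 fun a => ?_
  rcases a with i | j
  · simp only [garchShock, Sum.elim_inl]
    split_ifs
    · rw [norm_mul, Real.norm_of_nonneg h2]
      nlinarith
    · rw [norm_zero]; positivity
  · simp only [garchShock, Sum.elim_inr]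
    split_ifs
    · nlinarith
    · rw [norm_zero]; positivity

/-- Under the Bougerol–Picard condition the squares of a stationary solution and of its volatilities
are functions of the past innovations, and have a fractional moment. -/
theorem IsStationaryGarch.exists_isPastFactor [IsProbabilityMeasure μ]
    (hε : IsGarchInnovation μ ε) (hγ : garchLyapunov μ θ ε < 0) (hX : IsStationaryGarch μ θ ε σ X)
    (hsmall : ∃ ζ : ℝ, 0 < ζ ∧
      Tendsto (fun x : ℝ => x ^ (-ζ) * μ.real {ω | |ε 0 ω| ≤ x}) (𝓝[>] 0) (𝓝 0)) :
    (∀ a, IsPastFactor μ ε fun t ω => garchState p q σ X t ω a) ∧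
    ∃ s : ℝ, 0 < s ∧ s ≤ 1 ∧ ∃ C : ℝ≥0∞, C ≠ ∞ ∧
      ∀ t a, ∫⁻ ω, ‖garchState p q σ X t ω a‖ₑ ^ s ∂μ ≤ C := by
  obtain ⟨s, hs0, hs1, hsum⟩ := hε.exists_tsum_prodMoment_ne_top hγ
  set bound : (ℕ → ℝ) → ℕ → ℝ≥0∞ := fun e l =>
    supOpNorm (garchBackProd θ e l) * ‖garchShock θ (e l)‖ₑ
  have hbm : ∀ l, Measurable fun e => bound e l := fun l =>
    (measurable_supOpNorm_garchBackProd θ l fun i _ =>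
      measurable_pi_apply i).coe_nnreal_ennreal.mul
      ((measurable_garchShock θ).comp (measurable_pi_apply l)).enorm
  set b : ℝ≥0∞ := ∫⁻ ω, ‖garchShock θ (ε 0 ω)‖ₑ ^ s ∂μ
  have hb : b ≠ ∞ := by
    have hint : Integrable (fun ω => ‖θ‖ * (1 + ε 0 ω ^ 2)) μ :=
      ((integrable_const _).add hε.integrable_sq).const_mul _
    have h1 : ∫⁻ ω, (1 + ENNReal.ofReal (‖θ‖ * (1 + ε 0 ω ^ 2))) ∂μ ≠ ∞ := by
      rw [lintegral_add_left measurable_const]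
      simp only [lintegral_const, measure_univ, mul_one]
      exact ENNReal.add_ne_top.2 ⟨ENNReal.one_ne_top, hint.lintegral_lt_top.ne⟩
    refine ne_top_of_le_ne_top h1 (lintegral_mono fun ω => ?_)
    refine (ENNReal.rpow_le_one_add hs0.le hs1).trans ?_
    gcongr
    rw [← ofReal_norm]
    exact ENNReal.ofReal_le_ofReal (norm_garchShock_le _ _)
  set C : ℝ≥0∞ := (∑' m, prodMoment μ ε θ s m) * b
  have hC : C ≠ ∞ := ENNReal.mul_ne_top hsum hb
  have hmom : ∀ t, ∫⁻ ω, (∑' l, bound (pastSeq ε t ω) l) ^ s ∂μ ≤ C := by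
    intro t
    calc ∫⁻ ω, (∑' l, bound (pastSeq ε t ω) l) ^ s ∂μ
        ≤ ∫⁻ ω, ∑' l, bound (pastSeq ε t ω) l ^ s ∂μ :=
          lintegral_mono fun ω => ENNReal.rpow_tsum_le _ hs0 hs1
      _ = ∑' l, ∫⁻ ω, bound (pastSeq ε t ω) l ^ s ∂μ := lintegral_tsum fun l =>
          (((hbm l).pow_const s).comp (hε.measurable_pastSeq t)).aemeasurable
      _ = ∑' l, prodMoment μ ε θ s l * b := by
          congr 1
          funext l
          -- The l-th product involves ε_t, …, ε_{t-l+1} and the shock involves ε_{t-l}, so the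
          -- moment factorises.
          have := hε.lintegral_mul_remote θ s l t (G := fun e => ‖garchShock θ (e 0)‖ₑ ^ s)
            (((measurable_garchShock θ).comp (measurable_pi_apply 0)).enorm.pow_const s)
          simp only [add_zero] at this
          have hb' : b = ∫⁻ ω, ‖garchShock θ (pastSeq ε 0 ω 0)‖ₑ ^ s ∂μ := by simp [b, pastSeq]
          rw [hb', ← this]
          exact lintegral_congr fun ω => ENNReal.mul_rpow_of_nonneg _ _ hs0.le
      _ = C := ENNReal.tsum_mul_right
  have hfin : ∀ t, ∀ᵐ ω ∂μ, ∑' l, bound (pastSeq ε t ω) l ≠ ∞ := by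
    intro t
    have hm : Measurable fun ω => (∑' l, bound (pastSeq ε t ω) l) ^ s :=
      ((Measurable.tsum hbm).pow_const s).comp (hε.measurable_pastSeq t)
    filter_upwards [ae_lt_top hm (ne_top_of_le_ne_top hC (hmom t))] with ω hω
    intro h
    rw [h, ENNReal.top_rpow_of_pos hs0] at hω
    exact lt_irrefl _ hω
  set term : (ℕ → ℝ) → ℕ → Fin p ⊕ Fin q → ℝ := fun e l =>
    (garchBackProd θ e l).mulVec (garchShock θ (e l))
  have hterm : ∀ e l a, ‖term e l a‖ₑ ≤ bound e l := by
    intro e l a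
    have h1 : ‖term e l a‖ ≤ supOpNorm (garchBackProd θ e l) * ‖garchShock θ (e l)‖ :=
      (norm_le_pi_norm _ a).trans (norm_mulVec_le_supOpNorm _ _)
    rw [← ofReal_norm]
    refine (ENNReal.ofReal_le_ofReal h1).trans_eq ?_
    rw [ENNReal.ofReal_mul NNReal.zero_le_coe, ENNReal.ofReal_coe_nnreal, ofReal_norm]
  have htermsum : ∀ e, ∑' l, bound e l ≠ ∞ → ∀ a, Summable (fun l => term e l a) := by
    intro e he a
    refine Summable.of_enorm ?_
    exact ne_top_of_le_ne_top he (ENNReal.tsum_le_tsum fun l => hterm e l a)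
  have htermm : ∀ l a, Measurable fun e => term e l a := by
    intro l a
    simp only [term, Matrix.mulVec, dotProduct]
    exact Finset.measurable_fun_sum _ fun c _ =>
      (measurable_garchBackProd_apply θ l (fun i _ => measurable_pi_apply i) a c).mul
        ((measurable_pi_apply c).comp ((measurable_garchShock θ).comp (measurable_pi_apply l)))
  -- The sum over m of the s-th powers of the norms has finite expectation, so it is finite almost
  -- surely and its terms tend to 0.
  have hprod0 : ∀ t, ∀ᵐ ω ∂μ,
      Tendsto (fun m => (supOpNorm (garchBackProd θ (pastSeq ε t ω) m) : ℝ)) atTop (𝓝 0) := by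
    intro t
    have hm : ∀ l, Measurable fun ω =>
        (supOpNorm (garchBackProd θ (pastSeq ε t ω) l) : ℝ≥0∞) ^ s := fun l =>
      (measurable_supOpNorm_garchBackProd_rpow θ s l).comp (hε.measurable_pastSeq t)
    have hi : ∫⁻ ω, ∑' l, (supOpNorm (garchBackProd θ (pastSeq ε t ω) l) : ℝ≥0∞) ^ s ∂μ ≠ ∞ := by
      rw [lintegral_tsum fun l => (hm l).aemeasurable]
      simp only [hε.lintegral_supOpNorm_rpow]
      exact hsum
    filter_upwards [ae_lt_top (Measurable.tsum hm) hi] with ω hω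
    have h1 := ENNReal.tendsto_atTop_zero_of_tsum_ne_top hω.ne
    have h2 := h1.ennrpow_const s⁻¹
    rw [ENNReal.zero_rpow_of_pos (inv_pos.2 hs0)] at h2
    simp only [ENNReal.rpow_rpow_inv hs0.ne'] at h2
    have h3 : Tendsto (fun m => supOpNorm (garchBackProd θ (pastSeq ε t ω) m)) atTop (𝓝 0) := by
      rw [← ENNReal.coe_zero] at h2
      exact ENNReal.tendsto_coe.1 h2
    simpa using NNReal.tendsto_coe.2 h3
  -- The remainders converge almost surely to the state minus the series, and in probability to 0;
  -- the two limits coincide.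
  have hstate : ∀ t a, ∀ᵐ ω ∂μ, garchState p q σ X t ω a = ∑' l, term (pastSeq ε t ω) l a := by
    intro t a
    set R : ℕ → Ω → ℝ := fun m ω =>
      garchState p q σ X t ω a - ∑ l ∈ Finset.range m, term (pastSeq ε t ω) l a
    have hsm : Measurable fun ω => garchState p q σ X t ω a := by
      rcases a with i | j
      · exact (hX.measurable_X _).pow_const 2
      · exact (hX.measurable_σ _).pow_const 2
    have hRm : ∀ m, Measurable (R m) := fun m => hsm.sub (Finset.measurable_fun_sum _ fun l _ =>
      (htermm l a).comp (hε.measurable_pastSeq t))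
    have hR1 : TendstoInMeasure μ R atTop
        (fun ω => garchState p q σ X t ω a - ∑' l, term (pastSeq ε t ω) l a) := by
      refine tendstoInMeasure_of_tendsto_ae (fun m => (hRm m).aestronglyMeasurable) ?_
      filter_upwards [hfin t] with ω hω
      exact (htermsum _ hω a).hasSum.tendsto_sum_nat.const_sub _
    -- The remainder is the m-fold product applied to the state at time t − m. The product tends to
    -- 0 but the state is merely tight, so the convergence obtained is in probability.
    have hR2 : TendstoInMeasure μ R atTop (fun _ => (0 : ℝ)) := by
      rw [tendstoInMeasure_iff_norm]
      intro η hη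
      have hM : TendstoInMeasure μ
          (fun m ω => (supOpNorm (garchBackProd θ (pastSeq ε t ω) m) : ℝ)) atTop
          (fun _ => (0 : ℝ)) :=
        tendstoInMeasure_of_tendsto_ae (fun m =>
          ((measurable_supOpNorm_garchBackProd θ m fun i _ =>
            hε.measurable _).coe_nnreal_real).aestronglyMeasurable) (hprod0 t)
      rw [tendstoInMeasure_iff_norm] at hM
      rw [ENNReal.tendsto_nhds_zero]
      intro κ hκ
      obtain ⟨K, hK, hKt⟩ := hX.tight_state hε hsmall (ENNReal.half_pos hκ.ne')
      filter_upwards [ENNReal.tendsto_nhds_zero.1 (hM (η / K) (by positivity)) (κ / 2)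
        (ENNReal.half_pos hκ.ne')] with m hm
      have hsub : ({ω | η ≤ ‖R m ω - 0‖} : Set Ω) ≤ᵐ[μ]
          ({ω | η / K ≤ ‖(supOpNorm (garchBackProd θ (pastSeq ε t ω) m) : ℝ) - 0‖} ∪
            {ω | K < ‖garchState p q σ X (t - m) ω‖} : Set Ω) := by
        filter_upwards [hX.state_eq_iterate t] with ω hω h
        by_cases h' : K < ‖garchState p q σ X (t - m) ω‖
        · exact Or.inr h'
        · left
          replace h : η ≤ ‖R m ω - 0‖ := h
          show η / K ≤ ‖(supOpNorm (garchBackProd θ (pastSeq ε t ω) m) : ℝ) - 0‖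
          push Not at h'
          have h1 : R m ω = ((garchBackProd θ (pastSeq ε t ω) m).mulVec
              (garchState p q σ X (t - m) ω)) a := by
            simp only [R]
            rw [hω m]
            simp [term]
          rw [sub_zero, h1] at h
          rw [sub_zero, Real.norm_of_nonneg NNReal.zero_le_coe, div_le_iff₀ hK]
          calc η ≤ _ := h
            _ ≤ _ := norm_le_pi_norm _ a
            _ ≤ _ := norm_mulVec_le_supOpNorm _ _
            _ ≤ _ := by gcongr
      calc μ {ω | η ≤ ‖R m ω - 0‖} ≤ _ := measure_mono_ae hsub
        _ ≤ _ := measure_union_le _ _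
        _ ≤ κ / 2 + κ / 2 := add_le_add hm (hKt _)
        _ = κ := ENNReal.add_halves κ
    filter_upwards [tendstoInMeasure_ae_unique hR1 hR2] with ω hω
    linarith
  refine ⟨fun a => ?_, s, hs0, hs1, C, hC, fun t a => ?_⟩
  · refine IsPastFactor.congr (IsPastFactor.tsum
      (V := fun l t ω => term (pastSeq ε t ω) l a)
      (fun l => IsPastFactor.of_pastSeq (htermm l a)) fun t => ?_) fun t => hstate t a
    filter_upwards [hfin t] with ω hω
    exact htermsum _ hω a
  · refine (lintegral_mono_ae ?_).trans (hmom t)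
    filter_upwards [hstate t a] with ω h1
    rw [h1]
    refine ENNReal.rpow_le_rpow ?_ hs0.le
    exact enorm_tsum_le_tsum_enorm.trans (ENNReal.tsum_le_tsum fun l => hterm _ l a)

end CausalSolution

/-! ### Subexponential growth of trajectories. -/

section Growth

/-- The two-sided sequence `x` grows more slowly than every exponential. -/
def SubexpGrowth (x : ℤ → ℝ) : Prop :=
  ∀ r : ℝ, 0 < r → r < 1 → ∃ B : ℝ, ∀ t, |x t| * r ^ t.natAbs ≤ B

/-- The requirement strengthens as r increases to 1, so rates above a fixed r₀ < 1 suffice. -/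
lemma SubexpGrowth.of_le {x : ℤ → ℝ} {r₀ : ℝ} (hr₀ : r₀ < 1)
    (h : ∀ r : ℝ, 0 < r → r₀ < r → r < 1 → ∃ B : ℝ, ∀ t, |x t| * r ^ t.natAbs ≤ B) :
    SubexpGrowth x := by
  intro r hr hr1
  have h1 : r ≤ max r ((1 + r₀) / 2) := le_max_left _ _
  obtain ⟨B, hB⟩ := h (max r ((1 + r₀) / 2)) (lt_of_lt_of_le hr h1)
    (lt_of_lt_of_le (by linarith) (le_max_right _ _)) (max_lt hr1 (by linarith))
  refine ⟨B, fun t => le_trans ?_ (hB t)⟩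
  gcongr

lemma SubexpGrowth.add {x y : ℤ → ℝ} (hx : SubexpGrowth x) (hy : SubexpGrowth y) :
    SubexpGrowth (fun t => x t + y t) := by
  intro r hr hr1
  obtain ⟨B, hB⟩ := hx r hr hr1
  obtain ⟨B', hB'⟩ := hy r hr hr1
  refine ⟨B + B', fun t => ?_⟩
  have := mul_le_mul_of_nonneg_right (abs_add_le (x t) (y t)) (pow_nonneg hr.le t.natAbs)
  linarith [hB t, hB' t, add_mul |x t| |y t| (r ^ t.natAbs)]

/-- The rate √r is spent on each factor. -/
lemma SubexpGrowth.mul {x y : ℤ → ℝ} (hx : SubexpGrowth x) (hy : SubexpGrowth y) :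
    SubexpGrowth (fun t => x t * y t) := by
  intro r hr hr1
  have hs0 : 0 < Real.sqrt r := Real.sqrt_pos.2 hr
  have hs1 : Real.sqrt r < 1 := by rw [Real.sqrt_lt' one_pos]; simpa
  obtain ⟨B, hB⟩ := hx _ hs0 hs1
  obtain ⟨B', hB'⟩ := hy _ hs0 hs1
  refine ⟨B * B', fun t => ?_⟩
  have h1 : |x t * y t| * r ^ t.natAbs =
      (|x t| * Real.sqrt r ^ t.natAbs) * (|y t| * Real.sqrt r ^ t.natAbs) := by
    rw [abs_mul]
    nth_rewrite 1 [← Real.mul_self_sqrt hr.le]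
    rw [mul_pow]
    ring
  rw [h1]
  exact mul_le_mul (hB t) (hB' t) (by positivity) ((by positivity : (0 : ℝ) ≤ _).trans (hB t))

lemma SubexpGrowth.neg {x : ℤ → ℝ} (hx : SubexpGrowth x) : SubexpGrowth (fun t => -x t) := by
  intro r hr hr1
  simpa using hx r hr hr1

lemma SubexpGrowth.const (c : ℝ) : SubexpGrowth (fun _ => c) := by
  intro r hr hr1
  exact ⟨|c|, fun t => mul_le_of_le_one_right (abs_nonneg _) (pow_le_one₀ hr.le hr1.le)⟩

lemma SubexpGrowth.pow {x : ℤ → ℝ} (hx : SubexpGrowth x) (k : ℕ) :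
    SubexpGrowth (fun t => x t ^ k) := by
  induction k with
  | zero => simpa using SubexpGrowth.const 1
  | succ k ih => simpa only [pow_succ] using ih.mul hx

lemma SubexpGrowth.exists_le_mul {x : ℤ → ℝ} (hx : SubexpGrowth x) {r : ℝ} (hr : 0 < r)
    (hr1 : r < 1) : ∃ B : ℝ, 0 ≤ B ∧ ∀ (t : ℤ) (i : ℕ), |x (t - i)| * r ^ (t.natAbs + i) ≤ B := by
  obtain ⟨B, hB⟩ := hx r hr hr1
  refine ⟨B, le_trans (by positivity) (hB 0), fun t i => le_trans ?_ (hB (t - i))⟩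
  refine mul_le_mul_of_nonneg_left ?_ (abs_nonneg _)
  exact pow_le_pow_of_le_one hr.le hr1.le (by omega)

/-- Since |t − i − 1| ≤ |t| + i + 1, the growth of x at rate r costs r^{-(i+1)} r^{-|t|}, and the
decay ρ^{i+1} with ρ < r leaves a geometric series in ρ/r. -/
lemma SubexpGrowth.exists_sum_bound {x : ℤ → ℝ} (hx : SubexpGrowth x) {ρ r : ℝ} (hρ : 0 < ρ)
    (hρr : ρ < r) (hr1 : r < 1) {c : ℕ → ℝ} {A : ℝ} (hc : ∀ i, |c i| ≤ A * ρ ^ i) :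
    ∃ B : ℝ, ∀ t : ℤ, (Summable fun i : ℕ => |c (i + 1) * x (t - (i + 1))|) ∧
      (∑' i : ℕ, |c (i + 1) * x (t - (i + 1))|) * r ^ t.natAbs ≤ B := by
  have hr : 0 < r := hρ.trans hρr
  obtain ⟨B, hB0, hB⟩ := hx.exists_le_mul hr hr1
  have hA : 0 ≤ A := by simpa using (abs_nonneg _).trans (hc 0)
  have hq : 0 ≤ ρ / r := by positivity
  have hq1 : ρ / r < 1 := (div_lt_one hr).2 hρr
  have hg := (summable_geometric_of_lt_one hq hq1).mul_left (A * B)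
  have hle : ∀ (t : ℤ) (i : ℕ), |c (i + 1) * x (t - (i + 1))| * r ^ t.natAbs ≤
      A * B * (ρ / r) ^ i := by
    intro t i
    have h1 := hB t (i + 1)
    rw [abs_mul]
    have h2 : |x (t - (i + 1))| * r ^ t.natAbs ≤ B / r ^ (i + 1) := by
      rw [le_div_iff₀ (by positivity), mul_assoc, ← pow_add]
      exact_mod_cast h1
    calc |c (i + 1)| * |x (t - (i + 1))| * r ^ t.natAbs
        = |c (i + 1)| * (|x (t - (i + 1))| * r ^ t.natAbs) := by ring
      _ ≤ (A * ρ ^ (i + 1)) * (B / r ^ (i + 1)) :=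
          mul_le_mul (hc _) h2 (by positivity) (by positivity)
      _ = A * B * (ρ / r) ^ (i + 1) := by rw [div_pow]; ring
      _ ≤ A * B * (ρ / r) ^ i :=
          mul_le_mul_of_nonneg_left (pow_le_pow_of_le_one hq hq1.le (by omega)) (by positivity)
  refine ⟨∑' i, A * B * (ρ / r) ^ i, fun t => ?_⟩
  have hs : Summable fun i : ℕ => |c (i + 1) * x (t - (i + 1))| * r ^ t.natAbs :=
    hg.of_nonneg_of_le (fun i => by positivity) (hle t)
  refine ⟨?_, ?_⟩
  · refine (summable_mul_right_iff (pow_pos hr t.natAbs).ne').1 hs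
  · rw [← tsum_mul_right]
    exact hs.tsum_le_tsum (hle t) hg

lemma summable_int_pow_natAbs {r : ℝ} (hr : 0 ≤ r) (hr1 : r < 1) :
    Summable fun t : ℤ => r ^ t.natAbs := by
  refine Summable.of_nat_of_neg ?_ ?_
  · simpa using summable_geometric_of_lt_one hr hr1
  · simpa using summable_geometric_of_lt_one hr hr1

/-- A process with a uniformly bounded fractional moment has subexponential trajectories. -/
lemma ae_subexpGrowth_of_lintegral_rpow_le {Ω : Type*} [MeasurableSpace Ω] {μ : Measure Ω}
    {Y : ℤ → Ω → ℝ} (hY : ∀ t, AEMeasurable (Y t) μ) {s : ℝ} (hs : 0 < s) {C : ℝ≥0∞} (hC : C ≠ ∞)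
    (h : ∀ t, ∫⁻ ω, ‖Y t ω‖ₑ ^ s ∂μ ≤ C) : ∀ᵐ ω ∂μ, SubexpGrowth fun t => Y t ω := by
  have key : ∀ r : ℝ, 0 < r → r < 1 → ∀ᵐ ω ∂μ, ∃ B : ℝ, ∀ t, |Y t ω| * r ^ t.natAbs ≤ B := by
    intro r hr hr1
    -- The sum over t of |Y_t|^s r^{s|t|} has finite expectation, so it is almost surely finite and
    -- bounds each of its terms.
    set f : ℤ → Ω → ℝ≥0∞ := fun t ω => ‖Y t ω‖ₑ ^ s * ENNReal.ofReal ((r ^ s) ^ t.natAbs)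
    have hfm : ∀ t, AEMeasurable (f t) μ := fun t => ((hY t).enorm.pow_const s).mul_const _
    have hrs : r ^ s < 1 := Real.rpow_lt_one hr.le hr1 hs
    have hrs0 : 0 < r ^ s := Real.rpow_pos_of_pos hr s
    have hint : ∫⁻ ω, ∑' t, f t ω ∂μ ≠ ∞ := by
      rw [lintegral_tsum hfm]
      refine ne_top_of_le_ne_top (ENNReal.mul_ne_top hC
        (summable_int_pow_natAbs hrs0.le hrs).tsum_ofReal_ne_top) ?_
      rw [← ENNReal.tsum_mul_left]
      refine ENNReal.tsum_le_tsum fun t => ?_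
      rw [lintegral_mul_const'' _ ((hY t).enorm.pow_const s)]
      gcongr
      exact h t
    filter_upwards [ae_lt_top' (AEMeasurable.tsum hfm) hint] with ω hω
    refine ⟨((∑' t, f t ω) ^ s⁻¹).toReal, fun t => ?_⟩
    have h1 : f t ω ≤ ∑' t, f t ω := ENNReal.le_tsum t
    have h2 : f t ω = ENNReal.ofReal (|Y t ω| * r ^ t.natAbs) ^ s := by
      simp only [f]
      rw [ENNReal.ofReal_mul (abs_nonneg _), ENNReal.mul_rpow_of_nonneg _ _ hs.le,
        ENNReal.ofReal_rpow_of_pos (by positivity : 0 < r ^ t.natAbs), ← Real.norm_eq_abs,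
        ofReal_norm]
      congr 2
      rw [← Real.rpow_natCast, ← Real.rpow_natCast, ← Real.rpow_mul hr.le, ← Real.rpow_mul hr.le,
        mul_comm]
    rw [h2, ← ENNReal.le_rpow_inv_iff hs] at h1
    refine (ENNReal.ofReal_le_iff_le_toReal ?_).1 h1
    exact ENNReal.rpow_ne_top_of_nonneg (inv_nonneg.2 hs.le) hω.ne
  -- The countably many rates 1 − 1/(n+2) increase to 1, so a single null set serves all r.
  have hn : ∀ n : ℕ, 0 < 1 - 1 / ((n : ℝ) + 2) ∧ 1 - 1 / ((n : ℝ) + 2) < 1 := by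
    intro n
    have h1 : (0 : ℝ) < 1 / ((n : ℝ) + 2) := by positivity
    have h2 : 1 / ((n : ℝ) + 2) < 1 := by
      rw [div_lt_one (by positivity)]
      have : (0 : ℝ) ≤ n := n.cast_nonneg
      linarith
    constructor <;> linarith
  filter_upwards [ae_all_iff.2 fun n : ℕ => key _ (hn n).1 (hn n).2] with ω hω r hr hr1
  obtain ⟨n, hn'⟩ := exists_nat_one_div_lt (sub_pos.2 hr1)
  obtain ⟨B, hB⟩ := hω n
  refine ⟨B, fun t => le_trans ?_ (hB t)⟩
  have h3 : 1 / ((n : ℝ) + 2) ≤ 1 / ((n : ℝ) + 1) :=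
    one_div_le_one_div_of_le (by positivity) (by linarith)
  have h4 : r ≤ 1 - 1 / ((n : ℝ) + 2) := by linarith
  gcongr

end Growth

/-! ### Decay of the coefficients c_i and their behaviour near θ. -/

section Coefficients

variable {p q : ℕ} {θ : GarchParam p q}

/-- The entry `s_i` of a parameter vector, read as `0` for `i > p`. -/
def garchArchEntry (u : GarchParam p q) (i : ℕ) : ℝ :=
  if h : i ≤ p then u (Sum.inl ⟨i, Nat.lt_succ_of_le h⟩) else 0

lemma garchCoef_zero (u : GarchParam p q) :
    garchCoef u 0 = u (Sum.inl 0) / (1 - ∑ j : Fin q, u (Sum.inr j)) := by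
  rw [garchCoef]

lemma garchCoef_succ (u : GarchParam p q) (i : ℕ) :
    garchCoef u (i + 1) = garchArchEntry u (i + 1) +
      ∑ j : Fin q, if (j : ℕ) < i then u (Sum.inr j) * garchCoef u (i - j) else 0 := by
  rw [garchCoef]
  rfl

lemma garchArchEntry_nonneg (hθ : ∀ a, 0 < θ a) (i : ℕ) : 0 ≤ garchArchEntry θ i := by
  unfold garchArchEntry
  split_ifs
  · exact (hθ _).le
  · exact le_rfl

lemma garchCoef_nonneg (hθ : ∀ a, 0 < θ a) (hβ : ∑ j : Fin q, θ (Sum.inr j) < 1) (i : ℕ) :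
    0 ≤ garchCoef θ i := by
  induction i using Nat.strong_induction_on with
  | _ i ih =>
    rcases i with _ | i
    · rw [garchCoef_zero]
      exact div_nonneg (hθ _).le (by linarith)
    · rw [garchCoef_succ]
      refine add_nonneg (garchArchEntry_nonneg hθ _) (Finset.sum_nonneg fun j _ => ?_)
      split_ifs
      · exact mul_nonneg (hθ _).le (ih _ (by omega))
      · exact le_rfl

lemma garchCoef_zero_pos (hθ : ∀ a, 0 < θ a) (hβ : ∑ j : Fin q, θ (Sum.inr j) < 1) :
    0 < garchCoef θ 0 := by
  rw [garchCoef_zero]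
  exact div_pos (hθ _) (by linarith)

lemma exists_lt_pow_lt_one {a : ℝ} (ha : a < 1) (n : ℕ) : ∃ r : ℝ, 0 < r ∧ r < 1 ∧ a < r ^ n := by
  have h1 : Tendsto (fun r : ℝ => r ^ n) (𝓝[<] 1) (𝓝 1) := by
    have := (continuous_pow n).tendsto (1 : ℝ)
    rw [one_pow] at this
    exact this.mono_left nhdsWithin_le_nhds
  have h2 : ∀ᶠ r : ℝ in 𝓝[<] 1, r < 1 := self_mem_nhdsWithin
  have h3 : ∀ᶠ r : ℝ in 𝓝[<] 1, 0 < r :=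
    mem_nhdsWithin_of_mem_nhds (Ioi_mem_nhds zero_lt_one)
  obtain ⟨r, hr, hr1, hr0⟩ := ((h1.eventually_const_lt ha).and (h2.and h3)).exists
  exact ⟨r, hr0, hr1, hr⟩

/-- With T the sum of the β_j, take ρ < 1 so near 1 that T/ρ^q ≤ (1+T)/2. In the induction the
recursive part then uses the share (1+T)/2 of the bound, and the entries s_i fit into the remaining
share (1−T)/2. -/
lemma garchCoef_le_geometric (hθ : ∀ a, 0 < θ a) (hβ : ∑ j : Fin q, θ (Sum.inr j) < 1) :
    ∃ ρ : ℝ, 0 < ρ ∧ ρ < 1 ∧ ∃ C : ℝ, 0 < C ∧ ∀ i, garchCoef θ i ≤ C * ρ ^ i := by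
  set T := ∑ j : Fin q, θ (Sum.inr j)
  have hT : 0 ≤ T := Finset.sum_nonneg fun j _ => (hθ _).le
  obtain ⟨ρ, hρ0, hρ1, hρ⟩ := exists_lt_pow_lt_one (a := 2 * T / (1 + T))
    (by rw [div_lt_one (by linarith)]; linarith) q
  have hTρ : 2 * T ≤ ρ ^ q * (1 + T) := by
    rw [div_lt_iff₀ (by linarith)] at hρ
    exact hρ.le
  have hs : ∀ i, garchArchEntry θ i ≤ ‖θ‖ := by
    intro i
    unfold garchArchEntry
    split_ifs
    · exact (le_abs_self _).trans (norm_le_pi_norm θ _)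
    · exact norm_nonneg _
  -- Chosen so that C₁ ρ^p (1−T)/2 = ‖θ‖, which covers s_i for every i ≤ p.
  set C₁ := 2 * ‖θ‖ / ((1 - T) * ρ ^ p) with hC₁
  have hC₁0 : 0 ≤ C₁ := div_nonneg (by positivity) (mul_nonneg (by linarith) (by positivity))
  have hs' : ∀ i, garchArchEntry θ i ≤ C₁ * ρ ^ i * ((1 - T) / 2) := by
    intro i
    by_cases h : i ≤ p
    · have h1 : ρ ^ p ≤ ρ ^ i := pow_le_pow_of_le_one hρ0.le hρ1.le h
      have h2 : C₁ * ρ ^ p * ((1 - T) / 2) = ‖θ‖ := by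
        have : (1 - T) ≠ 0 := by linarith
        rw [hC₁]
        field_simp
      calc garchArchEntry θ i ≤ C₁ * ρ ^ p * ((1 - T) / 2) := (hs i).trans h2.ge
        _ ≤ _ := by
          have : 0 ≤ (1 - T) / 2 := by linarith
          gcongr
    · have : garchArchEntry θ i = 0 := dif_neg h
      rw [this]
      exact mul_nonneg (by positivity) (by linarith)
  have hc0 : 0 < garchCoef θ 0 := garchCoef_zero_pos hθ hβ
  refine ⟨ρ, hρ0, hρ1, C₁ + garchCoef θ 0, by positivity, fun i => ?_⟩
  set C := C₁ + garchCoef θ 0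
  have hC : C₁ ≤ C := by simp only [C]; linarith
  have hC0 : 0 ≤ C := by positivity
  induction i using Nat.strong_induction_on with
  | _ i ih =>
    rcases i with _ | i
    · simp only [C, pow_zero, mul_one]; linarith
    · rw [garchCoef_succ]
      have h1 : (∑ j : Fin q, if (j : ℕ) < i then θ (Sum.inr j) * garchCoef θ (i - j) else 0) ≤
          ∑ j : Fin q, θ (Sum.inr j) * (C * ρ ^ (i + 1) / ρ ^ q) := by
        refine Finset.sum_le_sum fun j _ => ?_
        split_ifs with hj
        · refine mul_le_mul_of_nonneg_left ((ih (i - j) (by omega)).trans ?_) (hθ _).le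
          rw [le_div_iff₀ (by positivity), mul_assoc, ← pow_add]
          exact mul_le_mul_of_nonneg_left
            (pow_le_pow_of_le_one hρ0.le hρ1.le (by have := j.2; omega)) hC0
        · exact mul_nonneg (hθ _).le (by positivity)
      rw [← Finset.sum_mul] at h1
      have h2 : T * (C * ρ ^ (i + 1) / ρ ^ q) ≤ C * ρ ^ (i + 1) * ((1 + T) / 2) := by
        rw [mul_div_assoc', div_le_iff₀ (by positivity)]
        have : 0 ≤ C * ρ ^ (i + 1) := by positivity
        nlinarith
      have h3 : C₁ * ρ ^ (i + 1) * ((1 - T) / 2) ≤ C * ρ ^ (i + 1) * ((1 - T) / 2) := by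
        have : 0 ≤ (1 - T) / 2 := by linarith
        gcongr
      linarith [hs' (i + 1)]

lemma garchArchEntry_add (u h : GarchParam p q) (i : ℕ) :
    garchArchEntry (u + h) i = garchArchEntry u i + garchArchEntry h i := by
  unfold garchArchEntry
  split_ifs <;> simp

/-- `u ↦ s_i` as a continuous linear map. -/
def garchArchEntryCLM (p q i : ℕ) : GarchParam p q →L[ℝ] ℝ :=
  if h : i ≤ p then ContinuousLinearMap.proj (Sum.inl ⟨i, Nat.lt_succ_of_le h⟩) else 0

lemma garchArchEntryCLM_apply (u : GarchParam p q) (i : ℕ) :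
    garchArchEntryCLM p q i u = garchArchEntry u i := by
  unfold garchArchEntry garchArchEntryCLM
  split_ifs <;> simp

lemma hasFDerivAt_garchArchEntry (θ : GarchParam p q) (i : ℕ) :
    HasFDerivAt (fun v : GarchParam p q => garchArchEntry v i) (garchArchEntryCLM p q i) θ :=
  (garchArchEntryCLM p q i).hasFDerivAt.congr_of_eventuallyEq
    (Eventually.of_forall fun v => (garchArchEntryCLM_apply v i).symm)

lemma hasFDerivAt_coord (θ : GarchParam p q) (a : Fin (p + 1) ⊕ Fin q) :
    HasFDerivAt (fun v : GarchParam p q => v a) (ContinuousLinearMap.proj (R := ℝ) a) θ :=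
  (ContinuousLinearMap.proj (R := ℝ) (φ := fun _ : Fin (p + 1) ⊕ Fin q => ℝ) a).hasFDerivAt

lemma hasFDerivAt_garchCoef_zero (hβ : ∑ j : Fin q, θ (Sum.inr j) < 1) :
    HasFDerivAt (fun v : GarchParam p q => garchCoef v 0)
      ((1 - ∑ j : Fin q, θ (Sum.inr j))⁻¹ • ContinuousLinearMap.proj (R := ℝ) (Sum.inl 0) +
        (θ (Sum.inl 0) / (1 - ∑ j : Fin q, θ (Sum.inr j)) ^ 2) •
          ∑ j : Fin q, ContinuousLinearMap.proj (R := ℝ) (Sum.inr j)) θ := by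
  have hne : 1 - ∑ j : Fin q, θ (Sum.inr j) ≠ 0 := by linarith
  have h1 : HasFDerivAt (fun v : GarchParam p q => 1 - ∑ j : Fin q, v (Sum.inr j))
      (-∑ j : Fin q, (ContinuousLinearMap.proj (R := ℝ)
        (φ := fun _ : Fin (p + 1) ⊕ Fin q => ℝ) (Sum.inr j))) θ :=
    (HasFDerivAt.fun_sum (u := Finset.univ) fun (j : Fin q) _ =>
      hasFDerivAt_coord θ (Sum.inr j)).const_sub 1
  have h2 := (hasFDerivAt_coord θ (Sum.inl 0)).mul
    ((hasDerivAt_inv hne).comp_hasFDerivAt θ h1)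
  simp only [garchCoef_zero, div_eq_mul_inv]
  refine h2.congr_fderiv ?_
  ext v
  simp
  ring

lemma differentiableAt_garchCoef (hβ : ∑ j : Fin q, θ (Sum.inr j) < 1) (i : ℕ) :
    DifferentiableAt ℝ (fun v : GarchParam p q => garchCoef v i) θ := by
  induction i using Nat.strong_induction_on with
  | _ i ih =>
    rcases i with _ | i
    · exact (hasFDerivAt_garchCoef_zero hβ).differentiableAt
    · simp only [garchCoef_succ]
      refine (hasFDerivAt_garchArchEntry θ (i + 1)).differentiableAt.add
        (DifferentiableAt.fun_sum fun j _ => ?_)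
      split_ifs with hj
      · exact (hasFDerivAt_coord θ (Sum.inr j)).differentiableAt.mul (ih (i - j) (by omega))
      · exact differentiableAt_const _

/-- The derivative of `c_i` at `θ` in the direction `h`. -/
def garchCoefDir (θ h : GarchParam p q) (i : ℕ) : ℝ :=
  fderiv ℝ (fun v : GarchParam p q => garchCoef v i) θ h

lemma garchCoefDir_eq_sum (θ h : GarchParam p q) (i : ℕ) :
    garchCoefDir θ h i = ∑ a, garchCoefDeriv θ i a * h a := by
  unfold garchCoefDir garchCoefDeriv
  conv_lhs => rw [pi_eq_sum_univ' h]
  simp only [map_sum, map_smul, smul_eq_mul]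
  refine Finset.sum_congr rfl fun a _ => ?_
  rw [mul_comm]

lemma garchCoefDir_zero (hβ : ∑ j : Fin q, θ (Sum.inr j) < 1) (h : GarchParam p q) :
    garchCoefDir θ h 0 = h (Sum.inl 0) / (1 - ∑ j : Fin q, θ (Sum.inr j)) +
      θ (Sum.inl 0) * (∑ j : Fin q, h (Sum.inr j)) / (1 - ∑ j : Fin q, θ (Sum.inr j)) ^ 2 := by
  unfold garchCoefDir
  rw [(hasFDerivAt_garchCoef_zero hβ).fderiv]
  simp
  ring

lemma garchCoefDir_succ (hβ : ∑ j : Fin q, θ (Sum.inr j) < 1) (h : GarchParam p q) (i : ℕ) :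
    garchCoefDir θ h (i + 1) = garchArchEntry h (i + 1) +
      ∑ j : Fin q, if (j : ℕ) < i then
        θ (Sum.inr j) * garchCoefDir θ h (i - j) + h (Sum.inr j) * garchCoef θ (i - j) else 0 := by
  have h1 : HasFDerivAt (fun v : GarchParam p q => garchCoef v (i + 1))
      (garchArchEntryCLM p q (i + 1) + ∑ j : Fin q, if (j : ℕ) < i then
        θ (Sum.inr j) • fderiv ℝ (fun v : GarchParam p q => garchCoef v (i - j)) θ +
          garchCoef θ (i - j) • ContinuousLinearMap.proj (R := ℝ) (Sum.inr j) else 0) θ := by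
    simp only [garchCoef_succ]
    refine (hasFDerivAt_garchArchEntry θ (i + 1)).add (HasFDerivAt.fun_sum fun j _ => ?_)
    split_ifs with hj
    · exact (hasFDerivAt_coord θ (Sum.inr j)).mul (differentiableAt_garchCoef hβ _).hasFDerivAt
    · exact hasFDerivAt_const _ _
  unfold garchCoefDir
  rw [h1.fderiv]
  simp only [_root_.add_apply, garchArchEntryCLM_apply, _root_.sum_apply]
  congr 1
  refine Finset.sum_congr rfl fun j _ => ?_
  split_ifs
  · simp [mul_comm]
  · simp

variable {h : GarchParam p q} {δ : ℝ}

lemma abs_garchArchEntry_le (hh : ∀ a, |h a| ≤ δ * θ a) (i : ℕ) :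
    |garchArchEntry h i| ≤ δ * garchArchEntry θ i := by
  unfold garchArchEntry
  split_ifs
  · exact hh _
  · simp

/-- For i ≥ 1, c_i is a polynomial in the entries with nonnegative coefficients and degree at most
i. A relative perturbation of size δ therefore changes it to first order by at most iδ c_i. The
induction on the differentiated recursion makes this exact; the next two lemmas treat the
second-order remainder and the lower bound in the same spirit. -/
lemma abs_garchCoefDir_le (hθ : ∀ a, 0 < θ a) (hβ : ∑ j : Fin q, θ (Sum.inr j) < 1) (hδ : 0 ≤ δ)
    (hh : ∀ a, |h a| ≤ δ * θ a) (i : ℕ) :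
    |garchCoefDir θ h (i + 1)| ≤ ((i + 1 : ℕ) : ℝ) * δ * garchCoef θ (i + 1) := by
  induction i using Nat.strong_induction_on with
  | _ i ih =>
    rw [garchCoefDir_succ hβ, garchCoef_succ, mul_add, Finset.mul_sum]
    refine (abs_add_le _ _).trans (add_le_add ?_ ((Finset.abs_sum_le_sum_abs _ _).trans
      (Finset.sum_le_sum fun j _ => ?_)))
    · refine (abs_garchArchEntry_le hh _).trans ?_
      refine mul_le_mul_of_nonneg_right ?_ (garchArchEntry_nonneg hθ _)
      refine le_mul_of_one_le_left hδ ?_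
      push_cast
      linarith [(Nat.cast_nonneg i : (0 : ℝ) ≤ i)]
    · split_ifs with hj
      · obtain ⟨m, hm⟩ : ∃ m, i - (j : ℕ) = m + 1 := ⟨i - j - 1, by omega⟩
        have h1 := ih m (by omega)
        rw [hm]
        have hc := garchCoef_nonneg hθ hβ (m + 1)
        have hmi : ((m + 1 : ℕ) : ℝ) ≤ i := by exact_mod_cast (by omega : m + 1 ≤ i)
        calc |θ (Sum.inr j) * garchCoefDir θ h (m + 1) + h (Sum.inr j) * garchCoef θ (m + 1)|
            ≤ θ (Sum.inr j) * |garchCoefDir θ h (m + 1)| +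
              |h (Sum.inr j)| * garchCoef θ (m + 1) := by
              refine (abs_add_le _ _).trans_eq ?_
              rw [abs_mul, abs_mul, abs_of_pos (hθ _), abs_of_nonneg hc]
          _ ≤ θ (Sum.inr j) * (((m + 1 : ℕ) : ℝ) * δ * garchCoef θ (m + 1)) +
              δ * θ (Sum.inr j) * garchCoef θ (m + 1) :=
              add_le_add (mul_le_mul_of_nonneg_left h1 (hθ _).le)
                (mul_le_mul_of_nonneg_right (hh _) hc)
          _ = (((m + 1 : ℕ) : ℝ) + 1) * (δ * (θ (Sum.inr j) * garchCoef θ (m + 1))) := by ring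
          _ ≤ ((i : ℝ) + 1) * (δ * (θ (Sum.inr j) * garchCoef θ (m + 1))) :=
              mul_le_mul_of_nonneg_right (by linarith)
                (mul_nonneg hδ (mul_nonneg (hθ _).le hc))
          _ = _ := by push_cast; ring
      · simp

lemma abs_garchCoef_taylor_le (hθ : ∀ a, 0 < θ a) (hβ : ∑ j : Fin q, θ (Sum.inr j) < 1)
    (hδ : 0 ≤ δ) (hh : ∀ a, |h a| ≤ δ * θ a) (i : ℕ) :
    |garchCoef (θ + h) (i + 1) - garchCoef θ (i + 1) - garchCoefDir θ h (i + 1)| ≤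
      ((1 + δ) ^ (i + 1) - 1 - ((i + 1 : ℕ) : ℝ) * δ) * garchCoef θ (i + 1) := by
  -- The factor g_n = (1+δ)^n − 1 − nδ satisfies g_{n+1} = (1+δ)g_n + nδ², the recursion met by the
  -- remainder, and it increases with n.
  have hg : ∀ n : ℕ, 0 ≤ (1 + δ) ^ n - 1 - (n : ℝ) * δ := fun n => by
    have := one_add_mul_le_pow (by linarith : (-2 : ℝ) ≤ δ) n
    linarith
  have hgs : ∀ n : ℕ, (1 + δ) * ((1 + δ) ^ n - 1 - (n : ℝ) * δ) + n * δ ^ 2 =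
      (1 + δ) ^ (n + 1) - 1 - ((n + 1 : ℕ) : ℝ) * δ := fun n => by push_cast; ring
  have hgm : ∀ m n : ℕ, m ≤ n → (1 + δ) ^ m - 1 - (m : ℝ) * δ ≤ (1 + δ) ^ n - 1 - (n : ℝ) * δ := by
    intro m n hmn
    induction n, hmn using Nat.le_induction with
    | base => exact le_rfl
    | succ n _ ih =>
      rw [← hgs]
      nlinarith [hg n, mul_nonneg (Nat.cast_nonneg (α := ℝ) n) (sq_nonneg δ)]
  induction i using Nat.strong_induction_on with
  | _ i ih =>
    rw [garchCoefDir_succ hβ, garchCoef_succ (θ + h), garchCoef_succ θ, garchArchEntry_add, mul_add,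
      Finset.mul_sum]
    have h0 : (garchArchEntry θ (i + 1) + garchArchEntry h (i + 1) + (∑ j : Fin q,
        if (j : ℕ) < i then (θ + h) (Sum.inr j) * garchCoef (θ + h) (i - j) else 0)) -
        (garchArchEntry θ (i + 1) + ∑ j : Fin q,
          if (j : ℕ) < i then θ (Sum.inr j) * garchCoef θ (i - j) else 0) -
        (garchArchEntry h (i + 1) + ∑ j : Fin q, if (j : ℕ) < i then θ (Sum.inr j) *
          garchCoefDir θ h (i - j) + h (Sum.inr j) * garchCoef θ (i - j) else 0) =
        ∑ j : Fin q, if (j : ℕ) < i then (θ (Sum.inr j) * (garchCoef (θ + h) (i - j) -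
          garchCoef θ (i - j) - garchCoefDir θ h (i - j)) + h (Sum.inr j) *
          ((garchCoef (θ + h) (i - j) - garchCoef θ (i - j) - garchCoefDir θ h (i - j)) +
            garchCoefDir θ h (i - j))) else 0 := by
      have : ∀ a b A B C : ℝ, a + b + A - (a + B) - (b + C) = A - B - C := by intros; ring
      rw [this, ← Finset.sum_sub_distrib, ← Finset.sum_sub_distrib]
      refine Finset.sum_congr rfl fun j _ => ?_
      split_ifs
      · simp only [Pi.add_apply]; ring
      · simp
    rw [h0]
    refine (Finset.abs_sum_le_sum_abs _ _).trans ((Finset.sum_le_sum fun j _ => ?_).trans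
      (le_add_of_nonneg_left (mul_nonneg (hg _) (garchArchEntry_nonneg hθ _))))
    split_ifs with hj
    · obtain ⟨m, hm⟩ : ∃ m, i - (j : ℕ) = m + 1 := ⟨i - j - 1, by omega⟩
      have h1 := ih m (by omega)
      rw [hm]
      have hc := garchCoef_nonneg hθ hβ (m + 1)
      have hd := abs_garchCoefDir_le hθ hβ hδ hh m
      set c := garchCoef θ (m + 1)
      set D := garchCoefDir θ h (m + 1)
      set R := garchCoef (θ + h) (m + 1) - c - D
      set g := (1 + δ) ^ (m + 1) - 1 - ((m + 1 : ℕ) : ℝ) * δ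
      have hθj := hθ (Sum.inr j)
      calc |θ (Sum.inr j) * R + h (Sum.inr j) * (R + D)|
          ≤ θ (Sum.inr j) * |R| + |h (Sum.inr j)| * (|R| + |D|) := by
            refine (abs_add_le _ _).trans ?_
            rw [abs_mul, abs_mul, abs_of_pos hθj]
            gcongr
            exact abs_add_le _ _
        _ ≤ θ (Sum.inr j) * (g * c) + (δ * θ (Sum.inr j)) *
              (g * c + ((m + 1 : ℕ) : ℝ) * δ * c) := by
            have := hh (Sum.inr j)
            gcongr
        _ = ((1 + δ) * g + ((m + 1 : ℕ) : ℝ) * δ ^ 2) * (θ (Sum.inr j) * c) := by ring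
        _ ≤ _ := by
            rw [hgs]
            exact mul_le_mul_of_nonneg_right (hgm _ _ (by omega)) (mul_nonneg hθj.le hc)
    · simp

lemma garchCoef_ge (hθ : ∀ a, 0 < θ a) (hβ : ∑ j : Fin q, θ (Sum.inr j) < 1)
    (hδ : 0 ≤ δ) (hδ1 : δ ≤ 1) (hh : ∀ a, |h a| ≤ δ * θ a) (i : ℕ) :
    (1 - δ) ^ (i + 1) * garchCoef θ (i + 1) ≤ garchCoef (θ + h) (i + 1) := by
  have hu : ∀ a, (1 - δ) * θ a ≤ (θ + h) a := fun a => by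
    have := neg_abs_le (h a)
    have := hh a
    simp only [Pi.add_apply]
    linarith
  have h1δ : 0 ≤ 1 - δ := by linarith
  have hpow : ∀ m n : ℕ, m ≤ n → (1 - δ) ^ n ≤ (1 - δ) ^ m := fun m n hmn =>
    pow_le_pow_of_le_one h1δ (by linarith) hmn
  induction i using Nat.strong_induction_on with
  | _ i ih =>
    rw [garchCoef_succ, garchCoef_succ, mul_add, Finset.mul_sum]
    refine add_le_add ?_ (Finset.sum_le_sum fun j _ => ?_)
    · refine (mul_le_mul_of_nonneg_right ((hpow 1 (i + 1) (by omega)).trans_eq (pow_one _))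
        (garchArchEntry_nonneg hθ _)).trans ?_
      unfold garchArchEntry
      split_ifs
      · exact hu _
      · simp
    · split_ifs with hj
      · obtain ⟨m, hm⟩ : ∃ m, i - (j : ℕ) = m + 1 := ⟨i - j - 1, by omega⟩
        have h1 := ih m (by omega)
        rw [hm]
        have hc := garchCoef_nonneg hθ hβ (m + 1)
        have hθj := hθ (Sum.inr j)
        calc (1 - δ) ^ (i + 1) * (θ (Sum.inr j) * garchCoef θ (m + 1))
            ≤ (1 - δ) ^ (m + 1 + 1) * (θ (Sum.inr j) * garchCoef θ (m + 1)) :=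
              mul_le_mul_of_nonneg_right (hpow _ _ (by omega)) (mul_nonneg hθj.le hc)
          _ = ((1 - δ) * θ (Sum.inr j)) * ((1 - δ) ^ (m + 1) * garchCoef θ (m + 1)) := by ring
          _ ≤ _ := mul_le_mul (hu _) h1 (mul_nonneg (by positivity) hc)
              ((mul_nonneg h1δ hθj.le).trans (hu _))
      · simp

lemma pow_taylor_le (hδ : 0 ≤ δ) (n : ℕ) :
    (1 + δ) ^ n - 1 - (n : ℝ) * δ ≤ (n : ℝ) ^ 2 * (δ ^ 2 * (1 + δ) ^ n) := by
  induction n with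
  | zero => simp
  | succ n ih =>
    have h1 : (1 : ℝ) ≤ (1 + δ) ^ (n + 1) := one_le_pow₀ (by linarith)
    have h2 : (n : ℝ) * δ ^ 2 ≤ n * δ ^ 2 * (1 + δ) ^ (n + 1) :=
      le_mul_of_one_le_right (by positivity) h1
    have h3 := mul_le_mul_of_nonneg_left ih (by linarith : 0 ≤ 1 + δ)
    have h4 : 0 ≤ ((n : ℝ) + 1) * (δ ^ 2 * (1 + δ) ^ (n + 1)) := by positivity
    push_cast
    calc (1 + δ) ^ (n + 1) - 1 - ((n : ℝ) + 1) * δ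
        = (1 + δ) * ((1 + δ) ^ n - 1 - (n : ℝ) * δ) + n * δ ^ 2 := by ring
      _ ≤ (1 + δ) * ((n : ℝ) ^ 2 * (δ ^ 2 * (1 + δ) ^ n)) + n * δ ^ 2 * (1 + δ) ^ (n + 1) := by
          linarith
      _ = ((n : ℝ) ^ 2 + n) * (δ ^ 2 * (1 + δ) ^ (n + 1)) := by ring
      _ ≤ _ := by
          refine mul_le_mul_of_nonneg_right ?_ (by positivity)
          nlinarith [(Nat.cast_nonneg n : (0 : ℝ) ≤ n)]

/-- Serves to absorb the polynomial factors of the derivative bounds into an arbitrarily slow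
geometric one. -/
lemma exists_sq_mul_pow_le {r : ℝ} (hr : 1 < r) :
    ∃ A : ℝ, 1 ≤ A ∧ ∀ n : ℕ, (n : ℝ) ^ 2 ≤ A * r ^ n := by
  have h1 := tendsto_pow_const_div_const_pow_of_one_lt 2 hr
  obtain ⟨B, hB⟩ := h1.bddAbove_range
  refine ⟨max B 1, le_max_right _ _, fun n => ?_⟩
  have h2 : (n : ℝ) ^ 2 / r ^ n ≤ B := hB ⟨n, rfl⟩
  rw [div_le_iff₀ (by positivity)] at h2
  exact h2.trans (by gcongr; exact le_max_left _ _)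

/-- The coefficient c_0 is a quotient, not a polynomial, so it is treated by hand: for small δ the
denominator stays above half of its value g at θ. -/
lemma garchCoef_zero_local (hθ : ∀ a, 0 < θ a) (hβ : ∑ j : Fin q, θ (Sum.inr j) < 1) :
    ∃ A : ℝ, 1 ≤ A ∧ ∃ δ₀ : ℝ, 0 < δ₀ ∧ ∀ δ : ℝ, 0 ≤ δ → δ ≤ δ₀ → ∀ h : GarchParam p q,
      (∀ a, |h a| ≤ δ * θ a) →
      |garchCoefDir θ h 0| ≤ A * δ * garchCoef θ 0 ∧
      |garchCoef (θ + h) 0 - garchCoef θ 0 - garchCoefDir θ h 0| ≤ A * δ ^ 2 * garchCoef θ 0 ∧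
      garchCoef θ 0 ≤ A * garchCoef (θ + h) 0 := by
  set g := 1 - ∑ j : Fin q, θ (Sum.inr j) with hg
  have hg0 : 0 < g := by linarith
  have hT0 : 0 ≤ ∑ j : Fin q, θ (Sum.inr j) := Finset.sum_nonneg fun j _ => (hθ _).le
  -- The second entry is the constant of the second-order remainder and also dominates the
  -- first-order constant 1 + 1/g because g ≤ 1; the 4 is for the comparison from below.
  set A := max 4 (2 / g * (1 / g + 1))
  have hA4 : 4 ≤ A := le_max_left _ _
  have hA2 : 2 / g * (1 / g + 1) ≤ A := le_max_right _ _
  have hg1 : g ≤ 1 := by linarith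
  have hA1 : 1 + 1 / g ≤ A := by
    refine le_trans ?_ hA2
    have h1 : 1 ≤ 1 / g := by rw [le_div_iff₀ hg0]; linarith
    have h2 : 2 / g = 2 * (1 / g) := by ring
    rw [h2]
    nlinarith
  refine ⟨A, by linarith, min (1 / 2) (g / 2), by positivity, fun δ hδ hδ0 h hh => ?_⟩
  have hδ1 : δ ≤ 1 / 2 := hδ0.trans (min_le_left _ _)
  have hδ2 : δ ≤ g / 2 := hδ0.trans (min_le_right _ _)
  set τ := ∑ j : Fin q, h (Sum.inr j) with hτ
  have hτ1 : |τ| ≤ δ := by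
    calc |τ| ≤ ∑ j : Fin q, δ * θ (Sum.inr j) :=
          (Finset.abs_sum_le_sum_abs _ _).trans (Finset.sum_le_sum fun j _ => hh _)
      _ = δ * (1 - g) := by rw [← Finset.mul_sum, hg]; ring
      _ ≤ δ * 1 := by gcongr; linarith
      _ = δ := mul_one δ
  set s := θ (Sum.inl 0) with hs
  have hs0 : 0 < s := hθ _
  set η := h (Sum.inl 0) with hη
  have hη1 : |η| ≤ δ * s := hh _
  have hτ2 := abs_le.1 hτ1
  have hη2 := abs_le.1 hη1
  have hd : g / 2 ≤ g - τ := by linarith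
  have hd0 : 0 < g - τ := by linarith
  have hc : garchCoef θ 0 = s / g := garchCoef_zero θ
  have hcu : garchCoef (θ + h) 0 = (s + η) / (g - τ) := by
    rw [garchCoef_zero]
    simp only [Pi.add_apply, Finset.sum_add_distrib]
    congr 1
    rw [hg, hτ]
    ring
  have hD : garchCoefDir θ h 0 = η / g + s * τ / g ^ 2 := garchCoefDir_zero hβ h
  rw [hc, hcu, hD]
  refine ⟨?_, ?_, ?_⟩
  · calc |η / g + s * τ / g ^ 2| ≤ |η| / g + s * |τ| / g ^ 2 := by
          refine (abs_add_le _ _).trans_eq ?_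
          rw [abs_div, abs_div, abs_mul, abs_of_pos hg0, abs_of_pos hs0, abs_of_pos (pow_pos hg0 2)]
      _ ≤ (δ * s) / g + s * δ / g ^ 2 := by gcongr
      _ = (1 + 1 / g) * δ * (s / g) := by field_simp
      _ ≤ A * δ * (s / g) := by gcongr
  · have h1 : (s + η) / (g - τ) - s / g - (η / g + s * τ / g ^ 2) =
        (s * τ ^ 2 / g ^ 2 + η * τ / g) / (g - τ) := by
      field_simp
      ring
    rw [h1, abs_div, abs_of_pos hd0]
    calc |s * τ ^ 2 / g ^ 2 + η * τ / g| / (g - τ)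
        ≤ (s * δ ^ 2 / g ^ 2 + (δ * s) * δ / g) / (g / 2) := by
          refine div_le_div₀ (by positivity) ((abs_add_le _ _).trans (add_le_add ?_ ?_))
            (by positivity) hd
          · rw [abs_div, abs_mul, abs_of_pos hs0, abs_of_pos (pow_pos hg0 2), abs_pow]
            gcongr
          · rw [abs_div, abs_mul, abs_of_pos hg0]
            gcongr
      _ = (2 / g * (1 / g + 1)) * δ ^ 2 * (s / g) := by field_simp
      _ ≤ A * δ ^ 2 * (s / g) := by gcongr
  · have h1 : s / g ≤ 4 * ((s + η) / (g - τ)) := by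
      rw [div_le_iff₀ hg0, mul_div_assoc', div_mul_eq_mul_div, le_div_iff₀ hd0]
      nlinarith
    refine h1.trans (mul_le_mul_of_nonneg_right hA4 (div_nonneg ?_ hd0.le))
    nlinarith

/-- The coefficients near `θ`: linear part, second order remainder, and comparison from below,
relative to `c_i(θ)` and up to an arbitrarily slow geometric factor. -/
theorem garchCoef_local (hθ : ∀ a, 0 < θ a) (hβ : ∑ j : Fin q, θ (Sum.inr j) < 1) {κ : ℝ}
    (hκ : 1 < κ) :
    ∃ A : ℝ, 1 ≤ A ∧ ∃ δ₀ : ℝ, 0 < δ₀ ∧ ∀ δ : ℝ, 0 ≤ δ → δ ≤ δ₀ → ∀ h : GarchParam p q,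
      (∀ a, |h a| ≤ δ * θ a) → ∀ i : ℕ,
      |garchCoefDir θ h i| ≤ A * δ * (κ ^ i * garchCoef θ i) ∧
      |garchCoef (θ + h) i - garchCoef θ i - garchCoefDir θ h i| ≤
        A * δ ^ 2 * (κ ^ i * garchCoef θ i) ∧
      garchCoef θ i ≤ A * (κ ^ i * garchCoef (θ + h) i) := by
  obtain ⟨A₀, hA₀, δ₁, hδ₁, h₀⟩ := garchCoef_zero_local hθ hβ
  have hsq : 1 < Real.sqrt κ := by
    rw [Real.lt_sqrt zero_le_one]; simpa using hκ
  have hsqκ : Real.sqrt κ * Real.sqrt κ = κ := Real.mul_self_sqrt (by linarith)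
  obtain ⟨A₁, hA₁, h₁⟩ := exists_sq_mul_pow_le hsq
  have hsqle : Real.sqrt κ ≤ κ := by nlinarith
  -- One factor √κ^i absorbs i², the other absorbs (1+δ)^i when δ ≤ √κ − 1. The condition δ ≤ 1 −
  -- κ⁻¹ gives κ(1−δ) ≥ 1 for the lower bound.
  refine ⟨max A₀ A₁, hA₀.trans (le_max_left _ _), min δ₁ (min (Real.sqrt κ - 1) (1 - κ⁻¹)), ?_, ?_⟩
  · refine lt_min hδ₁ (lt_min (by linarith) ?_)
    rw [sub_pos]
    exact inv_lt_one_of_one_lt₀ hκ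
  · intro δ hδ hδ0 h hh i
    have hδa : δ ≤ δ₁ := hδ0.trans (min_le_left _ _)
    have hδb : δ ≤ Real.sqrt κ - 1 := hδ0.trans ((min_le_right _ _).trans (min_le_left _ _))
    have hδc : δ ≤ 1 - κ⁻¹ := hδ0.trans ((min_le_right _ _).trans (min_le_right _ _))
    have hκ0 : 0 < κ := by linarith
    have hδ1 : δ ≤ 1 := hδc.trans (by have := inv_pos.2 hκ0; linarith)
    rcases i with _ | i
    · obtain ⟨ha, hb, hc⟩ := h₀ δ hδ hδa h hh
      have hc0 := (garchCoef_zero_pos hθ hβ).le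
      have hu0 : 0 ≤ garchCoef (θ + h) 0 := by
        by_contra hcon
        push Not at hcon
        have := mul_neg_of_pos_of_neg (by linarith : (0 : ℝ) < A₀) hcon
        linarith
      simp only [pow_zero, one_mul]
      refine ⟨ha.trans ?_, hb.trans ?_, hc.trans ?_⟩
      · gcongr; exact le_max_left _ _
      · gcongr; exact le_max_left _ _
      · gcongr; exact le_max_left _ _
    · have hc := garchCoef_nonneg hθ hβ (i + 1)
      have hlow := garchCoef_ge hθ hβ hδ hδ1 hh i
      have hmax : A₁ ≤ max A₀ A₁ := le_max_right _ _
      have hsqpow : Real.sqrt κ ^ (i + 1) ≤ κ ^ (i + 1) := by gcongr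
      have hn : (((i + 1 : ℕ) : ℝ)) ^ 2 ≤ A₁ * Real.sqrt κ ^ (i + 1) := h₁ (i + 1)
      have hn1 : (((i + 1 : ℕ) : ℝ)) ≤ (((i + 1 : ℕ) : ℝ)) ^ 2 := by
        have : (1 : ℝ) ≤ ((i + 1 : ℕ) : ℝ) := by exact_mod_cast Nat.le_add_left 1 i
        nlinarith
      refine ⟨?_, ?_, ?_⟩
      · refine (abs_garchCoefDir_le hθ hβ hδ hh i).trans ?_
        calc ((i + 1 : ℕ) : ℝ) * δ * garchCoef θ (i + 1)
            ≤ (A₁ * κ ^ (i + 1)) * δ * garchCoef θ (i + 1) := by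
              gcongr
              exact (hn1.trans hn).trans (by gcongr)
          _ = A₁ * δ * (κ ^ (i + 1) * garchCoef θ (i + 1)) := by ring
          _ ≤ _ := by gcongr
      · refine (abs_garchCoef_taylor_le hθ hβ hδ hh i).trans ?_
        calc ((1 + δ) ^ (i + 1) - 1 - ((i + 1 : ℕ) : ℝ) * δ) * garchCoef θ (i + 1)
            ≤ (((i + 1 : ℕ) : ℝ) ^ 2 * (δ ^ 2 * (1 + δ) ^ (i + 1))) * garchCoef θ (i + 1) := by
              gcongr
              exact pow_taylor_le hδ _
          _ ≤ ((A₁ * Real.sqrt κ ^ (i + 1)) * (δ ^ 2 * Real.sqrt κ ^ (i + 1))) *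
              garchCoef θ (i + 1) := by
              gcongr
              linarith
          _ = A₁ * δ ^ 2 * ((Real.sqrt κ * Real.sqrt κ) ^ (i + 1) * garchCoef θ (i + 1)) := by
              rw [mul_pow]; ring
          _ ≤ _ := by rw [hsqκ]; gcongr
      · have hκδ : 1 ≤ κ * (1 - δ) := by
          have : κ⁻¹ ≤ 1 - δ := by linarith
          calc 1 = κ * κ⁻¹ := (mul_inv_cancel₀ hκ0.ne').symm
            _ ≤ _ := by gcongr
        have hu0 : 0 ≤ garchCoef (θ + h) (i + 1) :=
          (mul_nonneg (pow_nonneg (by linarith) _) hc).trans hlow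
        calc garchCoef θ (i + 1) ≤ (κ * (1 - δ)) ^ (i + 1) * garchCoef θ (i + 1) :=
              le_mul_of_one_le_left hc (one_le_pow₀ hκδ)
          _ = κ ^ (i + 1) * ((1 - δ) ^ (i + 1) * garchCoef θ (i + 1)) := by rw [mul_pow]; ring
          _ ≤ κ ^ (i + 1) * garchCoef (θ + h) (i + 1) := by gcongr
          _ ≤ _ := le_mul_of_one_le_left (by positivity) (hA₁.trans hmax)

end Coefficients

/-! ### The ARCH(∞) form of the volatility. -/

section ArchInfinity

lemma abs_tsum_le_tsum_abs {f : ℕ → ℝ} (hf : Summable fun i => |f i|) :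
    |∑' i, f i| ≤ ∑' i, |f i| := by
  simp only [← Real.norm_eq_abs] at hf ⊢
  exact norm_tsum_le_tsum_norm hf

variable {p q : ℕ} {θ : GarchParam p q}

lemma SubexpGrowth.summable_garchCoef {y : ℤ → ℝ} (hθ : ∀ a, 0 < θ a)
    (hβ : ∑ j : Fin q, θ (Sum.inr j) < 1) (hy : SubexpGrowth y) (t : ℤ) :
    Summable fun i : ℕ => garchCoef θ (i + 1) * y (t - (i + 1)) := by
  obtain ⟨ρ, hρ0, hρ1, C, hC, hc⟩ := garchCoef_le_geometric hθ hβ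
  obtain ⟨B, hB⟩ := hy.exists_sum_bound hρ0 (by linarith : ρ < (1 + ρ) / 2) (by linarith)
    (c := garchCoef θ) (A := C) fun i => by
      rw [abs_of_nonneg (garchCoef_nonneg hθ hβ i)]; exact hc i
  exact (hB t).1.of_abs

lemma SubexpGrowth.sigmaSq {x : ℤ → ℝ} (hθ : ∀ a, 0 < θ a)
    (hβ : ∑ j : Fin q, θ (Sum.inr j) < 1) (hy : SubexpGrowth fun t => x t ^ 2) :
    SubexpGrowth (garchSigmaSq θ x) := by
  obtain ⟨ρ, hρ0, hρ1, C, hC, hc⟩ := garchCoef_le_geometric hθ hβ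
  have h1 : SubexpGrowth fun t => ∑' i : ℕ, garchCoef θ (i + 1) * x (t - (i + 1)) ^ 2 := by
    have hc' : ∀ i, |garchCoef θ i| ≤ C * ρ ^ i := fun i => by
      rw [abs_of_nonneg (garchCoef_nonneg hθ hβ i)]; exact hc i
    generalize garchCoef θ = c at hc'
    refine SubexpGrowth.of_le hρ1 fun r hr hρr hr1 => ?_
    obtain ⟨B, hB⟩ := hy.exists_sum_bound hρ0 hρr hr1 hc'
    exact ⟨B, fun t => (mul_le_mul_of_nonneg_right (abs_tsum_le_tsum_abs (hB t).1)
      (pow_nonneg hr.le _)).trans (hB t).2⟩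
  exact (SubexpGrowth.const (garchCoef θ 0)).add h1

/-- The series `σ_t²(θ)` solves the volatility equation. -/
lemma garchSigmaSq_eq {x : ℤ → ℝ} (hθ : ∀ a, 0 < θ a)
    (hβ : ∑ j : Fin q, θ (Sum.inr j) < 1) (hy : SubexpGrowth fun t => x t ^ 2) (t : ℤ) :
    garchSigmaSq θ x t = θ (Sum.inl 0) +
      ∑ i : Fin p, θ (Sum.inl i.succ) * x (t - ((i : ℤ) + 1)) ^ 2 +
      ∑ j : Fin q, θ (Sum.inr j) * garchSigmaSq θ x (t - ((j : ℤ) + 1)) := by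
  have hS := hy.summable_garchCoef hθ hβ
  set y : ℤ → ℝ := fun t => x t ^ 2
  have h0 : garchCoef θ 0 = θ (Sum.inl 0) + (∑ j : Fin q, θ (Sum.inr j)) * garchCoef θ 0 := by
    rw [garchCoef_zero]
    have : 1 - ∑ j : Fin q, θ (Sum.inr j) ≠ 0 := by linarith
    field_simp
    ring
  have hA : HasSum (fun i : ℕ => garchArchEntry θ (i + 1) * y (t - (i + 1)))
      (∑ i : Fin p, θ (Sum.inl i.succ) * y (t - ((i : ℤ) + 1))) := by
    have h1 : HasSum (fun i : ℕ => garchArchEntry θ (i + 1) * y (t - (i + 1)))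
        (∑ i ∈ Finset.range p, garchArchEntry θ (i + 1) * y (t - (i + 1))) := by
      refine hasSum_sum_of_ne_finset_zero fun i hi => ?_
      have : garchArchEntry θ (i + 1) = 0 := dif_neg (by simpa using hi)
      rw [this, zero_mul]
    rw [← Fin.sum_univ_eq_sum_range (fun i => garchArchEntry θ (i + 1) * y (t - (i + 1)))] at h1
    convert h1 using 2 with i
    congr 1
    unfold garchArchEntry
    rw [dif_pos (by omega)]
    rfl
  -- Shifted by j + 1, the j-th part of the recursion for c_{i+1} reproduces the series of the
  -- volatility at time t − j − 1; its terms with i ≤ j vanish.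
  have hB : ∀ j : Fin q, HasSum (fun i : ℕ => (if (j : ℕ) < i then
      θ (Sum.inr j) * garchCoef θ (i - j) else 0) * y (t - (i + 1)))
      (θ (Sum.inr j) * ∑' i : ℕ, garchCoef θ (i + 1) * y (t - ((j : ℤ) + 1) - (i + 1))) := by
    intro j
    have h1 := (hS (t - ((j : ℤ) + 1))).hasSum.mul_left (θ (Sum.inr j))
    rw [← hasSum_nat_add_iff' ((j : ℕ) + 1)]
    have h2 : ∑ i ∈ Finset.range ((j : ℕ) + 1), (if (j : ℕ) < i then
        θ (Sum.inr j) * garchCoef θ (i - j) else 0) * y (t - (i + 1)) = 0 := by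
      refine Finset.sum_eq_zero fun i hi => ?_
      rw [if_neg (by simp at hi; omega), zero_mul]
    rw [h2, sub_zero]
    refine h1.congr_fun fun i => ?_
    rw [if_pos (by omega), show i + ((j : ℕ) + 1) - j = i + 1 by omega, mul_assoc]
    congr 3
    push_cast
    ring
  have hsum := hA.add (hasSum_sum (s := Finset.univ) fun j _ => hB j)
  have hT : ∑' i : ℕ, garchCoef θ (i + 1) * y (t - (i + 1)) =
      ∑ i : Fin p, θ (Sum.inl i.succ) * y (t - ((i : ℤ) + 1)) + ∑ j : Fin q, θ (Sum.inr j) *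
        ∑' i : ℕ, garchCoef θ (i + 1) * y (t - ((j : ℤ) + 1) - (i + 1)) := by
    refine HasSum.tsum_eq (hsum.congr_fun fun i => ?_)
    rw [garchCoef_succ, add_mul, Finset.sum_mul]
  have hdef : ∀ t, garchSigmaSq θ x t =
      garchCoef θ 0 + ∑' i : ℕ, garchCoef θ (i + 1) * y (t - (i + 1)) := fun t => rfl
  rw [hdef t, hT]
  simp only [hdef, mul_add, Finset.sum_add_distrib]
  rw [← Finset.sum_mul]
  linarith

/-- A linear recursion with coefficients of sum less than one has no nonzero subexponential
solution on the integers. -/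
lemma eq_zero_of_recursion {d : ℤ → ℝ} {β : Fin q → ℝ} (hβ0 : ∀ j, 0 ≤ β j) (hβ : ∑ j, β j < 1)
    (hd : SubexpGrowth d) (h : ∀ t, d t = ∑ j : Fin q, β j * d (t - ((j : ℤ) + 1))) (t : ℤ) :
    d t = 0 := by
  obtain ⟨r, hr0, hr1, hr⟩ := exists_lt_pow_lt_one hβ q
  obtain ⟨B, hB0, hB⟩ := hd.exists_le_mul hr0 hr1
  -- Each use of the recursion gains the factor ℓ < 1, simultaneously at all lags m; the division by
  -- r^q pays for the shift by at most q.
  set ℓ := (∑ j, β j) / r ^ q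
  have hl0 : 0 ≤ ℓ := div_nonneg (Finset.sum_nonneg fun j _ => hβ0 j) (by positivity)
  have hl1 : ℓ < 1 := (div_lt_one (by positivity)).2 hr
  set B' := B / r ^ t.natAbs
  have hB' : 0 ≤ B' := by positivity
  have key : ∀ n : ℕ, ∀ m : ℕ, |d (t - m)| * r ^ m ≤ ℓ ^ n * B' := by
    intro n
    induction n with
    | zero =>
      intro m
      rw [pow_zero, one_mul, le_div_iff₀ (by positivity), mul_assoc, ← pow_add, add_comm m]
      exact hB t m
    | succ n ih =>
      intro m
      rw [h (t - m)]
      calc |∑ j : Fin q, β j * d (t - m - ((j : ℤ) + 1))| * r ^ m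
          ≤ (∑ j : Fin q, β j * |d (t - m - ((j : ℤ) + 1))|) * r ^ m := by
            refine mul_le_mul_of_nonneg_right ((Finset.abs_sum_le_sum_abs _ _).trans_eq ?_)
              (by positivity)
            refine Finset.sum_congr rfl fun j _ => ?_
            rw [abs_mul, abs_of_nonneg (hβ0 j)]
        _ = ∑ j : Fin q, β j * (|d (t - m - ((j : ℤ) + 1))| * r ^ m) := by
            rw [Finset.sum_mul]
            exact Finset.sum_congr rfl fun j _ => mul_assoc _ _ _
        _ ≤ ∑ j : Fin q, β j * (ℓ ^ n * B' / r ^ q) := by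
            refine Finset.sum_le_sum fun j _ => mul_le_mul_of_nonneg_left ?_ (hβ0 j)
            have h1 := ih (m + (j + 1))
            have h2 : t - ((m + ((j : ℕ) + 1) : ℕ) : ℤ) = t - m - ((j : ℤ) + 1) := by
              push_cast; ring
            rw [h2] at h1
            rw [le_div_iff₀ (by positivity), mul_assoc, ← pow_add]
            refine le_trans (mul_le_mul_of_nonneg_left ?_ (abs_nonneg _)) h1
            exact pow_le_pow_of_le_one hr0.le hr1.le (by have := j.2; omega)
        _ = ℓ ^ (n + 1) * B' := by
            rw [← Finset.sum_mul, pow_succ]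
            simp only [ℓ]
            ring
  have hlim : Tendsto (fun n : ℕ => ℓ ^ n * B') atTop (𝓝 (0 * B')) :=
    (tendsto_pow_atTop_nhds_zero_of_lt_one hl0 hl1).mul_const B'
  rw [zero_mul] at hlim
  have h0 := ge_of_tendsto' hlim fun n => key n 0
  simp only [Nat.cast_zero, sub_zero, pow_zero, mul_one] at h0
  exact abs_nonpos_iff.1 h0

/-- Any solution and the series solve the same volatility equation, so their difference solves the
homogeneous recursion, where subexponential growth forces it to vanish. -/
lemma eq_garchSigmaSq {x s : ℤ → ℝ} (hθ : ∀ a, 0 < θ a)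
    (hβ : ∑ j : Fin q, θ (Sum.inr j) < 1) (hy : SubexpGrowth fun t => x t ^ 2)
    (hs : 0 < q → SubexpGrowth s)
    (h : ∀ t, s t = θ (Sum.inl 0) +
      ∑ i : Fin p, θ (Sum.inl i.succ) * x (t - ((i : ℤ) + 1)) ^ 2 +
      ∑ j : Fin q, θ (Sum.inr j) * s (t - ((j : ℤ) + 1))) (t : ℤ) :
    s t = garchSigmaSq θ x t := by
  have hd : ∀ t, s t - garchSigmaSq θ x t = ∑ j : Fin q, θ (Sum.inr j) *
      (s (t - ((j : ℤ) + 1)) - garchSigmaSq θ x (t - ((j : ℤ) + 1))) := by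
    intro t
    rw [h t, garchSigmaSq_eq hθ hβ hy t]
    simp only [mul_sub, Finset.sum_sub_distrib]
    ring
  -- For q = 0 the equation contains no past volatility and growth is not needed; the state vector
  -- then carries no σ² whose moments could supply it.
  rcases Nat.eq_zero_or_pos q with rfl | hq
  · have := hd t
    simp only [Finset.univ_eq_empty, Finset.sum_empty] at this
    linarith
  · have hg : SubexpGrowth fun t => s t - garchSigmaSq θ x t := by
      simpa only [sub_eq_add_neg] using (hs hq).add (hy.sigmaSq hθ hβ).neg
    have : s t - garchSigmaSq θ x t = 0 := eq_zero_of_recursion (d := fun t => s t - garchSigmaSq θ x t)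
      (fun j => (hθ (Sum.inr j)).le) hβ hg hd t
    linarith

lemma garchSigmaSq_ge {x : ℤ → ℝ} (hθ : ∀ a, 0 < θ a)
    (hβ : ∑ j : Fin q, θ (Sum.inr j) < 1) (t : ℤ) : garchCoef θ 0 ≤ garchSigmaSq θ x t :=
  le_add_of_nonneg_right (tsum_nonneg fun _ =>
    mul_nonneg (garchCoef_nonneg hθ hβ _) (sq_nonneg _))

variable {Ω : Type*} [MeasurableSpace Ω] {μ : Measure Ω} {ε σ X : ℤ → Ω → ℝ}

/-- Path properties of the stationary solution: it grows subexponentially and its volatility is the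
series `σ_t²(θ)`. -/
theorem IsStationaryGarch.ae_path [IsProbabilityMeasure μ] (hp : 1 ≤ p) (hθ : ∀ a, 0 < θ a)
    (hβ : ∑ j : Fin q, θ (Sum.inr j) < 1)
    (hε : IsGarchInnovation μ ε) (hγ : garchLyapunov μ θ ε < 0) (hX : IsStationaryGarch μ θ ε σ X)
    (hsmall : ∃ ζ : ℝ, 0 < ζ ∧
      Tendsto (fun x : ℝ => x ^ (-ζ) * μ.real {ω | |ε 0 ω| ≤ x}) (𝓝[>] 0) (𝓝 0)) :
    ∀ᵐ ω ∂μ, (SubexpGrowth fun t => X t ω ^ 2) ∧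
      ∀ t, X t ω = Real.sqrt (garchSigmaSq θ (fun s => X s ω) t) * ε t ω := by
  obtain ⟨-, s, hs0, -, C, hC, hmom⟩ := hX.exists_isPastFactor hε hγ hsmall
  have h1 := ae_subexpGrowth_of_lintegral_rpow_le (μ := μ) (Y := fun t ω => X t ω ^ 2)
    (fun t => ((hX.measurable_X t).pow_const 2).aemeasurable) hs0 hC
    fun t => by simpa [garchState] using hmom t (Sum.inl ⟨0, hp⟩)
  have h2 : ∀ᵐ ω ∂μ, 0 < q → SubexpGrowth fun t => σ t ω ^ 2 := by
    rcases Nat.eq_zero_or_pos q with hq | hq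
    · exact ae_of_all _ fun ω h => absurd h (by omega)
    · have h3 := ae_subexpGrowth_of_lintegral_rpow_le (μ := μ) (Y := fun t ω => σ t ω ^ 2)
        (fun t => ((hX.measurable_σ t).pow_const 2).aemeasurable) hs0 hC
        fun t => by simpa [garchState] using hmom t (Sum.inr ⟨0, hq⟩)
      filter_upwards [h3] with ω h _
      exact h
  filter_upwards [h1, h2, ae_all_iff.2 hX.σ_nonneg, ae_all_iff.2 hX.X_eq,
    ae_all_iff.2 hX.σ_sq_eq] with ω h1 h2 h3 h4 h5
  refine ⟨h1, fun t => ?_⟩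
  rw [← eq_garchSigmaSq (s := fun t => σ t ω ^ 2) hθ hβ h1 h2 h5 t, Real.sqrt_sq (h3 t), h4 t]

end ArchInfinity

/-! ### Cauchy–Schwarz and Jensen for weighted series. -/

section WeightedSeries

variable {c u l ξ : ℕ → ℝ} {A δ κ : ℝ}

lemma summable_of_abs_le_mul {f g : ℕ → ℝ} {B : ℝ} (hξ : ∀ i, 0 ≤ ξ i)
    (hsum : Summable fun i => g i * ξ i) (h : ∀ i, |f i| ≤ B * g i) :
    Summable fun i => f i * ξ i := by
  refine Summable.of_norm_bounded (hsum.mul_left B) fun i => ?_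
  rw [Real.norm_eq_abs, abs_mul, abs_of_nonneg (hξ i), ← mul_assoc]
  exact mul_le_mul_of_nonneg_right (h i) (hξ i)

lemma abs_tsum_le_of_abs_le_mul {f g : ℕ → ℝ} {B : ℝ} (hξ : ∀ i, 0 ≤ ξ i)
    (hsum : Summable fun i => g i * ξ i) (h : ∀ i, |f i| ≤ B * g i) :
    |∑' i, f i * ξ i| ≤ B * ∑' i, g i * ξ i := by
  have hle : ∀ i, |f i * ξ i| ≤ B * (g i * ξ i) := fun i => by
    rw [abs_mul, abs_of_nonneg (hξ i), ← mul_assoc]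
    exact mul_le_mul_of_nonneg_right (h i) (hξ i)
  have hs : Summable fun i => |f i * ξ i| :=
    (hsum.mul_left B).of_nonneg_of_le (fun i => abs_nonneg _) hle
  rw [← tsum_mul_left]
  exact (abs_tsum_le_tsum_abs hs).trans (hs.tsum_le_tsum hle (hsum.mul_left B))

/-- Cauchy–Schwarz in the form `(∑ c)² ≤ A (∑ b c) (∑ u)` when `c ≤ A b u`. -/
lemma sq_tsum_le_mul_tsum {b c u : ℕ → ℝ} (hA : 0 < A) (hb : ∀ i, 0 < b i) (hc : ∀ i, 0 ≤ c i)
    (hcs : Summable c) (hbs : Summable fun i => b i * c i) (hus : Summable u)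
    (h : ∀ i, c i ≤ A * (b i * u i)) (hT : 0 < ∑' i, b i * c i) :
    (∑' i, c i) ^ 2 ≤ A * (∑' i, b i * c i) * ∑' i, u i := by
  set S := ∑' i, c i
  set T := ∑' i, b i * c i
  set U := ∑' i, u i
  have hS0 : 0 ≤ S := tsum_nonneg hc
  have hU0 : 0 ≤ U := tsum_nonneg fun i => by
    have h1 := (hc i).trans (h i)
    have h2 : 0 < A * b i := mul_pos hA (hb i)
    rw [← mul_assoc] at h1
    exact nonneg_of_mul_nonneg_right h1 h2
  rcases hS0.eq_or_lt with h0 | h0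
  · rw [← h0, zero_pow two_ne_zero]
    exact mul_nonneg (mul_nonneg hA.le hT.le) hU0
  -- The weight of the arithmetic–geometric inequality 2c ≤ a u + (A/a) b c, chosen so that (A/a)T =
  -- S and the sum reads 2S ≤ aU + S.
  set a := A * T / S
  have ha : 0 < a := by positivity
  have hi : ∀ i, 2 * c i ≤ a * u i + A / a * (b i * c i) := by
    intro i
    have hB : 0 < A * b i := mul_pos hA (hb i)
    have h1 : c i / (A * b i) ≤ u i := by
      rw [div_le_iff₀ hB]
      linarith [h i]
    have h2 : 0 ≤ c i * (a - A * b i) ^ 2 / (a * (A * b i)) :=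
      div_nonneg (mul_nonneg (hc i) (sq_nonneg _)) (mul_pos ha hB).le
    have h3 : c i * (a - A * b i) ^ 2 / (a * (A * b i)) =
        a * (c i / (A * b i)) + A / a * (b i * c i) - 2 * c i := by
      have := hb i
      field_simp
      ring
    have := mul_le_mul_of_nonneg_left h1 ha.le
    linarith
  have h1 : 2 * S ≤ a * U + A / a * T := by
    have := (hcs.mul_left 2).tsum_le_tsum hi ((hus.mul_left a).add (hbs.mul_left (A / a)))
    rwa [tsum_mul_left, (hus.mul_left a).tsum_add (hbs.mul_left (A / a)), tsum_mul_left,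
      tsum_mul_left] at this
  have h2 : A / a * T = S := by
    simp only [a]
    field_simp
  have h3 : S ≤ a * U := by linarith
  calc S ^ 2 = S * S := sq S
    _ ≤ (a * U) * S := by gcongr
    _ = A * T * U := by simp only [a]; field_simp

/-- Jensen's inequality for the weights `w_i / ∑ w`. -/
lemma pow_weighted_tsum_le {b w : ℕ → ℝ} (hw : ∀ i, 0 ≤ w i) (hb : ∀ i, 0 ≤ b i) (m : ℕ)
    (hws : Summable w) (hbs : Summable fun i => b i * w i)
    (hbm : Summable fun i => b i ^ m * w i) (hS : 0 < ∑' i, w i) :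
    ((∑' i, b i * w i) / ∑' i, w i) ^ m ≤ (∑' i, b i ^ m * w i) / ∑' i, w i := by
  set S := ∑' i, w i
  set G := (∑' i, b i * w i) / S
  have hG0 : 0 ≤ G := div_nonneg (tsum_nonneg fun i => mul_nonneg (hb i) (hw i)) hS.le
  rcases m with _ | m
  · simp only [pow_zero, one_mul]
    exact (div_self hS.ne').ge
  rcases hG0.eq_or_lt with h0 | h0
  · rw [← h0, zero_pow (Nat.succ_ne_zero m)]
    exact div_nonneg (tsum_nonneg fun i => mul_nonneg (pow_nonneg (hb i) _) (hw i)) hS.le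
  -- Bernoulli's inequality gives the tangent line of x ↦ x^{m+1} at the mean G; summing it against
  -- w is Jensen's inequality.
  have hi : ∀ i, (G ^ (m + 1) - ((m + 1 : ℕ) : ℝ) * G ^ (m + 1)) * w i +
      ((m + 1 : ℕ) : ℝ) * G ^ m * (b i * w i) ≤ b i ^ (m + 1) * w i := by
    intro i
    have h1 := one_add_mul_le_pow (a := b i / G - 1)
      (by have := div_nonneg (hb i) hG0; linarith) (m + 1)
    rw [add_sub_cancel, div_pow, le_div_iff₀ (by positivity)] at h1
    have h2 : (1 + ((m + 1 : ℕ) : ℝ) * (b i / G - 1)) * G ^ (m + 1) =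
        (G ^ (m + 1) - ((m + 1 : ℕ) : ℝ) * G ^ (m + 1)) + ((m + 1 : ℕ) : ℝ) * G ^ m * b i := by
      field_simp
      ring
    rw [h2] at h1
    have := mul_le_mul_of_nonneg_right h1 (hw i)
    linarith
  have h1 := Summable.tsum_le_tsum hi ((hws.mul_left _).add (hbs.mul_left _)) hbm
  rw [(hws.mul_left _).tsum_add (hbs.mul_left _), tsum_mul_left, tsum_mul_left] at h1
  have h2 : ∑' i, b i * w i = G * S := (div_mul_cancel₀ _ hS.ne').symm
  rw [h2] at h1
  rw [le_div_iff₀ hS]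
  have h3 : (G ^ (m + 1) - ((m + 1 : ℕ) : ℝ) * G ^ (m + 1)) * S +
      ((m + 1 : ℕ) : ℝ) * G ^ m * (G * S) = G ^ (m + 1) * S := by ring
  linarith

end WeightedSeries

/-! ### Elementary expansions of y ↦ y^{-k/2}. -/

section PowerExpansion

lemma abs_pow_sub_le {v : ℝ} (hv : 0 ≤ v) (k : ℕ) :
    |v ^ k - 1 - k * (v - 1)| ≤ (k : ℝ) ^ 2 * (v - 1) ^ 2 * (1 + v) ^ k := by
  induction k with
  | zero => simp
  | succ k ih =>
    have h1 : v ^ (k + 1) - 1 - ((k + 1 : ℕ) : ℝ) * (v - 1) =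
        v * (v ^ k - 1 - k * (v - 1)) + k * (v - 1) ^ 2 := by push_cast; ring
    have h2 : (1 : ℝ) ≤ (1 + v) ^ (k + 1) := one_le_pow₀ (by linarith)
    rw [h1]
    have hk : (0 : ℝ) ≤ k := k.cast_nonneg
    calc |v * (v ^ k - 1 - k * (v - 1)) + k * (v - 1) ^ 2|
        ≤ v * ((k : ℝ) ^ 2 * (v - 1) ^ 2 * (1 + v) ^ k) + k * (v - 1) ^ 2 := by
          refine (abs_add_le _ _).trans ?_
          rw [abs_mul, abs_of_nonneg hv, abs_of_nonneg (by positivity : 0 ≤ k * (v - 1) ^ 2)]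
          gcongr
      _ ≤ (1 + v) * ((k : ℝ) ^ 2 * (v - 1) ^ 2 * (1 + v) ^ k) +
          k * (v - 1) ^ 2 * (1 + v) ^ (k + 1) := by
          refine add_le_add (mul_le_mul_of_nonneg_right (by linarith) (by positivity)) ?_
          exact le_mul_of_one_le_right (by positivity) h2
      _ = ((k : ℝ) ^ 2 + k) * ((v - 1) ^ 2 * (1 + v) ^ (k + 1)) := by ring
      _ ≤ ((k + 1 : ℕ) : ℝ) ^ 2 * ((v - 1) ^ 2 * (1 + v) ^ (k + 1)) := by
          gcongr
          push_cast
          nlinarith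
      _ = _ := by ring

/-- Second order expansion of `y ↦ y^{-k/2}` at `1`, with `v = y^{-1/2}`. -/
lemma abs_pow_expansion_le {v y : ℝ} (hv : 0 < v) (hy : y * v ^ 2 = 1) (k : ℕ) :
    |v ^ k - 1 + (k : ℝ) / 2 * (y - 1)| ≤ ((k : ℝ) ^ 2 + k) * ((y - 1) ^ 2 * (1 + v) ^ (k + 4)) := by
  have hk : (0 : ℝ) ≤ k := k.cast_nonneg
  have hyv : y = 1 / v ^ 2 := by field_simp; linarith
  have h1 : (v - 1) ^ 2 ≤ (y - 1) ^ 2 * v ^ 4 := by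
    have : (y - 1) ^ 2 * v ^ 4 = (v - 1) ^ 2 * (1 + v) ^ 2 := by
      rw [hyv]; field_simp; ring
    rw [this]
    refine le_mul_of_one_le_right (sq_nonneg _) (one_le_pow₀ (by linarith))
  have h2 : v - 1 + 1 / 2 * (y - 1) = (v - 1) ^ 2 * (2 * v + 1) * (y / 2) := by
    rw [hyv]; field_simp; ring
  have h3 : |v - 1 + 1 / 2 * (y - 1)| ≤ (y - 1) ^ 2 * (1 + v) ^ (k + 4) := by
    have hy0 : 0 < y := by rw [hyv]; positivity
    rw [h2, abs_of_nonneg (by positivity)]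
    calc (v - 1) ^ 2 * (2 * v + 1) * (y / 2) ≤ ((y - 1) ^ 2 * v ^ 4) * (2 * v + 1) * (y / 2) := by
          gcongr
      _ = (y - 1) ^ 2 * (v ^ 2 * (v + 1 / 2)) * (y * v ^ 2) := by ring
      _ = (y - 1) ^ 2 * (v ^ 2 * (v + 1 / 2)) := by rw [hy, mul_one]
      _ ≤ (y - 1) ^ 2 * (1 + v) ^ (k + 4) := by
          gcongr
          calc v ^ 2 * (v + 1 / 2) ≤ (1 + v) ^ 2 * (1 + v) :=
                mul_le_mul (pow_le_pow_left₀ hv.le (by linarith) 2) (by linarith) (by linarith)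
                  (by positivity)
            _ = (1 + v) ^ 3 := by ring
            _ ≤ (1 + v) ^ (k + 4) := pow_le_pow_right₀ (by linarith) (by omega)
  have h4 : |v ^ k - 1 - k * (v - 1)| ≤ (k : ℝ) ^ 2 * ((y - 1) ^ 2 * (1 + v) ^ (k + 4)) := by
    refine (abs_pow_sub_le hv.le k).trans ?_
    calc (k : ℝ) ^ 2 * (v - 1) ^ 2 * (1 + v) ^ k
        ≤ (k : ℝ) ^ 2 * ((y - 1) ^ 2 * (1 + v) ^ 4) * (1 + v) ^ k := by
          gcongr
          exact h1.trans (by gcongr; linarith)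
      _ = _ := by ring
  have h5 : v ^ k - 1 + (k : ℝ) / 2 * (y - 1) =
      (v ^ k - 1 - k * (v - 1)) + k * (v - 1 + 1 / 2 * (y - 1)) := by ring
  rw [h5]
  refine (abs_add_le _ _).trans ?_
  rw [abs_mul, abs_of_nonneg hk, add_mul]
  gcongr

/-- With v = y^{-1/2} and w = z^{-1/2}, a mean value bound using the larger number w throughout. It
measures the effect of truncating the volatility series. -/
lemma abs_pow_sub_pow_le_of_mul_sq {v w y z : ℝ} (hv : 0 < v) (hvw : v ≤ w) (hy : y * v ^ 2 = 1)
    (hz : z * w ^ 2 = 1) (k : ℕ) : |w ^ k - v ^ k| ≤ k * ((y - z) * w ^ (k + 2)) := by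
  have hw : 0 < w := hv.trans_le hvw
  have h0 : w - v ≤ (y - z) * w ^ 3 := by
    have hyv : y = 1 / v ^ 2 := by field_simp; linarith
    have hzw : z = 1 / w ^ 2 := by field_simp; linarith
    have h1 : (y - z) * w ^ 3 = (w - v) * (w * (w + v) / v ^ 2) := by
      rw [hyv, hzw]; field_simp; ring
    rw [h1]
    refine le_mul_of_one_le_right (by linarith) ?_
    rw [le_div_iff₀ (by positivity)]
    nlinarith
  have hyz : 0 ≤ y - z := by
    have h1 : 0 ≤ (y - z) * w ^ 3 := le_trans (by linarith) h0
    exact nonneg_of_mul_nonneg_left h1 (by positivity)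
  rw [abs_of_nonneg (sub_nonneg.2 (pow_le_pow_left₀ hv.le hvw k))]
  induction k with
  | zero => simp
  | succ k ih =>
    have h1 : w ^ (k + 1) - v ^ (k + 1) = w * (w ^ k - v ^ k) + v ^ k * (w - v) := by ring
    rw [h1]
    calc w * (w ^ k - v ^ k) + v ^ k * (w - v)
        ≤ w * (k * ((y - z) * w ^ (k + 2))) + w ^ k * ((y - z) * w ^ 3) := by
          refine add_le_add (mul_le_mul_of_nonneg_left ih hw.le)
            (mul_le_mul (pow_le_pow_left₀ hv.le hvw k) h0 (by linarith) (by positivity))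
      _ = _ := by push_cast; ring

end PowerExpansion

/-! ### Pathwise expansion of the residual powers around θ. -/

section ResidualExpansion

variable {p q : ℕ} {θ : GarchParam p q} {x : ℤ → ℝ} {κ ρ C : ℝ}

/-- The sequence `(1, x_{t-1}², x_{t-2}², …)`. -/
def lagSq (x : ℤ → ℝ) (t : ℤ) : ℕ → ℝ
  | 0 => 1
  | i + 1 => x (t - (i + 1)) ^ 2

lemma lagSq_nonneg (x : ℤ → ℝ) (t : ℤ) (i : ℕ) : 0 ≤ lagSq x t i := by
  rcases i with _ | i
  · exact zero_le_one
  · exact sq_nonneg _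

/-- The mean of `κ^i` under the weights `c_i(θ) x_{t-i}² / σ_t²(θ)`. -/
def garchTilt (θ : GarchParam p q) (κ : ℝ) (x : ℤ → ℝ) (t : ℤ) : ℝ :=
  (∑' i : ℕ, (κ ^ i * garchCoef θ i) * lagSq x t i) / garchSigmaSq θ x t

lemma SubexpGrowth.summable_tilt (hy : SubexpGrowth fun t => x t ^ 2) (hθ : ∀ a, 0 < θ a)
    (hβ : ∑ j : Fin q, θ (Sum.inr j) < 1) (hρ : 0 < ρ) (hc : ∀ i, garchCoef θ i ≤ C * ρ ^ i)
    (hκ : 0 < κ) (hκρ : κ * ρ < 1) (t : ℤ) :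
    Summable fun i => (κ ^ i * garchCoef θ i) * lagSq x t i := by
  have hκρ0 : 0 < κ * ρ := mul_pos hκ hρ
  obtain ⟨B, hB⟩ := hy.exists_sum_bound hκρ0 (by linarith : κ * ρ < (1 + κ * ρ) / 2)
    (by linarith) (c := fun i => κ ^ i * garchCoef θ i) (A := C) fun i => by
      have h0 := garchCoef_nonneg hθ hβ i
      rw [abs_of_nonneg (by positivity), mul_pow]
      have := mul_le_mul_of_nonneg_left (hc i) (pow_nonneg hκ.le i)
      linarith
  exact (summable_nat_add_iff 1).1 (hB t).1.of_abs

lemma garchSigmaSq_eq_tsum (u : GarchParam p q) (t : ℤ)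
    (h : Summable fun i => garchCoef u i * lagSq x t i) :
    garchSigmaSq u x t = ∑' i, garchCoef u i * lagSq x t i := by
  rw [h.tsum_eq_zero_add]
  simp only [lagSq, mul_one]
  rfl

lemma SubexpGrowth.summable_lagSq (hy : SubexpGrowth fun t => x t ^ 2) (hθ : ∀ a, 0 < θ a)
    (hβ : ∑ j : Fin q, θ (Sum.inr j) < 1) (t : ℤ) :
    Summable fun i => garchCoef θ i * lagSq x t i :=
  (summable_nat_add_iff 1).1 (hy.summable_garchCoef hθ hβ t)

lemma garchSigmaSq_pos (hθ : ∀ a, 0 < θ a) (hβ : ∑ j : Fin q, θ (Sum.inr j) < 1) (t : ℤ) :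
    0 < garchSigmaSq θ x t := (garchCoef_zero_pos hθ hβ).trans_le (garchSigmaSq_ge hθ hβ t)

lemma exists_abs_garchCoefDeriv_le (hθ : ∀ a, 0 < θ a) (hβ : ∑ j : Fin q, θ (Sum.inr j) < 1)
    (hκ : 1 < κ) : ∃ B : ℝ, 0 ≤ B ∧ ∀ i a, |garchCoefDeriv θ i a| ≤ B * (κ ^ i * garchCoef θ i) := by
  obtain ⟨A, hA, δ, hδ, hloc⟩ := garchCoef_local hθ hβ hκ
  -- The directional bound is applied to the perturbation δθ_a of the single coordinate a and
  -- divided by δθ_a; the sum over a makes the constant uniform.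
  refine ⟨∑ a, A / θ a, Finset.sum_nonneg fun a _ => div_nonneg (by linarith) (hθ a).le,
    fun i a => ?_⟩
  have hc := garchCoef_nonneg hθ hβ i
  have h1 := (hloc δ hδ.le le_rfl (Pi.single a (δ * θ a)) (fun b => by
    rcases eq_or_ne b a with rfl | hb
    · rw [Pi.single_eq_same, abs_of_pos (mul_pos hδ (hθ _))]
    · rw [Pi.single_eq_of_ne hb, abs_zero]
      exact (mul_pos hδ (hθ _)).le) i).1
  rw [garchCoefDir_eq_sum, Finset.sum_eq_single a (fun b _ hb => by
    rw [Pi.single_eq_of_ne hb, mul_zero]) (by simp), Pi.single_eq_same, abs_mul,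
    abs_of_pos (mul_pos hδ (hθ a))] at h1
  have h2 : |garchCoefDeriv θ i a| ≤ A / θ a * (κ ^ i * garchCoef θ i) := by
    have hθa := hθ a
    rw [div_mul_eq_mul_div, le_div_iff₀ hθa]
    refine le_of_mul_le_mul_left ?_ hδ
    linarith
  refine h2.trans (mul_le_mul_of_nonneg_right ?_ (by positivity))
  exact Finset.single_le_sum (f := fun a => A / θ a)
    (fun a _ => div_nonneg (by linarith) (hθ a).le) (Finset.mem_univ a)

lemma garchDLogSigmaSq_eq_tsum (a : Fin (p + 1) ⊕ Fin q) (t : ℤ)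
    (h : Summable fun i => garchCoefDeriv θ i a * lagSq x t i) :
    garchDLogSigmaSq θ x t a = (∑' i, garchCoefDeriv θ i a * lagSq x t i) / garchSigmaSq θ x t := by
  rw [h.tsum_eq_zero_add]
  simp only [lagSq, mul_one]
  rfl

lemma sum_garchDLogSigmaSq_mul (h : GarchParam p q) (t : ℤ)
    (hs : ∀ a, Summable fun i => garchCoefDeriv θ i a * lagSq x t i) :
    ∑ a, garchDLogSigmaSq θ x t a * h a =
      (∑' i, garchCoefDir θ h i * lagSq x t i) / garchSigmaSq θ x t := by
  have h1 : ∀ i, garchCoefDir θ h i * lagSq x t i =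
      ∑ a, garchCoefDeriv θ i a * lagSq x t i * h a := by
    intro i
    rw [garchCoefDir_eq_sum, Finset.sum_mul]
    exact Finset.sum_congr rfl fun a _ => by ring
  simp only [h1]
  rw [Summable.tsum_finsetSum fun a _ => (hs a).mul_right (h a), Finset.sum_div]
  refine Finset.sum_congr rfl fun a _ => ?_
  rw [garchDLogSigmaSq_eq_tsum a t (hs a), tsum_mul_right]
  ring

lemma SubexpGrowth.summable_garchCoefDeriv (hy : SubexpGrowth fun t => x t ^ 2)
    (hθ : ∀ a, 0 < θ a) (hβ : ∑ j : Fin q, θ (Sum.inr j) < 1) (t : ℤ)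
    (a : Fin (p + 1) ⊕ Fin q) : Summable fun i => garchCoefDeriv θ i a * lagSq x t i := by
  obtain ⟨ρ, hρ0, hρ1, C, hC, hc⟩ := garchCoef_le_geometric hθ hβ
  have hκ : 1 < (1 + ρ⁻¹) / 2 := by
    have := (one_lt_inv₀ hρ0).2 hρ1
    linarith
  obtain ⟨B, hB, hderiv⟩ := exists_abs_garchCoefDeriv_le hθ hβ hκ
  refine summable_of_abs_le_mul (lagSq_nonneg x t)
    (hy.summable_tilt hθ hβ hρ0 hc (by linarith) ?_ t) fun i => hderiv i a
  have : (1 + ρ⁻¹) / 2 * ρ = (ρ + 1) / 2 := by field_simp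
  linarith

/-- The logarithmic derivative of the volatility is bounded by the tilted mean. -/
lemma exists_abs_garchDLogSigmaSq_le (hθ : ∀ a, 0 < θ a) (hβ : ∑ j : Fin q, θ (Sum.inr j) < 1)
    (hρ : 0 < ρ) (hc : ∀ i, garchCoef θ i ≤ C * ρ ^ i) (hκ : 1 < κ) (hκρ : κ * ρ < 1) :
    ∃ B : ℝ, 0 ≤ B ∧ ∀ x : ℤ → ℝ, (SubexpGrowth fun t => x t ^ 2) → ∀ t a,
      |garchDLogSigmaSq θ x t a| ≤ B * garchTilt θ κ x t := by
  obtain ⟨B, hB, hderiv⟩ := exists_abs_garchCoefDeriv_le hθ hβ hκ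
  refine ⟨B, hB, fun x hy t a => ?_⟩
  have hS := garchSigmaSq_pos (x := x) hθ hβ t
  have h1 := hy.summable_tilt hθ hβ hρ hc (by linarith) hκρ t
  rw [garchDLogSigmaSq_eq_tsum a t (hy.summable_garchCoefDeriv hθ hβ t a), abs_div, abs_of_pos hS,
    garchTilt, ← mul_div_assoc]
  gcongr
  exact abs_tsum_le_of_abs_le_mul (lagSq_nonneg x t) h1 fun i => hderiv i a

lemma garchSigmaSqHat_eq_sum (u : GarchParam p q) (x : ℤ → ℝ) (n : ℕ) :
    garchSigmaSqHat u x n = ∑ i ∈ Finset.range (n + 1), garchCoef u i * lagSq x n i := by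
  rw [Finset.sum_range_succ', garchSigmaSqHat, add_comm]
  congr 1
  · rw [Finset.range_eq_Ico, Finset.sum_Ico_add' (fun i => garchCoef u i * lagSq x n i) 0 n 1]
    refine Finset.sum_congr (by ext; simp only [Finset.mem_Icc, Finset.mem_Ico]; omega) fun i hi => ?_
    obtain ⟨m, rfl⟩ : ∃ m, i = m + 1 := ⟨i - 1, by have := (Finset.mem_Ico.1 hi).1; omega⟩
    simp [lagSq]
  · simp [lagSq]

/-- Growth is controlled for squares only, hence the detour through |x|^k ≤ 1 + x^{2k}. -/
lemma SubexpGrowth.summable_pow_mul_abs_pow (hy : SubexpGrowth fun t => x t ^ 2) {r : ℝ}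
    (hr : 0 < r) (hr1 : r < 1) (k : ℕ) : Summable fun n : ℕ => r ^ n * |x n| ^ k := by
  obtain ⟨r', hr'⟩ : ∃ r', r' = (1 + r) / 2 := ⟨_, rfl⟩
  have hr'0 : 0 < r' := by rw [hr']; positivity
  have hr'1 : r' < 1 := by rw [hr']; linarith
  have hr'2 : r < r' := by rw [hr']; linarith
  obtain ⟨B, hB⟩ := ((SubexpGrowth.const 1).add (hy.pow k)) r' hr'0 hr'1
  have hg := (summable_geometric_of_lt_one (by positivity) ((div_lt_one hr'0).2 hr'2)).mul_left B
  refine hg.of_nonneg_of_le (fun n => by positivity) fun n => ?_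
  have h1 := hB n
  have h2 : |x n| ^ k ≤ |1 + (x n ^ 2) ^ k| := by
    have h3 : (x n ^ 2) ^ k = (|x n| ^ k) ^ 2 := by
      rw [← sq_abs]; ring
    rw [h3]
    refine le_trans ?_ (le_abs_self _)
    nlinarith [sq_nonneg (|x n| ^ k - 1)]
  simp only [Int.natAbs_natCast] at h1
  calc r ^ n * |x n| ^ k ≤ r ^ n * (B / r' ^ n) := by
        gcongr
        rw [le_div_iff₀ (by positivity)]
        exact (mul_le_mul_of_nonneg_right h2 (by positivity)).trans h1
    _ = B * (r / r') ^ n := by rw [div_pow r]; ring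

lemma SubexpGrowth.summable_pow_mul_lagSq (hy : SubexpGrowth fun t => x t ^ 2) {r : ℝ}
    (hr : 0 < r) (hr1 : r < 1) (t : ℤ) :
    Summable fun m : ℕ => r ^ (m + 1) * lagSq x t (m + 1) := by
  obtain ⟨B, hB⟩ := hy.exists_sum_bound hr (by linarith : r < (1 + r) / 2)
    (by linarith) (c := fun i => r ^ i) (A := 1) fun i => by
      rw [one_mul, abs_of_nonneg (by positivity)]
  exact (hB t).1.of_abs

/-- Second order expansion of `(S / U) ^ (k / 2)` for `U = S + D + ⋯`. -/
lemma abs_sqrt_div_pow_sub_le {S U D T A δ : ℝ} (hS : 0 < S) (hU0 : 0 < U) (hST : S ≤ T)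
    (hA : 1 ≤ A) (hδ : 0 ≤ δ) (hδ1 : δ ≤ 1) (hD : |D| ≤ A * δ * T)
    (hUD : |U - S - D| ≤ A * δ ^ 2 * T) (hCS : S ^ 2 ≤ A * T * U) (k : ℕ) :
    |Real.sqrt (S / U) ^ k - 1 + (k : ℝ) / 2 * (D / S)| ≤
      (((k : ℝ) ^ 2 + k) * (4 * 2 ^ (k + 4)) + k) * A ^ (k + 6) * δ ^ 2 * (T / S) ^ (k + 6) := by
  have hk : (0 : ℝ) ≤ k := k.cast_nonneg
  have hA0 : 0 < A := by linarith
  have hG1 : 1 ≤ T / S := (one_le_div hS).2 hST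
  set v := Real.sqrt (S / U) with hv
  have hv0 : 0 < v := Real.sqrt_pos.2 (by positivity)
  have hyv : U / S * v ^ 2 = 1 := by
    rw [hv, Real.sq_sqrt (by positivity)]; field_simp
  -- H dominates everything at once: Cauchy–Schwarz gives S/U ≤ H, and H ≤ H² because H ≥ 1, so v ≤
  -- H.
  obtain ⟨H, hHdef⟩ : ∃ H, H = A * (T / S) := ⟨_, rfl⟩
  have hH1 : 1 ≤ H := hHdef ▸ one_le_mul_of_one_le_of_one_le hA hG1
  have hvH : v ≤ H := by
    have h1 : S / U ≤ H := by
      rw [div_le_iff₀ hU0, hHdef]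
      have h2 : A * (T / S) * U = A * T * U / S := by ring
      rw [h2, le_div_iff₀ hS]
      linarith [sq S]
    calc v ≤ Real.sqrt (H ^ 2) := Real.sqrt_le_sqrt (h1.trans (by nlinarith))
      _ = H := Real.sqrt_sq (by linarith)
  have hDL : |D / S| ≤ δ * H := by
    rw [abs_div, abs_of_pos hS, div_le_iff₀ hS, hHdef]
    refine hD.trans_eq ?_
    field_simp
  have hUL : |U / S - 1 - D / S| ≤ δ ^ 2 * H := by
    have h1 : U / S - 1 - D / S = (U - S - D) / S := by field_simp
    rw [h1, abs_div, abs_of_pos hS, div_le_iff₀ hS, hHdef]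
    refine hUD.trans_eq ?_
    field_simp
  have hδ2 : δ ^ 2 ≤ δ := by nlinarith
  have hy1 : |U / S - 1| ≤ 2 * δ * H := by
    have h1 : U / S - 1 = (U / S - 1 - D / S) + D / S := by ring
    rw [h1]
    refine (abs_add_le _ _).trans ?_
    have h2 : δ ^ 2 * H ≤ δ * H := by gcongr
    linarith
  have h1 := abs_pow_expansion_le hv0 hyv k
  have h2 : v ^ k - 1 + (k : ℝ) / 2 * (D / S) =
      (v ^ k - 1 + (k : ℝ) / 2 * (U / S - 1)) - (k : ℝ) / 2 * (U / S - 1 - D / S) := by ring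
  have h3 : (U / S - 1) ^ 2 * (1 + v) ^ (k + 4) ≤
      (2 * δ * H) ^ 2 * (2 * H) ^ (k + 4) := by
    have h4 : (U / S - 1) ^ 2 ≤ (2 * δ * H) ^ 2 := by
      rw [← sq_abs]
      gcongr
    gcongr
    linarith
  have h5 : H ≤ H ^ (k + 6) := le_self_pow₀ hH1 (by omega)
  calc |v ^ k - 1 + (k : ℝ) / 2 * (D / S)|
      ≤ ((k : ℝ) ^ 2 + k) * ((2 * δ * H) ^ 2 * (2 * H) ^ (k + 4)) + (k : ℝ) / 2 * (δ ^ 2 * H) := by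
        rw [h2]
        refine (abs_sub _ _).trans (add_le_add (h1.trans (by gcongr)) ?_)
        rw [abs_mul, abs_of_nonneg (by positivity : 0 ≤ (k : ℝ) / 2)]
        gcongr
    _ ≤ ((k : ℝ) ^ 2 + k) * ((2 * δ * H) ^ 2 * (2 * H) ^ (k + 4)) + k * (δ ^ 2 * H ^ (k + 6)) := by
        have h6 : (k : ℝ) / 2 ≤ k := by linarith
        have h7 : 0 ≤ H := by linarith
        gcongr
    _ = _ := by
        rw [hHdef]
        ring
/-- Pathwise expansion of the powers of the residuals around `θ`. -/
theorem exists_residual_expansion (hθ : ∀ a, 0 < θ a) (hβ : ∑ j : Fin q, θ (Sum.inr j) < 1)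
    (hρ : 0 < ρ) (hC : 0 < C) (hc : ∀ i, garchCoef θ i ≤ C * ρ ^ i) (k : ℕ) {K : ℝ} (hK : 1 < K)
    (hKρ : K * ρ < 1) :
    ∃ M : ℝ, 0 ≤ M ∧ ∃ L : ℝ, 0 ≤ L ∧ ∃ r : ℝ, 0 < r ∧ r < 1 ∧ ∃ δ₀ : ℝ, 0 < δ₀ ∧
      ∀ x ε : ℤ → ℝ, (SubexpGrowth fun t => x t ^ 2) →
      (∀ t, x t = Real.sqrt (garchSigmaSq θ x t) * ε t) →
      ∀ δ : ℝ, 0 ≤ δ → δ ≤ δ₀ → ∀ h : GarchParam p q, (∀ a, |h a| ≤ δ * θ a) → ∀ n : ℕ,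
        |(|garchResidual (θ + h) x n ^ k - ε n ^ k| -
          (k : ℝ) / 2 * |∑ a, ε n ^ k * garchDLogSigmaSq θ x n a * h a|)| ≤
        M * δ ^ 2 * (|ε n| ^ k * garchTilt θ K x n) +
          L * ((∑' m : ℕ, r ^ (m + 1) * lagSq x 0 (m + 1)) * (r ^ n * |x n| ^ k)) := by
  -- The second-order error carries the power k + 6 of the κ-tilted mean, so κ = 1/r is taken with
  -- κ^{k+6} ≤ K.
  obtain ⟨r, hr0, hr1, hr⟩ := exists_lt_pow_lt_one (a := K⁻¹) (inv_lt_one_of_one_lt₀ hK) (k + 6)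
  set κ := r⁻¹ with hκdef
  have hκ : 1 < κ := (one_lt_inv₀ hr0).2 hr1
  have hκ0 : 0 < κ := by linarith
  have hκK : κ ^ (k + 6) ≤ K := by
    rw [hκdef, inv_pow]
    exact (inv_le_comm₀ (by positivity) (by linarith)).2 hr.le
  have hκK1 : κ ≤ K := (le_self_pow₀ hκ.le (by omega)).trans hκK
  have hκρ : κ * ρ < 1 := lt_of_le_of_lt (by gcongr) hKρ
  have hκmρ : κ ^ (k + 6) * ρ < 1 := lt_of_le_of_lt (by gcongr) hKρ
  obtain ⟨A, hA, δ₁, hδ₁, hloc⟩ := garchCoef_local hθ hβ hκ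
  have hA0 : 0 < A := by linarith
  have hc0 := garchCoef_zero_pos hθ hβ
  have hcn := garchCoef_nonneg hθ hβ
  have hk : (0 : ℝ) ≤ k := k.cast_nonneg
  set M := (((k : ℝ) ^ 2 + k) * (4 * 2 ^ (k + 4)) + k) * A ^ (k + 6) with hMdef
  have hκρ0 : 0 < κ * ρ := mul_pos hκ0 hρ
  set a₀ := Real.sqrt (A / garchCoef θ 0) with ha₀
  refine ⟨M, by positivity, k * a₀ ^ (k + 2) * (3 * A * C), by positivity, κ * ρ, hκρ0, hκρ,
    min δ₁ 1, by positivity, fun x ε hy hx δ hδ hδ0 h hh n => ?_⟩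
  -- the contribution of the unobserved past
  have hgeo := hy.summable_pow_mul_lagSq hκρ0 hκρ 0
  set Z := ∑' m : ℕ, (κ * ρ) ^ (m + 1) * lagSq x 0 (m + 1) with hZdef
  have hZ0 : 0 ≤ Z := tsum_nonneg fun m => mul_nonneg (by positivity) (lagSq_nonneg x 0 _)
  have hδ1 : δ ≤ 1 := hδ0.trans (min_le_right _ _)
  have hl := hloc δ hδ (hδ0.trans (min_le_left _ _)) h hh
  set ξ := lagSq x n with hξdef
  have hξ : ∀ i, 0 ≤ ξ i := lagSq_nonneg x n
  set S := garchSigmaSq θ x n with hSdef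
  have hS : 0 < S := garchSigmaSq_pos hθ hβ _
  have hcS := hy.summable_lagSq hθ hβ n
  have hSsum : S = ∑' i, garchCoef θ i * ξ i := garchSigmaSq_eq_tsum θ n hcS
  have hT := hy.summable_tilt hθ hβ hρ hc hκ0 hκρ n
  have hTm := hy.summable_tilt hθ hβ hρ hc (by positivity) hκmρ n
  set T := ∑' i, (κ ^ i * garchCoef θ i) * ξ i with hTdef
  set G := T / S with hGdef
  have hST : S ≤ T := by
    rw [hSsum]
    refine hcS.tsum_le_tsum (fun i => ?_) hT
    rw [mul_assoc]
    exact le_mul_of_one_le_left (mul_nonneg (hcn i) (hξ i)) (one_le_pow₀ hκ.le)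
  have hG1 : 1 ≤ G := (one_le_div hS).2 hST
  -- the perturbed coefficients
  set u := θ + h with hu
  have hu0 : ∀ i, 0 ≤ garchCoef u i := by
    intro i
    have h1 := (hcn i).trans (hl i).2.2
    rw [← mul_assoc] at h1
    exact nonneg_of_mul_nonneg_right h1 (by positivity)
  have hu3 : ∀ i, |garchCoef u i| ≤ 3 * A * (κ ^ i * garchCoef θ i) := by
    intro i
    have h1 := (hl i).1
    have h2 := (hl i).2.1
    have hw : 0 ≤ κ ^ i * garchCoef θ i := mul_nonneg (by positivity) (hcn i)
    have h3 : garchCoef θ i ≤ κ ^ i * garchCoef θ i :=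
      le_mul_of_one_le_left (hcn i) (one_le_pow₀ hκ.le)
    have h4 : A * δ * (κ ^ i * garchCoef θ i) ≤ A * (κ ^ i * garchCoef θ i) := by
      gcongr
      exact mul_le_of_le_one_right hA0.le hδ1
    have h5 : A * δ ^ 2 * (κ ^ i * garchCoef θ i) ≤ A * (κ ^ i * garchCoef θ i) := by
      gcongr
      exact mul_le_of_le_one_right hA0.le (pow_le_one₀ hδ hδ1)
    have h6 : κ ^ i * garchCoef θ i ≤ A * (κ ^ i * garchCoef θ i) := le_mul_of_one_le_left hw hA
    rw [abs_of_nonneg (hu0 i)]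
    linarith [le_abs_self (garchCoef u i - garchCoef θ i - garchCoefDir θ h i),
      le_abs_self (garchCoefDir θ h i)]
  have hus : Summable fun i => garchCoef u i * ξ i := summable_of_abs_le_mul hξ hT hu3
  have hls : Summable fun i => garchCoefDir θ h i * ξ i :=
    summable_of_abs_le_mul hξ hT fun i => (hl i).1
  set U := ∑' i, garchCoef u i * ξ i with hUdef
  set D := ∑' i, garchCoefDir θ h i * ξ i with hDdef
  have hD : |D| ≤ A * δ * T := abs_tsum_le_of_abs_le_mul hξ hT fun i => (hl i).1
  have hUD : |U - S - D| ≤ A * δ ^ 2 * T := by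
    have h1 := abs_tsum_le_of_abs_le_mul hξ hT fun i => (hl i).2.1
    have h2 : ∑' i, (garchCoef u i - garchCoef θ i - garchCoefDir θ h i) * ξ i = U - S - D := by
      simp only [sub_mul]
      rw [(hus.sub hcS).tsum_sub hls, hus.tsum_sub hcS, ← hSsum]
    rwa [h2] at h1
  -- The bound S/U ≤ A·T/S on the inverse of the perturbed volatility, obtained without any moment
  -- of X.
  have hCS : S ^ 2 ≤ A * T * U := by
    have h1 := sq_tsum_le_mul_tsum (A := A) (b := fun i => κ ^ i)
      (c := fun i => garchCoef θ i * ξ i) (u := fun i => garchCoef u i * ξ i) hA0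
      (fun i => by positivity) (fun i => mul_nonneg (hcn i) (hξ i)) hcS
      (by simpa only [mul_assoc] using hT) hus (fun i => by
        have := mul_le_mul_of_nonneg_right (hl i).2.2 (hξ i)
        linarith) (by simpa only [hTdef, mul_assoc] using hS.trans_le hST)
    simpa only [← mul_assoc, ← hSsum, ← hTdef, ← hUdef] using h1
  have hT0 : 0 < T := hS.trans_le hST
  have hU0 : 0 < U := by
    by_contra hcon
    push Not at hcon
    have : A * T * U ≤ 0 := mul_nonpos_of_nonneg_of_nonpos (by positivity) hcon
    nlinarith
  -- the truncated volatility
  set V := garchSigmaSqHat u x n with hVdef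
  have hVsum : V = ∑ i ∈ Finset.range (n + 1), garchCoef u i * ξ i := garchSigmaSqHat_eq_sum u x n
  have hVU : V + ∑' i, garchCoef u (i + (n + 1)) * ξ (i + (n + 1)) = U := by
    rw [hVsum]
    exact hus.sum_add_tsum_nat_add (n + 1)
  have htail0 : 0 ≤ ∑' i, garchCoef u (i + (n + 1)) * ξ (i + (n + 1)) :=
    tsum_nonneg fun i => mul_nonneg (hu0 _) (hξ _)
  have htail : ∑' i, garchCoef u (i + (n + 1)) * ξ (i + (n + 1)) ≤ 3 * A * C * Z * (κ * ρ) ^ n := by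
    have h1 : ∀ i, garchCoef u (i + (n + 1)) * ξ (i + (n + 1)) ≤
        3 * A * C * (κ * ρ) ^ n * ((κ * ρ) ^ (i + 1) * lagSq x 0 (i + 1)) := by
      intro i
      -- Lag i + n + 1 seen from time n is lag i + 1 seen from time 0, so the tail splits into a
      -- geometric factor in n and one variable Z independent of n.
      have h2 : ξ (i + (n + 1)) = lagSq x 0 (i + 1) := by
        simp only [hξdef, lagSq, ← add_assoc]
        congr 2
        push_cast
        ring
      rw [h2]
      have h3 : garchCoef u (i + (n + 1)) ≤ 3 * A * (κ ^ (i + (n + 1)) * (C * ρ ^ (i + (n + 1)))) := by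
        refine (le_abs_self _).trans ((hu3 _).trans ?_)
        gcongr
        exact hc _
      calc garchCoef u (i + (n + 1)) * lagSq x 0 (i + 1)
          ≤ 3 * A * (κ ^ (i + (n + 1)) * (C * ρ ^ (i + (n + 1)))) * lagSq x 0 (i + 1) :=
            mul_le_mul_of_nonneg_right h3 (lagSq_nonneg _ _ _)
        _ = _ := by rw [mul_pow, mul_pow]; ring
    have h4 := (summable_nat_add_iff (n + 1)).2 hus
    refine (h4.tsum_le_tsum h1 (hgeo.mul_left _)).trans_eq ?_
    rw [tsum_mul_left]
    ring
  -- The term i = 0 alone bounds the truncated volatility from below, uniformly in n and in the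
  -- trajectory.
  have hV0 : garchCoef θ 0 / A ≤ V := by
    have h1 := (hl 0).2.2
    rw [pow_zero, one_mul] at h1
    rw [div_le_iff₀ hA0]
    refine h1.trans ?_
    rw [mul_comm]
    gcongr
    have h2 : garchCoef u 0 * ξ 0 ≤ V := by
      rw [hVsum]
      exact Finset.single_le_sum (f := fun i => garchCoef u i * ξ i)
        (fun i _ => mul_nonneg (hu0 i) (hξ i)) (by simp)
    simpa [hξdef, lagSq] using h2
  have hVpos : 0 < V := lt_of_lt_of_le (by positivity) hV0
  have hVleU : V ≤ U := by linarith
  -- passage to the ratios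
  set v := Real.sqrt (S / U) with hv
  set w := Real.sqrt (S / V) with hw
  have hv0 : 0 < v := Real.sqrt_pos.2 (by positivity)
  have hvw : v ≤ w := Real.sqrt_le_sqrt (by gcongr)
  have hyv : U / S * v ^ 2 = 1 := by
    rw [hv, Real.sq_sqrt (by positivity)]; field_simp
  have hzw : V / S * w ^ 2 = 1 := by
    rw [hw, Real.sq_sqrt (by positivity)]; field_simp
  have hmain : |v ^ k - 1 + (k : ℝ) / 2 * (D / S)| ≤ M * δ ^ 2 * G ^ (k + 6) :=
    abs_sqrt_div_pow_sub_le hS hU0 hST hA hδ hδ1 hD hUD hCS k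
  -- Jensen moves the power inside the weighted mean, where κ^{(k+6)i} ≤ K^i.
  have hJ : G ^ (k + 6) ≤ garchTilt θ K x n := by
    have h1 := pow_weighted_tsum_le (b := fun i => κ ^ i) (w := fun i => garchCoef θ i * ξ i)
      (fun i => mul_nonneg (hcn i) (hξ i)) (fun i => by positivity) (k + 6) hcS
      (by simpa only [mul_assoc] using hT)
      (by simpa only [mul_assoc, ← pow_mul, mul_comm (k + 6)] using hTm)
      (by rw [← hSsum]; exact hS)
    simp only [← mul_assoc, ← hSsum, ← hTdef] at h1
    refine h1.trans ?_
    unfold garchTilt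
    rw [← hSdef, ← hξdef]
    refine div_le_div_of_nonneg_right ?_ hS.le
    refine Summable.tsum_le_tsum (fun i => ?_)
      (by simpa only [mul_assoc, ← pow_mul, mul_comm (k + 6)] using hTm)
      (hy.summable_tilt hθ hβ hρ hc (by linarith) hKρ n)
    have h2 : (κ ^ i) ^ (k + 6) ≤ K ^ i := by
      rw [← pow_mul, mul_comm, pow_mul]
      gcongr
    have := hξ i
    have := hcn i
    gcongr
  -- conclusion
  have hres : garchResidual u x n = ε n * w := by
    unfold garchResidual
    rw [hx n, ← hSdef, ← hVdef, hw, Real.sqrt_div hS.le]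
    ring
  have hDlog : ∑ a, ε n ^ k * garchDLogSigmaSq θ x n a * h a = ε n ^ k * (D / S) := by
    have := sum_garchDLogSigmaSq_mul (x := x) h n fun a => hy.summable_garchCoefDeriv hθ hβ n a
    rw [hDdef, hξdef, hSdef, ← this, Finset.mul_sum]
    exact Finset.sum_congr rfl fun a _ => by ring
  -- Since w ≤ a₀√S, the powers of √S recombine with |ε_n|^k into |x_n|^k and the two left over
  -- cancel the denominator S.
  have hwv : |ε n| ^ k * |w ^ k - v ^ k| ≤
      k * a₀ ^ (k + 2) * (3 * A * C) * (Z * ((κ * ρ) ^ n * |x n| ^ k)) := by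
    have h1 := abs_pow_sub_pow_le_of_mul_sq hv0 hvw hyv hzw k
    have h2 : w ≤ a₀ * Real.sqrt S := by
      rw [ha₀, ← Real.sqrt_mul (by positivity)]
      refine Real.sqrt_le_sqrt ?_
      rw [div_le_iff₀ hVpos]
      calc S = A / garchCoef θ 0 * S * (garchCoef θ 0 / A) := by field_simp
        _ ≤ _ := by gcongr
    have h3 : U / S - V / S ≤ 3 * A * C * Z * (κ * ρ) ^ n / S := by
      rw [← sub_div]
      gcongr
      linarith
    have h4 : 0 ≤ U / S - V / S := by
      rw [← sub_div]
      exact div_nonneg (by linarith) hS.le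
    have hw0 : 0 < w := hv0.trans_le hvw
    have h5 : |ε n| ^ k * Real.sqrt S ^ k = |x n| ^ k := by
      rw [hx n, ← hSdef, abs_mul, abs_of_nonneg (Real.sqrt_nonneg _), mul_pow, mul_comm]
    calc |ε n| ^ k * |w ^ k - v ^ k|
        ≤ |ε n| ^ k * (k * ((3 * A * C * Z * (κ * ρ) ^ n / S) * (a₀ * Real.sqrt S) ^ (k + 2))) := by
          refine mul_le_mul_of_nonneg_left (h1.trans ?_) (by positivity)
          gcongr
      _ = (|ε n| ^ k * Real.sqrt S ^ k) *
            (k * a₀ ^ (k + 2) * (3 * A * C * Z)) * (κ * ρ) ^ n * (Real.sqrt S ^ 2 / S) := by ring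
      _ = _ := by
          rw [h5, Real.sq_sqrt hS.le, div_self hS.ne']
          ring
  rw [hres, hDlog, mul_pow, abs_mul, ← mul_sub_one, abs_mul, abs_pow]
  have hek : 0 ≤ |ε n| ^ k := by positivity
  have hfin : |(|w ^ k - 1| - (k : ℝ) / 2 * |D / S|)| ≤
      M * δ ^ 2 * G ^ (k + 6) + |w ^ k - v ^ k| := by
    have h1 : (k : ℝ) / 2 * |D / S| = |-((k : ℝ) / 2 * (D / S))| := by
      rw [abs_neg, abs_mul, abs_of_nonneg (by positivity : 0 ≤ (k : ℝ) / 2)]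
    rw [h1]
    refine (abs_abs_sub_abs_le _ _).trans ?_
    have h2 : w ^ k - 1 - -((k : ℝ) / 2 * (D / S)) =
        (v ^ k - 1 + (k : ℝ) / 2 * (D / S)) + (w ^ k - v ^ k) := by ring
    rw [h2]
    exact (abs_add_le _ _).trans (by gcongr)
  calc |(|ε n| ^ k * |w ^ k - 1| - (k : ℝ) / 2 * (|ε n| ^ k * |D / S|))|
      = |ε n| ^ k * |(|w ^ k - 1| - (k : ℝ) / 2 * |D / S|)| := by
        nth_rewrite 3 [← abs_of_nonneg hek]
        rw [← abs_mul, mul_sub, mul_left_comm]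
    _ ≤ |ε n| ^ k * (M * δ ^ 2 * G ^ (k + 6) + |w ^ k - v ^ k|) := by gcongr
    _ ≤ |ε n| ^ k * (M * δ ^ 2 * garchTilt θ K x n) +
          k * a₀ ^ (k + 2) * (3 * A * C) * (Z * ((κ * ρ) ^ n * |x n| ^ k)) := by
        rw [mul_add]
        have : 0 ≤ M := by positivity
        gcongr
    _ = _ := by ring

end ResidualExpansion

/-! ### Integrability and past-measurability of the tilted mean. -/

section TiltMoment

variable {p q : ℕ} {θ : GarchParam p q}
variable {Ω : Type*} [MeasurableSpace Ω] {μ : Measure Ω} {ε σ X : ℤ → Ω → ℝ}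

lemma le_rpow_of_le_one {w y s : ℝ} (hw : 0 ≤ w) (hw1 : w ≤ 1) (hwy : w ≤ y) (hs : 0 < s)
    (hs1 : s ≤ 1) : w ≤ y ^ s := by
  have h1 := Real.rpow_le_rpow_of_exponent_ge' hw hw1 hs.le hs1
  rw [Real.rpow_one] at h1
  exact h1.trans (Real.rpow_le_rpow hw hwy hs.le)

lemma garchTilt_nonneg (hθ : ∀ a, 0 < θ a) (hβ : ∑ j : Fin q, θ (Sum.inr j) < 1) {K : ℝ} (hK : 0 < K)
    (x : ℤ → ℝ) (t : ℤ) : 0 ≤ garchTilt θ K x t :=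
  div_nonneg (tsum_nonneg fun i => mul_nonneg (mul_nonneg (by positivity)
    (garchCoef_nonneg hθ hβ i)) (lagSq_nonneg _ _ _)) (garchSigmaSq_pos hθ hβ t).le

/-- Each weight is at most 1 and at most (C/c_0)ρ^i x_{t-i}², hence at most the s-th power of the
latter. The tilt is thus dominated by a series in which x² occurs only to the power s. -/
lemma ofReal_garchTilt_le (hθ : ∀ a, 0 < θ a) (hβ : ∑ j : Fin q, θ (Sum.inr j) < 1) {ρ C K s : ℝ}
    (hρ : 0 < ρ) (hC : 0 < C) (hc : ∀ i, garchCoef θ i ≤ C * ρ ^ i) (hK : 0 < K) (hKρ : K * ρ < 1)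
    (hs : 0 < s) (hs1 : s ≤ 1) {x : ℤ → ℝ} (hy : SubexpGrowth fun t => x t ^ 2) (t : ℤ) :
    ENNReal.ofReal (garchTilt θ K x t) ≤
      ∑' i : ℕ, ENNReal.ofReal ((C / garchCoef θ 0) ^ s * (K * ρ ^ s) ^ i) *
        ‖lagSq x t i‖ₑ ^ s := by
  have hc0 := garchCoef_zero_pos hθ hβ
  have hcn := garchCoef_nonneg hθ hβ
  have hS := garchSigmaSq_pos (x := x) hθ hβ t
  have hS0 := garchSigmaSq_ge (x := x) hθ hβ t
  have hcS := hy.summable_lagSq hθ hβ t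
  have hsum := hy.summable_tilt hθ hβ hρ hc hK hKρ t
  have hSS := garchSigmaSq_eq_tsum θ t hcS
  have hξ := lagSq_nonneg x t
  unfold garchTilt
  rw [← tsum_div_const, ENNReal.ofReal_tsum_of_nonneg (fun i => ?_) (hsum.div_const _)]
  · refine ENNReal.tsum_le_tsum fun i => ?_
    have hρs : (ρ ^ s) ^ i = (ρ ^ i) ^ s := by
      rw [← Real.rpow_natCast, ← Real.rpow_natCast, ← Real.rpow_mul hρ.le, ← Real.rpow_mul hρ.le,
        mul_comm]
    have hE : ‖lagSq x t i‖ₑ ^ s = ENNReal.ofReal (lagSq x t i ^ s) := by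
      rw [← ENNReal.ofReal_rpow_of_nonneg (hξ i) hs.le, Real.enorm_of_nonneg (hξ i)]
    rw [hE, ← ENNReal.ofReal_mul (by positivity)]
    refine ENNReal.ofReal_le_ofReal ?_
    have h1 : garchCoef θ i * lagSq x t i / garchSigmaSq θ x t ≤ 1 := by
      rw [div_le_one hS, hSS]
      exact hcS.le_tsum i fun j _ => mul_nonneg (hcn j) (hξ j)
    have h0 : 0 ≤ garchCoef θ i * lagSq x t i := mul_nonneg (hcn i) (hξ i)
    have h2 : garchCoef θ i * lagSq x t i / garchSigmaSq θ x t ≤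
        C / garchCoef θ 0 * ρ ^ i * lagSq x t i := by
      calc garchCoef θ i * lagSq x t i / garchSigmaSq θ x t
          ≤ garchCoef θ i * lagSq x t i / garchCoef θ 0 := by gcongr
        _ ≤ C * ρ ^ i * lagSq x t i / garchCoef θ 0 := by
            have := hc i
            have := hξ i
            gcongr
        _ = _ := by ring
    have h3 := le_rpow_of_le_one (div_nonneg h0 hS.le) h1 h2 hs hs1
    rw [Real.mul_rpow (by positivity) (hξ i), Real.mul_rpow (by positivity) (by positivity)] at h3
    rw [mul_assoc, mul_div_assoc, mul_pow, hρs]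
    refine (mul_le_mul_of_nonneg_left h3 (by positivity)).trans_eq ?_
    ring
  · have := hξ i
    have := hcn i
    positivity

/-- At time t + 1 the lags start with X_t², so the vector is a function of ε_t, ε_{t-1}, …. Stating
the factor property with this shift records that volatilities at time t do not involve ε_t, which
the independence argument needs. -/
lemma isPastFactor_lagSq (hY : IsPastFactor μ ε fun t ω => X t ω ^ 2) (i : ℕ) :
    IsPastFactor μ ε fun t ω => lagSq (fun s => X s ω) (t + 1) i := by
  rcases i with _ | i
  · exact IsPastFactor.const 1
  · have h := hY.shift i
    have h1 : ∀ t : ℤ, t + 1 - ((i : ℤ) + 1) = t - i := fun t => by ring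
    simpa only [lagSq, h1] using h

lemma isPastFactor_series (hY : IsPastFactor μ ε fun t ω => X t ω ^ 2) (b : ℕ → ℝ)
    (hb : ∀ᵐ ω ∂μ, ∀ t, Summable fun i => b i * lagSq (fun s => X s ω) t i) :
    IsPastFactor μ ε fun t ω => ∑' i, b i * lagSq (fun s => X s ω) (t + 1) i :=
  .tsum (fun i => (IsPastFactor.const (b i)).mul (isPastFactor_lagSq hY i))
    fun t => hb.mono fun _ h => h (t + 1)

lemma isPastFactor_garchSigmaSq (hθ : ∀ a, 0 < θ a) (hβ : ∑ j : Fin q, θ (Sum.inr j) < 1)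
    (hY : IsPastFactor μ ε fun t ω => X t ω ^ 2)
    (hpath : ∀ᵐ ω ∂μ, SubexpGrowth fun t => X t ω ^ 2) :
    IsPastFactor μ ε fun t ω => garchSigmaSq θ (fun s => X s ω) (t + 1) :=
  (isPastFactor_series hY (garchCoef θ)
    (hpath.mono fun _ h t => h.summable_lagSq hθ hβ t)).congr
    fun t => hpath.mono fun _ h => garchSigmaSq_eq_tsum θ _ (h.summable_lagSq hθ hβ _)

lemma isPastFactor_garchTilt (hθ : ∀ a, 0 < θ a) (hβ : ∑ j : Fin q, θ (Sum.inr j) < 1) {ρ C K : ℝ}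
    (hρ : 0 < ρ) (hc : ∀ i, garchCoef θ i ≤ C * ρ ^ i) (hK : 0 < K) (hKρ : K * ρ < 1)
    (hY : IsPastFactor μ ε fun t ω => X t ω ^ 2)
    (hpath : ∀ᵐ ω ∂μ, SubexpGrowth fun t => X t ω ^ 2) :
    IsPastFactor μ ε fun t ω => garchTilt θ K (fun s => X s ω) (t + 1) :=
  (isPastFactor_series hY (fun i => K ^ i * garchCoef θ i)
    (hpath.mono fun _ h t => h.summable_tilt hθ hβ hρ hc hK hKρ t)).div
    (isPastFactor_garchSigmaSq hθ hβ hY hpath)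

lemma isPastFactor_garchDLogSigmaSq (hθ : ∀ a, 0 < θ a) (hβ : ∑ j : Fin q, θ (Sum.inr j) < 1)
    (hY : IsPastFactor μ ε fun t ω => X t ω ^ 2)
    (hpath : ∀ᵐ ω ∂μ, SubexpGrowth fun t => X t ω ^ 2) (a : Fin (p + 1) ⊕ Fin q) :
    IsPastFactor μ ε fun t ω => garchDLogSigmaSq θ (fun s => X s ω) (t + 1) a :=
  ((isPastFactor_series hY (fun i => garchCoefDeriv θ i a)
    (hpath.mono fun _ h t => h.summable_garchCoefDeriv hθ hβ t a)).div
    (isPastFactor_garchSigmaSq hθ hβ hY hpath)).congr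
    fun t => hpath.mono fun _ h => garchDLogSigmaSq_eq_tsum a _ (h.summable_garchCoefDeriv hθ hβ _ a)

lemma IsPastFactor.of_succ {V : ℤ → Ω → ℝ} (hV : IsPastFactor μ ε fun t => V (t + 1)) :
    IsPastFactor μ ε V := by
  simpa using hV.shift 1

lemma integrable_garchTilt (hθ : ∀ a, 0 < θ a) (hβ : ∑ j : Fin q, θ (Sum.inr j) < 1)
    [IsProbabilityMeasure μ] (hε : IsGarchInnovation μ ε) {ρ C K s : ℝ}
    (hρ : 0 < ρ) (hC : 0 < C) (hc : ∀ i, garchCoef θ i ≤ C * ρ ^ i) (hK : 0 < K) (hKρ : K * ρ < 1)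
    (hs : 0 < s) (hs1 : s ≤ 1) (hKs : K * ρ ^ s < 1)
    (hY : IsPastFactor μ ε fun t ω => X t ω ^ 2)
    (hpath : ∀ᵐ ω ∂μ, SubexpGrowth fun t => X t ω ^ 2) {C' : ℝ≥0∞} (hC' : C' ≠ ∞)
    (hmom : ∀ t, ∫⁻ ω, ‖X t ω ^ 2‖ₑ ^ s ∂μ ≤ C') (t : ℤ) :
    Integrable (fun ω => garchTilt θ K (fun s => X s ω) t) μ := by
  have hV := (isPastFactor_garchTilt hθ hβ hρ hc hK hKρ hY hpath).of_succ
    (V := fun t ω => garchTilt θ K (fun s => X s ω) t)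
  have hl : ∀ i, AEMeasurable (fun ω => lagSq (fun s => X s ω) t i) μ := fun i =>
    ((isPastFactor_lagSq hY i).of_succ
      (V := fun t ω => lagSq (fun s => X s ω) t i)).aemeasurable hε t
  have hnn : ∀ ω, 0 ≤ garchTilt θ K (fun s => X s ω) t := fun ω => garchTilt_nonneg hθ hβ hK _ t
  refine ⟨(hV.aemeasurable hε t).aestronglyMeasurable, ?_⟩
  rw [hasFiniteIntegral_iff_ofReal (ae_of_all _ hnn), lt_top_iff_ne_top]
  set g : ℕ → ℝ := fun i => (C / garchCoef θ 0) ^ s * (K * ρ ^ s) ^ i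
  have hc0 := garchCoef_zero_pos hθ hβ
  have hg : Summable g := (summable_geometric_of_lt_one (by positivity) hKs).mul_left _
  have hmom' : ∀ i, ∫⁻ ω, ‖lagSq (fun s => X s ω) t i‖ₑ ^ s ∂μ ≤ max 1 C' := by
    intro i
    rcases i with _ | i
    · simp [lagSq]
    · exact (hmom _).trans (le_max_right _ _)
  refine ne_top_of_le_ne_top (ENNReal.mul_ne_top hg.tsum_ofReal_ne_top
    (max_ne_top ENNReal.one_ne_top hC')) ?_
  calc ∫⁻ ω, ENNReal.ofReal (garchTilt θ K (fun s => X s ω) t) ∂μ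
      ≤ ∫⁻ ω, ∑' i, ENNReal.ofReal (g i) * ‖lagSq (fun s => X s ω) t i‖ₑ ^ s ∂μ := by
        refine lintegral_mono_ae (hpath.mono fun ω h => ?_)
        exact ofReal_garchTilt_le hθ hβ hρ hC hc hK hKρ hs hs1 h t
    _ = ∑' i, ENNReal.ofReal (g i) * ∫⁻ ω, ‖lagSq (fun s => X s ω) t i‖ₑ ^ s ∂μ := by
        rw [lintegral_tsum fun i => ((hl i).enorm.pow_const s).const_mul _]
        exact tsum_congr fun i => lintegral_const_mul'' _ ((hl i).enorm.pow_const s)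
    _ ≤ ∑' i, ENNReal.ofReal (g i) * max 1 C' := by
        refine ENNReal.tsum_le_tsum fun i => ?_
        gcongr
        exact hmom' i
    _ = _ := ENNReal.tsum_mul_right

lemma integrable_pow_mul_garchTilt (hθ : ∀ a, 0 < θ a) (hβ : ∑ j : Fin q, θ (Sum.inr j) < 1)
    (hε : IsGarchInnovation μ ε) {ρ C K : ℝ}
    (hρ : 0 < ρ) (hc : ∀ i, garchCoef θ i ≤ C * ρ ^ i) (hK : 0 < K) (hKρ : K * ρ < 1)
    (hY : IsPastFactor μ ε fun t ω => X t ω ^ 2)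
    (hpath : ∀ᵐ ω ∂μ, SubexpGrowth fun t => X t ω ^ 2)
    (hint : Integrable (fun ω => garchTilt θ K (fun s => X s ω) 0) μ) {k : ℕ}
    (hmom : Integrable (fun ω => |ε 0 ω| ^ k) μ) :
    Integrable (fun ω => |ε 0 ω| ^ k * garchTilt θ K (fun s => X s ω) 0) μ := by
  have hind := (isPastFactor_garchTilt hθ hβ hρ hc hK hKρ hY hpath).indepFun_innovation hε 0
  simp only [zero_sub, neg_add_cancel] at hind
  exact (hind.comp (φ := fun y : ℝ => |y| ^ k) (ψ := id) (by fun_prop) measurable_id).integrable_mul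
    hmom hint

end TiltMoment

/-! ### A law of large numbers uniform over bounded sets of directions. -/

section UniformLaw

variable {Ω : Type*} [MeasurableSpace Ω] {μ : Measure Ω}

/-- Convergence in probability from majorants that are small in mean off sets of small measure. -/
lemma tendstoInMeasure_zero_of_majorant [IsProbabilityMeasure μ] {Z r : ℕ → Ω → ℝ}
    (hZ : ∀ n ω, 0 ≤ Z n ω) (hr : TendstoInMeasure μ r atTop fun _ => 0)
    (h : ∀ τ : ℝ, 0 < τ → ∃ Y : ℕ → Ω → ℝ, (∀ n, Integrable (Y n) μ) ∧ (∀ (n : ℕ) (ω : Ω), 0 ≤ Y n ω) ∧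
      (∀ᶠ n in atTop, ∫ ω, Y n ω ∂μ ≤ τ) ∧
      ∀ᶠ n in atTop, μ.real {ω | Y n ω + r n ω < Z n ω} ≤ τ) :
    TendstoInMeasure μ Z atTop fun _ => 0 := by
  rw [tendstoInMeasure_iff_measureReal_norm] at hr ⊢
  intro η hη
  refine Metric.tendsto_atTop.2 fun τ₀ hτ₀ => ?_
  -- Markov's inequality at level η/2 turns a mean of at most ητ₀/8 into a probability of at most
  -- τ₀/4; three exceptional sets of this size stay below τ₀.
  obtain ⟨Y, hYi, hY0, hY1, hY2⟩ := h (min (τ₀ / 4) (η * τ₀ / 8)) (by positivity)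
  have hr' := (Metric.tendsto_atTop.1 (hr (η / 2) (by positivity))) (τ₀ / 4) (by positivity)
  obtain ⟨N, hN⟩ := hr'
  have key : ∀ᶠ n in atTop, dist (μ.real {ω | η ≤ ‖Z n ω - 0‖}) 0 < τ₀ := by
    filter_upwards [hY1, hY2, eventually_ge_atTop N] with n h1 h2 h3
    have h4 := hN n h3
    rw [Real.dist_eq, sub_zero, abs_of_nonneg measureReal_nonneg] at h4 ⊢
    have h5 : μ.real {ω | η / 2 ≤ Y n ω} ≤ τ₀ / 4 := by
      have := mul_meas_ge_le_integral_of_nonneg (ae_of_all _ (hY0 n)) (hYi n) (η / 2)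
      have h6 := this.trans (h1.trans (min_le_right _ _))
      have h7 : η / 2 * μ.real {ω | η / 2 ≤ Y n ω} ≤ η / 2 * (τ₀ / 4) := by linarith
      exact le_of_mul_le_mul_left h7 (by positivity)
    have hsub : {ω | η ≤ ‖Z n ω - 0‖} ⊆ ({ω | Y n ω + r n ω < Z n ω} ∪ {ω | η / 2 ≤ Y n ω}) ∪
        {ω | η / 2 ≤ ‖r n ω - 0‖} := by
      intro ω hω
      simp only [Set.mem_ofPred_eq, sub_zero, Real.norm_eq_abs, Set.mem_union] at hω ⊢
      rw [abs_of_nonneg (hZ n ω)] at hω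
      by_contra hcon
      push Not at hcon
      linarith [le_abs_self (r n ω)]
    have h8 := (measureReal_mono hsub (measure_ne_top μ _)).trans
      ((measureReal_union_le _ _).trans (add_le_add_left (measureReal_union_le _ _) _))
    have h9 := h2.trans (min_le_left _ _)
    linarith
  exact eventually_atTop.1 key

variable {ε : ℤ → Ω → ℝ} {ι : Type*} [Fintype ι]

lemma IsPastFactor.integrable [IsProbabilityMeasure μ] {V : ℤ → Ω → ℝ}
    (hV : IsPastFactor μ ε V) (hε : IsGarchInnovation μ ε) (hint : Integrable (V 0) μ) (t : ℤ) :
    Integrable (V t) μ := (hV.identDistrib hε t).integrable_iff.2 hint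

lemma IsPastFactor.integrable_abs_mean_sub [IsProbabilityMeasure μ] {V : ℤ → Ω → ℝ}
    (hV : IsPastFactor μ ε V) (hε : IsGarchInnovation μ ε) (hint : Integrable (V 0) μ) (n : ℕ)
    (c : ℝ) : Integrable (fun ω => |(n : ℝ)⁻¹ * ∑ t ∈ Finset.Icc 1 n, V t ω - c|) μ := by
  have h1 : Integrable (fun ω => ∑ t ∈ Finset.Icc 1 n, V t ω) μ :=
    integrable_finsetSum (f := fun (t : ℕ) ω => V t ω) _ fun t _ => hV.integrable hε hint t
  exact ((h1.const_mul _).sub (integrable_const c)).abs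

/-- Transfers the deviation at the centre of a small ball of directions to the whole ball, at a cost
proportional to the radius. -/
lemma abs_mean_sub_le_of_close {x y g : ℤ → ℝ} {a b L ρ : ℝ} (hρ : 0 ≤ ρ)
    (hxy : ∀ t, |x t - y t| ≤ ρ * g t) (hab : |b - a| ≤ ρ * L) (n : ℕ) :
    |(n : ℝ)⁻¹ * ∑ t ∈ Finset.Icc 1 n, x t - a| ≤ |(n : ℝ)⁻¹ * ∑ t ∈ Finset.Icc 1 n, y t - b| +
      ρ * (|(n : ℝ)⁻¹ * ∑ t ∈ Finset.Icc 1 n, g t - L| + 2 * L) := by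
  have hn : (0 : ℝ) ≤ (n : ℝ)⁻¹ := by positivity
  have h1 : |(n : ℝ)⁻¹ * ∑ t ∈ Finset.Icc 1 n, x t - (n : ℝ)⁻¹ * ∑ t ∈ Finset.Icc 1 n, y t| ≤
      ρ * ((n : ℝ)⁻¹ * ∑ t ∈ Finset.Icc 1 n, g t) := by
    rw [← mul_sub, ← Finset.sum_sub_distrib, abs_mul, abs_of_nonneg hn, mul_left_comm,
      Finset.mul_sum (a := ρ)]
    exact mul_le_mul_of_nonneg_left ((Finset.abs_sum_le_sum_abs _ _).trans
      (Finset.sum_le_sum fun t _ => hxy t)) hn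
  have h3 := mul_le_mul_of_nonneg_left
    (le_abs_self ((n : ℝ)⁻¹ * ∑ t ∈ Finset.Icc 1 n, g t - L)) hρ
  generalize (n : ℝ)⁻¹ * ∑ t ∈ Finset.Icc 1 n, x t = x' at *
  generalize (n : ℝ)⁻¹ * ∑ t ∈ Finset.Icc 1 n, y t = y' at *
  generalize (n : ℝ)⁻¹ * ∑ t ∈ Finset.Icc 1 n, g t = g' at *
  have h6 := abs_add_three (x' - y') (y' - b) (b - a)
  rw [show x' - y' + (y' - b) + (b - a) = x' - a by ring] at h6
  linarith

/-- The law of large numbers for `|∑ₐ W_{t,a} u_a|`, uniformly over bounded sets of vectors `u`. -/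
lemma exists_majorant_abs_linear_mean [IsProbabilityMeasure μ] (hε : IsGarchInnovation μ ε)
    {W : ι → ℤ → Ω → ℝ} (hW : ∀ a, IsPastFactor μ ε (W a)) (hWi : ∀ a, Integrable (W a 0) μ)
    (B : ℝ) {τ : ℝ} (hτ : 0 < τ) :
    ∃ Y : ℕ → Ω → ℝ, (∀ n, Integrable (Y n) μ) ∧ (∀ (n : ℕ) (ω : Ω), 0 ≤ Y n ω) ∧
      (∀ᶠ n in atTop, ∫ ω, Y n ω ∂μ ≤ τ) ∧
      ∀ (n : ℕ) (ω : Ω) (u : ι → ℝ), ‖u‖ ≤ B →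
        |(n : ℝ)⁻¹ * ∑ t ∈ Finset.Icc 1 n, |∑ a, W a t ω * u a| -
          ∫ ω, |∑ a, W a 0 ω * u a| ∂μ| ≤ Y n ω := by
  set V : (ι → ℝ) → ℤ → Ω → ℝ := fun u t ω => |∑ a, W a t ω * u a|
  set G : ℤ → Ω → ℝ := fun t ω => ∑ a, |W a t ω|
  have hV : ∀ u, IsPastFactor μ ε (V u) := fun u =>
    (IsPastFactor.sum Finset.univ fun a _ => (hW a).mul (.const (u a))).comp measurable_abs
  have hG : IsPastFactor μ ε G := IsPastFactor.sum Finset.univ fun a _ => (hW a).comp measurable_abs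
  have hV0 : ∀ u, Integrable (V u 0) μ := fun u =>
    (integrable_finsetSum _ fun a _ => (hWi a).mul_const (u a)).abs
  have hG0 : Integrable (G 0) μ := integrable_finsetSum _ fun a _ => (hWi a).abs
  have hVG : ∀ u v t ω, |V u t ω - V v t ω| ≤ ‖u - v‖ * G t ω := by
    intro u v t ω
    refine (abs_abs_sub_abs_le _ _).trans ?_
    rw [← Finset.sum_sub_distrib, Finset.mul_sum]
    refine (Finset.abs_sum_le_sum_abs _ _).trans (Finset.sum_le_sum fun a _ => ?_)
    rw [← mul_sub, abs_mul, mul_comm]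
    gcongr
    exact norm_le_pi_norm (u - v) a
  set L := ∫ ω, G 0 ω ∂μ with hLdef
  have hL : 0 ≤ L := integral_nonneg fun ω => Finset.sum_nonneg fun a _ => abs_nonneg _
  -- The radius of the covering balls: 2Lρ is the part of the error that does not vanish as n grows.
  obtain ⟨ρ, hρ, hρL⟩ : ∃ ρ : ℝ, 0 < ρ ∧ ρ * (2 * L) < τ := by
    refine ⟨τ / (2 * L + 1), by positivity, ?_⟩
    rw [div_mul_eq_mul_div, div_lt_iff₀ (by positivity)]
    nlinarith
  obtain ⟨N, -, hNfin, hN⟩ :=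
    (isCompact_closedBall (0 : ι → ℝ) B).finite_cover_balls hρ
  lift N to Finset (ι → ℝ) using hNfin
  set d : (ℤ → Ω → ℝ) → ℕ → Ω → ℝ := fun F n ω =>
    |(n : ℝ)⁻¹ * ∑ t ∈ Finset.Icc 1 n, F t ω - ∫ ω, F 0 ω ∂μ| with hd
  have hd0 : ∀ F n ω, 0 ≤ d F n ω := fun _ _ _ => abs_nonneg _
  have hdV : ∀ u n, Integrable (d (V u) n) μ := fun u n =>
    (hV u).integrable_abs_mean_sub hε (hV0 u) n _
  have hdG : ∀ n, Integrable (d G n) μ := fun n => hG.integrable_abs_mean_sub hε hG0 n _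
  have hYint : ∀ n, Integrable (fun ω => ∑ v ∈ N, d (V v) n ω + ρ * (d G n ω + 2 * L)) μ :=
    fun n => (integrable_finsetSum _ fun v _ => hdV v n).add
      (((hdG n).add (integrable_const _)).const_mul ρ)
  -- Finitely many centres and the envelope G give one integrable majorant for all u in the ball.
  -- Its bound is pathwise, so a random direction may be inserted and no supremum over u has to be
  -- measurable.
  refine ⟨fun n ω => ∑ v ∈ N, d (V v) n ω + ρ * (d G n ω + 2 * L), hYint, fun n ω => ?_, ?_, ?_⟩
  · have h1 := hd0 G n ω
    have h2 : 0 ≤ ∑ v ∈ N, d (V v) n ω := Finset.sum_nonneg fun v _ => hd0 _ _ _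
    positivity
  · have hlim : Tendsto (fun n => ∫ ω, (∑ v ∈ N, d (V v) n ω + ρ * (d G n ω + 2 * L)) ∂μ) atTop
        (𝓝 (∑ v ∈ N, 0 + ρ * (0 + 2 * L))) := by
      have h1 : ∀ n, ∫ ω, (∑ v ∈ N, d (V v) n ω + ρ * (d G n ω + 2 * L)) ∂μ =
          ∑ v ∈ N, ∫ ω, d (V v) n ω ∂μ + ρ * (∫ ω, d G n ω ∂μ + 2 * L) := by
        intro n
        have hi1 : Integrable (fun ω => ∑ v ∈ N, d (V v) n ω) μ :=
          integrable_finsetSum _ fun v _ => hdV v n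
        have hi2 : Integrable (fun ω => d G n ω + 2 * L) μ := (hdG n).add (integrable_const _)
        rw [integral_add hi1 (hi2.const_mul ρ), integral_finsetSum _ fun v _ => hdV v n,
          integral_const_mul, integral_add (hdG n) (integrable_const _)]
        simp
      simp only [h1]
      exact (tendsto_finsetSum _ fun v _ => (hV v).tendsto_integral_abs_mean_sub hε (hV0 v)).add
        (((hG.tendsto_integral_abs_mean_sub hε hG0).add_const _).const_mul ρ)
    rw [Finset.sum_const_zero, zero_add, zero_add] at hlim
    exact (hlim.eventually_lt_const hρL).mono fun _ h => h.le
  · intro n ω u hu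
    have hu' := hN (mem_closedBall_zero_iff.2 hu)
    simp only [Set.mem_iUnion, Finset.mem_coe, Metric.mem_ball, dist_eq_norm, exists_prop] at hu'
    obtain ⟨v, hvN, huv⟩ := hu'
    have hG' : ∀ t ω, 0 ≤ G t ω := fun t ω => Finset.sum_nonneg fun a _ => abs_nonneg _
    have h1 : ∀ t, |V u t ω - V v t ω| ≤ ρ * G t ω := fun t =>
      (hVG u v t ω).trans (mul_le_mul_of_nonneg_right huv.le (hG' t ω))
    have h2 : |∫ ω, V v 0 ω ∂μ - ∫ ω, V u 0 ω ∂μ| ≤ ρ * L := by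
      rw [← integral_sub (hV0 v) (hV0 u), hLdef, ← integral_const_mul]
      refine abs_integral_le_integral_abs.trans (integral_mono ((hV0 v).sub (hV0 u)).abs
        (hG0.const_mul ρ) fun ω => ?_)
      refine (hVG v u 0 ω).trans (mul_le_mul_of_nonneg_right ?_ (hG' 0 ω))
      rw [norm_sub_rev]
      exact huv.le
    have h3 : d (V v) n ω ≤ ∑ v ∈ N, d (V v) n ω :=
      Finset.single_le_sum (f := fun v => d (V v) n ω) (fun v _ => hd0 _ _ _) hvN
    refine (abs_mean_sub_le_of_close hρ.le h1 h2 n).trans ?_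
    exact add_le_add_left h3 _

end UniformLaw

/-! ### Convergence in probability of the residual process. -/

section EmpiricalProcess

/-- Since 1/√n = √n/n, scaling the sum of the b_t by 1/√n produces the empirical mean of √n b_t, to
which a law of large numbers can apply. -/
lemma abs_scaled_sum_sub_le {a b e : ℕ → ℝ} {κ ψ : ℝ} (hκ : 0 ≤ κ) {n : ℕ} (hn : 0 < n)
    (h : ∀ t, |a t - κ * b t| ≤ e t) :
    |1 / Real.sqrt n * ∑ t ∈ Finset.Icc 1 n, a t - κ * ψ| ≤
      (Real.sqrt n)⁻¹ * ∑ t ∈ Finset.Icc 1 n, e t +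
        κ * |(n : ℝ)⁻¹ * ∑ t ∈ Finset.Icc 1 n, Real.sqrt n * b t - ψ| := by
  have hs : 0 < Real.sqrt n := Real.sqrt_pos.2 (by exact_mod_cast hn)
  have h1 : (n : ℝ)⁻¹ * ∑ t ∈ Finset.Icc 1 n, Real.sqrt n * b t =
      (Real.sqrt n)⁻¹ * ∑ t ∈ Finset.Icc 1 n, b t := by
    rw [← Finset.mul_sum, ← mul_assoc]
    congr 1
    nth_rewrite 1 [← Real.sq_sqrt (Nat.cast_nonneg n)]
    field_simp
  have h2 : 1 / Real.sqrt n * ∑ t ∈ Finset.Icc 1 n, a t - κ * ψ =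
      (Real.sqrt n)⁻¹ * ∑ t ∈ Finset.Icc 1 n, (a t - κ * b t) +
        κ * ((Real.sqrt n)⁻¹ * ∑ t ∈ Finset.Icc 1 n, b t - ψ) := by
    rw [Finset.sum_sub_distrib, ← Finset.mul_sum]
    ring
  rw [h1, h2]
  refine (abs_add_le _ _).trans (add_le_add ?_ ?_)
  · rw [abs_mul, abs_of_pos (inv_pos.2 hs)]
    exact mul_le_mul_of_nonneg_left ((Finset.abs_sum_le_sum_abs _ _).trans
      (Finset.sum_le_sum fun t _ => h t)) (inv_pos.2 hs).le
  · rw [abs_mul, abs_of_nonneg hκ]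

variable {p q : ℕ} {θ : GarchParam p q}
variable {Ω : Type*} [MeasurableSpace Ω] {μ : Measure Ω} {ε σ X : ℤ → Ω → ℝ}

/-- The contribution of the observations before time `0` to the residuals, summed over time. -/
def garchRemainder (r : ℝ) (k : ℕ) (x : ℤ → ℝ) : ℝ :=
  (∑' m : ℕ, r ^ (m + 1) * lagSq x 0 (m + 1)) * ∑' n : ℕ, r ^ n * |x n| ^ k

lemma aemeasurable_real_tsum {f : ℕ → Ω → ℝ} (hf : ∀ i, AEMeasurable (f i) μ)
    (h : ∀ᵐ ω ∂μ, Summable fun i => f i ω) : AEMeasurable (fun ω => ∑' i, f i ω) μ :=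
  aemeasurable_of_tendsto_metrizable_ae atTop
    (fun n => Finset.aemeasurable_fun_sum (Finset.range n) fun i _ => hf i)
    (h.mono fun _ h => h.hasSum.tendsto_sum_nat)

lemma aemeasurable_garchRemainder (hX : ∀ t, Measurable (X t))
    (hpath : ∀ᵐ ω ∂μ, SubexpGrowth fun t => X t ω ^ 2) {r : ℝ} (hr : 0 < r) (hr1 : r < 1) (k : ℕ) :
    AEMeasurable (fun ω => garchRemainder r k fun s => X s ω) μ := by
  refine AEMeasurable.mul (aemeasurable_real_tsum (fun m => ?_) ?_)
    (aemeasurable_real_tsum (fun n => ?_) ?_)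
  · exact (((hX _).pow_const 2).const_mul _).aemeasurable
  · exact hpath.mono fun ω h => h.summable_pow_mul_lagSq hr hr1 0
  · exact (((measurable_abs.comp (hX _)).pow_const k).const_mul _).aemeasurable
  · exact hpath.mono fun ω h => h.summable_pow_mul_abs_pow hr hr1 k

lemma tendsto_inv_sqrt_nat : Tendsto (fun n : ℕ => (Real.sqrt n)⁻¹) atTop (𝓝 0) :=
  (Real.tendsto_sqrt_atTop.comp tendsto_natCast_atTop_atTop).inv_tendsto_atTop

lemma tendstoInMeasure_inv_sqrt_mul [IsProbabilityMeasure μ] {Y : Ω → ℝ} (hY : AEMeasurable Y μ) :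
    TendstoInMeasure μ (fun (n : ℕ) ω => (Real.sqrt n)⁻¹ * Y ω) atTop fun _ => 0 := by
  refine tendstoInMeasure_of_tendsto_ae (fun n => (hY.const_mul _).aestronglyMeasurable)
    (ae_of_all _ fun ω => ?_)
  simpa using tendsto_inv_sqrt_nat.mul_const (Y ω)

/-- Convergence in probability of the residual empirical process of a stationary GARCH process. -/
theorem tendstoInMeasure_residual [IsProbabilityMeasure μ] (hθ : ∀ a, 0 < θ a)
    (hβ : ∑ j : Fin q, θ (Sum.inr j) < 1) (hε : IsGarchInnovation μ ε) {lo : ℝ} (hlo : 0 < lo)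
    (hloθ : ∀ a, lo ≤ θ a) (hXm : ∀ t, Measurable (X t))
    (hpath : ∀ᵐ ω ∂μ, (SubexpGrowth fun t => X t ω ^ 2) ∧
      ∀ t, X t ω = Real.sqrt (garchSigmaSq θ (fun s => X s ω) t) * ε t ω)
    {ρ C K : ℝ} (hρ : 0 < ρ) (hC : 0 < C) (hc : ∀ i, garchCoef θ i ≤ C * ρ ^ i) (hK : 1 < K)
    (hKρ : K * ρ < 1) (k : ℕ)
    (hT : IsPastFactor μ ε fun t ω => |ε t ω| ^ k * garchTilt θ K (fun s => X s ω) t)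
    (hTi : Integrable (fun ω => |ε 0 ω| ^ k * garchTilt θ K (fun s => X s ω) 0) μ)
    (hW : ∀ a, IsPastFactor μ ε fun t ω => ε t ω ^ k * garchDLogSigmaSq θ (fun s => X s ω) t a)
    (hWi : ∀ a, Integrable (fun ω => ε 0 ω ^ k * garchDLogSigmaSq θ (fun s => X s ω) 0 a) μ)
    {θhat : ℕ → Ω → GarchParam p q}
    (hcons : IsBigOInProb μ (fun n ω => Real.sqrt n * ‖θhat n ω - θ‖)) :
    TendstoInMeasure μ
      (fun (n : ℕ) ω =>
        |1 / Real.sqrt n * ∑ t ∈ Finset.Icc 1 n,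
            |garchResidual (θhat n ω) (fun s => X s ω) t ^ k - ε t ω ^ k|
          - (k : ℝ) / 2 * garchPsi μ k θ ε X (Real.sqrt n • (θhat n ω - θ))|)
      atTop (fun _ => 0) := by
  obtain ⟨M, hM, L, hL, r, hr, hr1, δ₀, hδ₀, hexp⟩ :=
    exists_residual_expansion hθ hβ hρ hC hc k hK hKρ
  have hK0 : 0 < K := by linarith
  set T : ℤ → Ω → ℝ := fun t ω => |ε t ω| ^ k * garchTilt θ K (fun s => X s ω) t with hTdef
  have hT0 : ∀ t ω, 0 ≤ T t ω := fun t ω =>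
    mul_nonneg (by positivity) (garchTilt_nonneg hθ hβ hK0 _ t)
  have hTint : ∀ t, Integrable (T t) μ := fun t => hT.integrable hε hTi t
  have hTmean : ∀ t, ∫ ω, T t ω ∂μ = ∫ ω, T 0 ω ∂μ := fun t =>
    (hT.identDistrib hε t).integral_eq
  have hrem := tendstoInMeasure_inv_sqrt_mul (μ := μ)
    ((aemeasurable_garchRemainder hXm (hpath.mono fun _ h => h.1) hr hr1 k).const_mul L)
  refine tendstoInMeasure_zero_of_majorant (fun n ω => abs_nonneg _) hrem fun τ hτ => ?_
  obtain ⟨B, hB⟩ := hcons τ hτ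
  have hk : (0 : ℝ) ≤ k := k.cast_nonneg
  -- The level τ/(k+1) leaves at most τ/2 after multiplication by k/2.
  obtain ⟨Y, hYi, hY0, hY1, hYb⟩ :=
    exists_majorant_abs_linear_mean hε hW hWi B (τ := τ / (k + 1)) (by positivity)
  -- On the event √n‖θ̂ − θ‖ ≤ B, each coordinate satisfies |h_a| ≤ B/√n ≤ δ_n θ_a because θ_a ≥ lo.
  set δ : ℕ → ℝ := fun n => B / lo * (Real.sqrt n)⁻¹ with hδ
  have hδlim : Tendsto δ atTop (𝓝 0) := by
    simpa using tendsto_inv_sqrt_nat.const_mul (B / lo)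
  have hTs : ∀ n : ℕ, Integrable (fun ω => ∑ t ∈ Finset.Icc 1 n, T t ω) μ := fun n =>
    integrable_finsetSum (f := fun (t : ℕ) ω => T t ω) _ fun t _ => hTint t
  refine ⟨fun n ω => (Real.sqrt n)⁻¹ * (M * δ n ^ 2) * ∑ t ∈ Finset.Icc 1 n, T t ω +
    (k : ℝ) / 2 * Y n ω, fun n => ((hTs n).const_mul _).add ((hYi n).const_mul _),
    fun n ω => ?_, ?_, ?_⟩
  · have h1 : 0 ≤ ∑ t ∈ Finset.Icc 1 n, T t ω := Finset.sum_nonneg fun t _ => hT0 t ω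
    have h2 := hY0 n ω
    positivity
  · have hlim : Tendsto (fun n : ℕ => M * (B / lo) ^ 2 * (∫ ω, T 0 ω ∂μ) * (Real.sqrt n)⁻¹) atTop
        (𝓝 0) := by
      simpa using tendsto_inv_sqrt_nat.const_mul (M * (B / lo) ^ 2 * (∫ ω, T 0 ω ∂μ))
    filter_upwards [hY1, hlim.eventually_lt_const (half_pos hτ), eventually_gt_atTop 0]
      with n h1 h2 h3
    have hs : 0 < Real.sqrt n := Real.sqrt_pos.2 (by exact_mod_cast h3)
    rw [integral_add ((hTs n).const_mul _) ((hYi n).const_mul _), integral_const_mul,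
      integral_const_mul, integral_finsetSum (f := fun (t : ℕ) ω => T t ω) _ fun t _ => hTint t]
    simp only [hTmean, Finset.sum_const, Nat.card_Icc, Nat.add_sub_cancel, nsmul_eq_mul]
    -- Summing n equal means against n^{-1/2}δ_n², with δ_n² of order 1/n, leaves n^{-1/2}.
    have h4 : (Real.sqrt n)⁻¹ * (M * δ n ^ 2) * (n * ∫ ω, T 0 ω ∂μ) =
        M * (B / lo) ^ 2 * (∫ ω, T 0 ω ∂μ) * (Real.sqrt n)⁻¹ := by
      have h5 : (n : ℝ) = Real.sqrt n ^ 2 := (Real.sq_sqrt (Nat.cast_nonneg n)).symm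
      simp only [hδ]
      generalize ∫ ω, T 0 ω ∂μ = E
      generalize Real.sqrt (n : ℝ) = s at *
      rw [h5]
      field_simp
    rw [h4]
    have h6 : (k : ℝ) / 2 * ∫ ω, Y n ω ∂μ ≤ τ / 2 := by
      calc (k : ℝ) / 2 * ∫ ω, Y n ω ∂μ ≤ (k : ℝ) / 2 * (τ / (k + 1)) := by gcongr
        _ = τ / 2 * (k / (k + 1)) := by ring
        _ ≤ τ / 2 := mul_le_of_le_one_right (by positivity)
            ((div_le_one (by positivity)).2 (by linarith))
    linarith
  · filter_upwards [hB, hδlim.eventually_lt_const hδ₀, eventually_gt_atTop 0] with n h1 h2 h3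
    -- Almost surely the majorant can fail only when √n‖θ̂ − θ‖ exceeds B, an event of probability
    -- at most τ for large n.
    refine le_trans (ENNReal.toReal_mono (measure_ne_top μ _) (measure_mono_ae ?_)) h1
    filter_upwards [hpath] with ω hω
    refine fun (hlt : _ < _) => show B < Real.sqrt n * ‖θhat n ω - θ‖ from ?_
    by_contra hcon
    push Not at hcon
    refine absurd hlt (not_lt.2 ?_)
    have hs : 0 < Real.sqrt n := Real.sqrt_pos.2 (by exact_mod_cast h3)
    have hB0 : 0 ≤ B := le_trans (by positivity) hcon
    have hδn : 0 ≤ δ n := by positivity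
    set h : GarchParam p q := θhat n ω - θ with hh
    have hθh : θhat n ω = θ + h := by rw [hh]; abel
    have hhb : ∀ a, |h a| ≤ δ n * θ a := fun a => by
      calc |h a| ≤ ‖h‖ := norm_le_pi_norm h a
        _ ≤ B / lo * (Real.sqrt n)⁻¹ * lo := by
            rw [div_mul_eq_mul_div, div_mul_cancel₀ _ hlo.ne', ← div_eq_mul_inv, le_div_iff₀ hs]
            linarith
        _ ≤ δ n * θ a := mul_le_mul_of_nonneg_left (hloθ a) hδn
    have hres := hexp (fun s => X s ω) (fun s => ε s ω) hω.1 hω.2 (δ n) hδn h2.le h hhb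
    rw [hθh]
    refine (abs_scaled_sum_sub_le (by positivity) h3 hres).trans ?_
    have hY2 := hYb n ω (Real.sqrt n • h) (by
      rw [norm_smul, Real.norm_of_nonneg hs.le]; exact hcon)
    have hlin : ∀ t : ℕ, Real.sqrt n *
        |∑ a, ε t ω ^ k * garchDLogSigmaSq θ (fun s => X s ω) t a * h a| =
        |∑ a, ε t ω ^ k * garchDLogSigmaSq θ (fun s => X s ω) t a * (Real.sqrt n • h) a| := by
      intro t
      rw [← abs_of_pos hs, ← abs_mul, abs_of_pos hs, Finset.mul_sum]
      congr 1
      refine Finset.sum_congr rfl fun a _ => ?_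
      rw [Pi.smul_apply, smul_eq_mul]
      ring
    simp only [hlin]
    have hψ : |(n : ℝ)⁻¹ * ∑ t ∈ Finset.Icc 1 n,
        |∑ a, ε t ω ^ k * garchDLogSigmaSq θ (fun s => X s ω) t a * (Real.sqrt n • h) a| -
        garchPsi μ k θ ε X (Real.sqrt n • h)| ≤ Y n ω := hY2
    have hsum : ∑ t ∈ Finset.Icc 1 n, (M * δ n ^ 2 *
        (|ε t ω| ^ k * garchTilt θ K (fun s => X s ω) t) +
        L * ((∑' m : ℕ, r ^ (m + 1) * lagSq (fun s => X s ω) 0 (m + 1)) *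
          (r ^ t * |X t ω| ^ k))) ≤
        M * δ n ^ 2 * ∑ t ∈ Finset.Icc 1 n, T t ω +
          L * garchRemainder r k fun s => X s ω := by
      rw [Finset.sum_add_distrib, ← Finset.mul_sum, ← Finset.mul_sum, ← Finset.mul_sum]
      unfold garchRemainder
      have h0 : 0 ≤ ∑' m : ℕ, r ^ (m + 1) * lagSq (fun s => X s ω) 0 (m + 1) :=
        tsum_nonneg fun m => mul_nonneg (by positivity) (lagSq_nonneg _ _ _)
      gcongr
      exact (hω.1.summable_pow_mul_abs_pow hr hr1 k).sum_le_tsum _ fun t _ => by positivity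
    have h4 := mul_le_mul_of_nonneg_left hsum (inv_pos.2 hs).le
    have h5 := mul_le_mul_of_nonneg_left hψ (by positivity : 0 ≤ (k : ℝ) / 2)
    refine (add_le_add h4 h5).trans_eq ?_
    ring

end EmpiricalProcess

/-! ### Choice of the constants and conclusion. -/

theorem theorem1p3 {Ω : Type*} [MeasurableSpace Ω] (μ : Measure Ω) [IsProbabilityMeasure μ]
    (p q : ℕ) (hp : 1 ≤ p)
    (lo hi ρ₀ : ℝ) (hlo : 0 < lo) (hlohi : lo < hi) (hρ₀ : 0 < ρ₀) (hρ₁ : ρ₀ < 1)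
    (hqρ : (q : ℝ) * lo < ρ₀)
    (θ : GarchParam p q) (hθ : θ ∈ interior (garchParamSpace p q lo hi ρ₀))
    (ε σ X : ℤ → Ω → ℝ)
    (hε : IsGarchInnovation μ ε)
    (hγ : garchLyapunov μ θ ε < 0)
    (hX : IsStationaryGarch μ θ ε σ X)
    (hsmall : ∃ ζ : ℝ, 0 < ζ ∧
      Tendsto (fun x : ℝ => x ^ (-ζ) * μ.real {ω | |ε 0 ω| ≤ x}) (𝓝[>] 0) (𝓝 0))
    (est : (n : ℕ) → (Fin (n + 1) → ℝ) → GarchParam p q) (hest : ∀ n, Measurable (est n))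
    (θhat : ℕ → Ω → GarchParam p q)
    (hθhat : ∀ n ω, θhat n ω = est n (fun i => X ((i : ℕ) : ℤ) ω))
    (hcons : IsBigOInProb μ (fun n ω => Real.sqrt n * ‖θhat n ω - θ‖))
    (k : ℕ) (hk : 1 ≤ k) (hmom : Integrable (fun ω => |ε 0 ω| ^ k) μ) :
    (∀ᵐ ω ∂μ, Summable (fun i : ℕ => garchCoef θ (i + 1) * X (0 - ((i : ℤ) + 1)) ω ^ 2) ∧
      ∀ a, Summable (fun i : ℕ => garchCoefDeriv θ (i + 1) a * X (0 - ((i : ℤ) + 1)) ω ^ 2)) ∧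
    (∀ u, Integrable (garchPsiIntegrand k θ ε X u) μ) ∧
    TendstoInMeasure μ
      (fun (n : ℕ) ω =>
        |1 / Real.sqrt n * ∑ t ∈ Finset.Icc 1 n,
            |garchResidual (θhat n ω) (fun s => X s ω) t ^ k - ε t ω ^ k|
          - (k : ℝ) / 2 * garchPsi μ k θ ε X (Real.sqrt n • (θhat n ω - θ))|)
      atTop (fun _ => 0) := by
  obtain ⟨hΘ1, hΘ2⟩ := interior_subset hθ
  have hpos : ∀ a, 0 < θ a := fun a => hlo.trans_le (hΘ2 a).1
  have hβ : ∑ j : Fin q, θ (Sum.inr j) < 1 := hΘ1.trans_lt hρ₁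
  obtain ⟨hfac, s, hs0, hs1, C', hC', hstate⟩ := hX.exists_isPastFactor hε hγ hsmall
  have hY : IsPastFactor μ ε fun t ω => X t ω ^ 2 := by
    simpa [garchState] using hfac (Sum.inl ⟨0, hp⟩)
  have hXmom : ∀ t, ∫⁻ ω, ‖X t ω ^ 2‖ₑ ^ s ∂μ ≤ C' := fun t => by
    simpa [garchState] using hstate t (Sum.inl ⟨0, hp⟩)
  have hae := hX.ae_path hp hpos hβ hε hγ hsmall
  have hpath : ∀ᵐ ω ∂μ, SubexpGrowth fun t => X t ω ^ 2 := hae.mono fun _ h => h.1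
  obtain ⟨ρ, hρ, hρ1, C, hC, hc⟩ := garchCoef_le_geometric hpos hβ
  have hρs0 : 0 < ρ ^ s := Real.rpow_pos_of_pos hρ s
  have hρs1 : ρ ^ s < 1 := Real.rpow_lt_one hρ.le hρ1 hs0
  have hρρs : ρ ≤ ρ ^ s := by
    simpa using Real.rpow_le_rpow_of_exponent_ge hρ hρ1.le hs1
  -- K·ρ^s < 1 makes the tilt integrable. As ρ ≤ ρ^s, it also gives K·ρ < 1, needed for the pathwise
  -- convergence of the tilted series.
  obtain ⟨K, hK, hKs⟩ : ∃ K : ℝ, 1 < K ∧ K * ρ ^ s < 1 := by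
    refine ⟨(1 + (ρ ^ s)⁻¹) / 2, ?_, ?_⟩
    · linarith [(one_lt_inv₀ hρs0).2 hρs1]
    · have : (1 + (ρ ^ s)⁻¹) / 2 * ρ ^ s = (ρ ^ s + 1) / 2 := by field_simp
      linarith
  have hK0 : 0 < K := by linarith
  have hKρ : K * ρ < 1 := (mul_le_mul_of_nonneg_left hρρs hK0.le).trans_lt hKs
  have hTi := integrable_pow_mul_garchTilt hpos hβ hε hρ hc hK0 hKρ hY hpath
    (integrable_garchTilt hpos hβ hε hρ hC hc hK0 hKρ hs0 hs1 hKs hY hpath hC' hXmom 0) hmom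
  have hT : IsPastFactor μ ε fun t ω => |ε t ω| ^ k * garchTilt θ K (fun s => X s ω) t :=
    (IsPastFactor.innovation.comp (g := fun y => |y| ^ k) (by fun_prop)).mul
      (isPastFactor_garchTilt hpos hβ hρ hc hK0 hKρ hY hpath).of_succ
  have hW : ∀ a, IsPastFactor μ ε fun t ω =>
      ε t ω ^ k * garchDLogSigmaSq θ (fun s => X s ω) t a := fun a =>
    (IsPastFactor.innovation.comp (g := fun y => y ^ k) (by fun_prop)).mul
      (IsPastFactor.of_succ (V := fun t ω => garchDLogSigmaSq θ (fun s => X s ω) t a)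
        (isPastFactor_garchDLogSigmaSq hpos hβ hY hpath a))
  obtain ⟨B, -, hB⟩ := exists_abs_garchDLogSigmaSq_le hpos hβ hρ hc hK hKρ
  have hWi : ∀ a, Integrable (fun ω => ε 0 ω ^ k * garchDLogSigmaSq θ (fun s => X s ω) 0 a) μ := by
    intro a
    refine (hTi.const_mul B).mono' ((hW a).aemeasurable hε 0).aestronglyMeasurable
      (hpath.mono fun ω h => ?_)
    rw [Real.norm_eq_abs, abs_mul, abs_pow, mul_left_comm]
    exact mul_le_mul_of_nonneg_left (hB _ h 0 a) (by positivity)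
  refine ⟨hpath.mono fun ω h => ⟨h.summable_garchCoef hpos hβ 0, fun a =>
    (summable_nat_add_iff 1).2 (h.summable_garchCoefDeriv hpos hβ 0 a)⟩, fun u =>
    integrable_finsetSum _ fun a _ => (hWi a).mul_const (u a), ?_⟩
  exact tendstoInMeasure_residual hpos hβ hε hlo (fun a => (hΘ2 a).1) hX.measurable_X hae hρ hC hc
    hK hKρ k hT hTi hW hWi hcons

end
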